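/- **Notation.** Let $m,n\ge 0$ and $I(m|n)=\{-m,\dots,-1,1,\dots,n\}$; let $\mathbb Z^{m|n}$ be the set of functions $I(m|n)\to\mathbb Z$, on which $S_{m|n}=S_m\times S_n$ acts on the right by $f\cdot x=f\circ x$. Write $\mathrm{sgn}(i)$ for the sign of $i$, $d_i\in\mathbb Z^{m|n}$ for the function $j\mapsto \mathrm{sgn}(i)\delta_{i,j}$, $\mathrm{wt}(f)=\sum_i \mathrm{sgn}(i)\varepsilon_{f(i)}$ in the free abelian group on $\{\varepsilon_a\}_{a\in\mathbb Z}$ (the $\varepsilon_a$ being orthonormal), and $\#f=\frac12\bigl(m+n-\sum_{a}|(\mathrm{wt}(f),\varepsilon_a)|\bigr)$. Call $f$ typical if $\#f=0$, and dominant if $f(-m)<\dots<f(-1)$ and $f(1)>\dots>f(n)$; $\mathbb Z^{m|n}_+$ is the set of dominant $f$. Let $\mathscr U=U_q(\mathfrak{gl}_\infty)$ over $\mathbb Q(q)$, with generators $E_a,F_a,K_a^{\pm1}$ $(a\in\mathbb Z)$, bar involution the antilinear (that is, semilinear for $q\mapsto q^{-1}$) algebra automorphism with $\overline{E_a}=E_a$,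 $\overline{F_a}=F_a$, $\overline{K_a}=K_a^{-1}$, and comultiplication $\Delta(E_a)=1\otimes E_a+E_a\otimes K_{a+1}K_a^{-1}$, $\Delta(F_a)=K_aK_{a+1}^{-1}\otimes F_a+F_a\otimes 1$, $\Delta(K_a)=K_a\otimes K_a$. Let $\mathscr V$ have basis $\{v_a\}_{a\in\mathbb Z}$ with $K_av_b=q^{\delta_{a,b}}v_b$, $E_av_b=\delta_{a+1,b}v_a$, $F_av_b=\delta_{a,b}v_{a+1}$, and let $\mathscr W=\mathscr V^*$ have basis $\{w_a\}_{a\in\mathbb Z}$ with $K_aw_b=q^{-\delta_{a,b}}w_b$, $E_aw_b=\delta_{a,b}w_{a+1}$, $F_aw_b=\delta_{a+1,b}w_a$. Let $\mathscr T^{m|n}=\mathscr W^{\otimes m}\otimes\mathscr V^{\otimes n}$, with basis $M_f=w_{f(-m)}\otimes\dots\otimes w_{f(-1)}\otimes v_{f(1)}\otimes\dots\otimes v_{f(n)}$. Its completion $\widehat{\mathscr T}^{m|n}$ is the inverse limit over $e\in\mathbb Z$ of the (discrete) spaces spanned by those $M_f$ with all $f(i)\le e$. Let $s_i$ run over the basic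 transpositions of $S_{m|n}$. The Iwahori–Hecke algebra of $S_{m|n}$, with generators $H_i$ satisfying the braid relations and $H_i^2=1-(q-q^{-1})H_i$, acts on the right by $M_fH_i=q^{-1}M_f$ if $f\cdot s_i=f$, $M_fH_i=M_{f\cdot s_i}-(q-q^{-1})M_f$ if $f\cdot s_i\prec f$, and $M_fH_i=M_{f\cdot s_i}$ otherwise; here, if $s_i$ interchanges the neighbouring positions $k<l$, then $f\cdot s_i\prec f$ means $f(k)<f(l)$ when $k,l<0$, and $f(k)>f(l)$ when $k,l>0$. Let $w_0$ be the longest element of $S_{m|n}$, $\ell$ the length function, $H_0=\sum_{x\in S_{m|n}}(-q)^{\ell(x)-\ell(w_0)}H_x$, $\widehat{\mathscr E}^{m|n}=\widehat{\mathscr T}^{m|n}H_0$ with the subspace topology (the completion of $\mathscr E^{m|n}=\mathscr T^{m|n}H_0$), and $K_f=M_{f\cdot w_0}H_0$ for $f\in\mathbb Z^{m|n}_+$. For $g\in\mathbb Z^{m|n}$ conjugate under $S_{m|n}$ to a dominant function, let $g^+$ be that dominant function. For $i<0<j$ with $g(i)=g(j)$ put $\mathtt L_{i,j}(g)=g-a(d_i-d_j)$,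 where $a$ is the smallest positive integer such that $g-a(d_i-d_j)$ and all $\mathtt L_{k,l}(g)-a(d_i-d_j)$, for $i<k<0<l<j$ with $g(k)=g(l)$, are conjugate to dominant functions. For $f\in\mathbb Z^{m|n}_+$ and $r=\#f$, let $-m\le i_1<\dots<i_r<0<j_r<\dots<j_1\le n$ be the indices with $f(i_s)=f(j_s)$, and for $\theta\in\mathbb N^r$ put $|\theta|=\theta_1+\dots+\theta_r$, $$\mathtt L_\theta(f)=\bigl(\mathtt L_{i_r,j_r}^{\theta_r}\circ\dots\circ\mathtt L_{i_1,j_1}^{\theta_1}(f)\bigr)^+,\qquad \mathtt L'_\theta(f)=\bigl(\mathtt L_{i_1,j_1}^{\theta_1}\circ\dots\circ\mathtt L_{i_r,j_r}^{\theta_r}(f)\bigr)^+ .$$ **Theorem.** There is a unique continuous antilinear map $u\mapsto\overline u$ on $\widehat{\mathscr E}^{m|n}$ such that $\overline{K_f}=K_f$ for all typical $f\in\mathbb Z^{m|n}_+$ and $\overline{Xu}=\overline X\,\overline u$ for all $X\in\mathscr U$, $u\in\widehat{\mathscr E}^{m|n}$. There is a unique topological basis $\{U_f\}_{f\in\mathbb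 Z^{m|n}_+}$ of $\widehat{\mathscr E}^{m|n}$ (every element is, in a unique way, a convergent possibly infinite linear combination of the $U_f$) such that $\overline{U_f}=U_f$ and $U_f$ is equal to $K_f$ plus a (possibly infinite) $q\mathbb Z[q]$-linear combination of $K_g$'s, $g\in\mathbb Z^{m|n}_+$; it is called the canonical basis. For every $f\in\mathbb Z^{m|n}_+$ and $r=\#f$, (i) $\displaystyle U_f=\sum_{\theta\in\{0,1\}^r}q^{|\theta|}K_{\mathtt L_\theta(f)}$; (ii) $\displaystyle K_f=\sum_{\theta\in\mathbb N^r}(-q)^{|\theta|}U_{\mathtt L'_\theta(f)}$, a convergent sum in $\widehat{\mathscr E}^{m|n}$. -/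

import Mathlib

noncomputable section

namespace GLmn

/-- The index set `I(m|n) = {-m, …, -1, 1, …, n}`: the element `Sum.inl k` is `-m + k` and
`Sum.inr k` is `1 + k`. -/
abbrev Idx (m n : ℕ) : Type := Fin m ⊕ Fin n

/-- `ℤ^{m|n}`, the set of all functions `I(m|n) → ℤ`. -/
abbrev ZFun (m n : ℕ) : Type := Idx m n → ℤ

/-- The field `ℚ(q)`. -/
abbrev Qq : Type := RatFunc ℚ

/-- The indeterminate `q`. -/
abbrev q : Qq := RatFunc.X

variable {m n : ℕ}

/-- The number of indices to the left of a given one, in the usual order of `I(m|n)`. -/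
def pos : Idx m n → ℕ
  | Sum.inl k => k
  | Sum.inr k => m + k

/-- The sign of an index. -/
def sgn : Idx m n → ℤ
  | Sum.inl _ => -1
  | Sum.inr _ => 1

/-- The function `d_i : j ↦ sgn(i) δ_{i,j}`. -/
def d (i : Idx m n) : ZFun m n := Pi.single i (sgn i)

/-- The weight `wt(f) = ∑_i sgn(i) ε_{f(i)}`, in the free abelian group on `{ε_a : a ∈ ℤ}`. -/
def wt (f : ZFun m n) : ℤ →₀ ℤ := ∑ i, Finsupp.single (f i) (sgn i)

/-- The degree of atypicality `#f = (m + n - ∑_a |(wt(f), ε_a)|) / 2`. -/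
def atyp (f : ZFun m n) : ℕ :=
  (((m : ℤ) + n - (wt f).sum fun _ z => |z|) / 2).toNat

/-- `f` is typical if its degree of atypicality is zero. -/
def Typical (f : ZFun m n) : Prop := atyp f = 0

/-- `f` is dominant if `f(-m) < ⋯ < f(-1)` and `f(1) > ⋯ > f(n)`. -/
def Dominant (f : ZFun m n) : Prop :=
  StrictMono (fun k : Fin m => f (Sum.inl k)) ∧ StrictAnti (fun k : Fin n => f (Sum.inr k))

/-- `ℤ^{m|n}_+`, the set of dominant functions. -/
abbrev ZPlus (m n : ℕ) : Type := {f : ZFun m n // Dominant f}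

/-! ### The bar involution of the field -/

theorem eval_inv_injective :
    Function.Injective (Polynomial.eval₂RingHom (RatFunc.C : ℚ →+* Qq) q⁻¹) := by
  rw [injective_iff_map_eq_zero]
  intro p hp
  by_contra hne
  have h1 : (Polynomial.reverse p).eval₂ (RatFunc.C : ℚ →+* Qq) q = 0 := by
    have hX : (q : Qq) ≠ 0 := RatFunc.X_ne_zero
    let _ : Invertible ((q : Qq)⁻¹) := invertibleOfNonzero (inv_ne_zero hX)
    have h2 := Polynomial.eval₂_reverse_eq_zero_iff (RatFunc.C : ℚ →+* Qq) (q : Qq)⁻¹ p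
    have h3 : ⅟((q : Qq)⁻¹) = q := by simp
    rw [h3] at h2
    exact h2.2 hp
  have h2 : algebraMap (Polynomial ℚ) Qq p.reverse = 0 := by
    rw [← h1]
    have : ∀ r : Polynomial ℚ, algebraMap (Polynomial ℚ) Qq r = r.eval₂ RatFunc.C q := by
      intro r
      induction r using Polynomial.induction_on' with
      | add a b ha hb => rw [map_add, Polynomial.eval₂_add, ha, hb]
      | monomial k c => rw [Polynomial.eval₂_monomial, ← Polynomial.C_mul_X_pow_eq_monomial]; simp
    exact this _
  have h3 : p.reverse = 0 := (RatFunc.algebraMap_injective ℚ) (by rw [h2, map_zero])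
  exact hne (by simpa using h3)

/-- The field endomorphism `c ↦ c̄` of `ℚ(q)` with `q ↦ q⁻¹`. -/
def barQ : Qq →+* Qq :=
  RatFunc.liftRingHom (Polynomial.eval₂RingHom (RatFunc.C : ℚ →+* Qq) q⁻¹)
    (nonZeroDivisors_le_comap_nonZeroDivisors_of_injective _ eval_inv_injective)

theorem barQ_q : barQ q = q⁻¹ := by
  unfold barQ
  rw [RatFunc.liftRingHom_X]
  simp

/-! ### The completed tensor space -/

/-- The infinite linear combinations `∑_f c_f M_f` of the monomial basis vectors
`M_f = w_{f(-m)} ⊗ ⋯ ⊗ w_{f(-1)} ⊗ v_{f(1)} ⊗ ⋯ ⊗ v_{f(n)}` of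
`𝒯^{m|n} = 𝒲^{⊗ m} ⊗ 𝒱^{⊗ n}` all of whose truncations `π_{≤ e}`
(to those `f` all of whose values are `≤ e`) are finite sums. -/
def tHatSubmodule (m n : ℕ) : Submodule Qq (ZFun m n → Qq) where
  carrier := {c | ∀ e : ℤ, {f : ZFun m n | (∀ i, f i ≤ e) ∧ c f ≠ 0}.Finite}
  zero_mem' := by intro e; simp
  add_mem' := by
    intro a b ha hb e
    refine ((ha e).union (hb e)).subset ?_
    rintro f ⟨hf, hne⟩
    by_cases h : a f = 0
    · right
      refine ⟨hf, fun h' => hne ?_⟩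
      simp [h, h']
    · exact Or.inl ⟨hf, h⟩
  smul_mem' := by
    intro r a ha e
    refine (ha e).subset ?_
    rintro f ⟨hf, hne⟩
    exact ⟨hf, fun h' => hne (by simp [h'])⟩

/-- The completion of the tensor space `𝒯^{m|n}`, the inverse limit over `e` of the spaces
`𝒯^{m|n}_{≤ e}`. -/
def THat (m n : ℕ) : Type := tHatSubmodule m n

instance : AddCommGroup (THat m n) := inferInstanceAs (AddCommGroup (tHatSubmodule m n))

instance : Module Qq (THat m n) := inferInstanceAs (Module Qq (tHatSubmodule m n))

/-- The coefficients of an element of the completed tensor space. -/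
def coeff : THat m n →ₗ[Qq] (ZFun m n → Qq) := (tHatSubmodule m n).subtype

theorem coeff_injective : Function.Injective (coeff : THat m n → ZFun m n → Qq) :=
  Subtype.val_injective

theorem coeff_finite (u : THat m n) (e : ℤ) :
    {f : ZFun m n | (∀ i, f i ≤ e) ∧ coeff u f ≠ 0}.Finite := u.2 e

open Classical in
/-- The truncation `π_{≤ e}`, as a family of coefficients. -/
def trunc (e : ℤ) (u : THat m n) : ZFun m n → Qq :=
  fun f => if ∀ i, f i ≤ e then coeff u f else 0

/-- The inverse limit topology: the coarsest topology for which every truncation is continuous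
as a map to a discrete space. -/
instance : TopologicalSpace (THat m n) :=
  ⨅ e : ℤ, TopologicalSpace.induced (trunc e) ⊥

open Classical in
/-- The basis vector `M_f`. -/
def M (f : ZFun m n) : THat m n :=
  ⟨Pi.single f 1, fun e => (Set.finite_singleton f).subset (by
    rintro g ⟨-, hg⟩
    by_contra h
    exact hg (Pi.single_eq_of_ne h _))⟩

open Classical in
theorem coeff_M (f g : ZFun m n) : coeff (M f) g = if g = f then 1 else 0 := by
  change (Pi.single f (1 : Qq) : ZFun m n → Qq) g = _
  rw [Pi.single_apply]

/-- A linear operator on families of coefficients induces one on the completed tensor space. -/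
def mkOp (T : (ZFun m n → Qq) →ₗ[Qq] (ZFun m n → Qq))
    (hT : ∀ c ∈ tHatSubmodule m n, T c ∈ tHatSubmodule m n) : THat m n →ₗ[Qq] THat m n :=
  T.restrict hT

theorem coeff_mkOp (T : (ZFun m n → Qq) →ₗ[Qq] (ZFun m n → Qq))
    (hT : ∀ c ∈ tHatSubmodule m n, T c ∈ tHatSubmodule m n) (u : THat m n) :
    coeff (mkOp T hT u) = T (coeff u) := rfl

/-! ### The action of the quantum group

`U_q(𝔤𝔩_∞)` is generated by `E_a, F_a, K_a^{±1}`; it acts on `𝒱` and `𝒲 = 𝒱^*` by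
`K_a v_b = q^{δ_{a,b}} v_b`, `E_a v_b = δ_{a+1,b} v_a`, `F_a v_b = δ_{a,b} v_{a+1}`,
`K_a w_b = q^{-δ_{a,b}} w_b`, `E_a w_b = δ_{a,b} w_{a+1}`, `F_a w_b = δ_{a+1,b} w_a`,
and on tensor products through
`Δ(E_a) = 1 ⊗ E_a + E_a ⊗ K_{a+1} K_a⁻¹`, `Δ(F_a) = K_a K_{a+1}⁻¹ ⊗ F_a + F_a ⊗ 1`,
`Δ(K_a) = K_a ⊗ K_a`. -/

/-- `E_a` does not kill the tensor factor of `M_f` in position `k`. -/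
def EActs (a : ℤ) (f : ZFun m n) : Idx m n → Prop
  | Sum.inl i => f (Sum.inl i) = a
  | Sum.inr j => f (Sum.inr j) = a + 1

/-- `F_a` does not kill the tensor factor of `M_f` in position `k`. -/
def FActs (a : ℤ) (f : ZFun m n) : Idx m n → Prop
  | Sum.inl i => f (Sum.inl i) = a + 1
  | Sum.inr j => f (Sum.inr j) = a

/-- The exponent of `q` by which `K_b K_c⁻¹` scales the tensor factor of `M_f` in position `i`. -/
def kExp (b c : ℤ) (f : ZFun m n) (i : Idx m n) : ℤ :=
  sgn i * ((if f i = b then 1 else 0) - (if f i = c then 1 else 0))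

/-- `K_{a+1} K_a⁻¹` acts on all tensor factors to the right of position `k`. -/
def eExp (a : ℤ) (f : ZFun m n) (k : Idx m n) : ℤ :=
  ∑ i with pos k < pos i, kExp (a + 1) a f i

/-- `K_a K_{a+1}⁻¹` acts on all tensor factors to the left of position `k`. -/
def fExp (a : ℤ) (f : ZFun m n) (k : Idx m n) : ℤ :=
  ∑ i with pos i < pos k, kExp a (a + 1) f i

open Classical in
/-- The operator `M_f ↦ ∑_k q^{e(f,k)} M_{f - d_k}`, sum over the positions `k` on which `E_a`
acts, on coefficients. -/
def EFun (a : ℤ) : (ZFun m n → Qq) →ₗ[Qq] (ZFun m n → Qq) where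
  toFun c g := ∑ k, if EActs a (g + d k) k then q ^ eExp a (g + d k) k * c (g + d k) else 0
  map_add' b c := by
    funext g
    simp only [Pi.add_apply, ← Finset.sum_add_distrib]
    refine Finset.sum_congr rfl fun k _ => ?_
    split_ifs <;> ring
  map_smul' r c := by
    funext g
    simp only [Pi.smul_apply, smul_eq_mul, RingHom.id_apply, Finset.mul_sum]
    refine Finset.sum_congr rfl fun k _ => ?_
    split_ifs <;> ring

open Classical in
/-- The operator `M_f ↦ ∑_k q^{e(f,k)} M_{f + d_k}`, sum over the positions `k` on which `F_a`
acts, on coefficients. -/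
def FFun (a : ℤ) : (ZFun m n → Qq) →ₗ[Qq] (ZFun m n → Qq) where
  toFun c g := ∑ k, if FActs a (g - d k) k then q ^ fExp a (g - d k) k * c (g - d k) else 0
  map_add' b c := by
    funext g
    simp only [Pi.add_apply, ← Finset.sum_add_distrib]
    refine Finset.sum_congr rfl fun k _ => ?_
    split_ifs <;> ring
  map_smul' r c := by
    funext g
    simp only [Pi.smul_apply, smul_eq_mul, RingHom.id_apply, Finset.mul_sum]
    refine Finset.sum_congr rfl fun k _ => ?_
    split_ifs <;> ring

theorem mem_of_shift {c c' : ZFun m n → Qq} (hc : c ∈ tHatSubmodule m n)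
    (σ : Idx m n → ZFun m n) (N : ℤ) (hσ : ∀ k i, σ k i ≤ N)
    (h : ∀ g, c' g ≠ 0 → ∃ k, c (g + σ k) ≠ 0) : c' ∈ tHatSubmodule m n := by
  intro e
  have hfin : (⋃ k : Idx m n, (fun g : ZFun m n => g + σ k) ⁻¹'
      {f | (∀ i, f i ≤ e + N) ∧ c f ≠ 0}).Finite :=
    Set.finite_iUnion fun k => (hc (e + N)).preimage (fun a _ b _ hab => add_right_cancel hab)
  refine hfin.subset ?_
  rintro g ⟨hg, hne⟩
  obtain ⟨k, hk⟩ := h g hne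
  exact Set.mem_iUnion.2 ⟨k, fun i => add_le_add (hg i) (hσ k i), hk⟩

theorem abs_d_le (k i : Idx m n) : |d k i| ≤ 1 := by
  unfold d
  rw [Pi.single_apply]
  split_ifs
  · cases k <;> simp [sgn]
  · simp

open Classical in
theorem EFun_mem (a : ℤ) (c : ZFun m n → Qq) (hc : c ∈ tHatSubmodule m n) :
    EFun a c ∈ tHatSubmodule m n := by
  refine mem_of_shift hc d 1 (fun k i => (abs_le.1 (abs_d_le k i)).2) fun g hg => ?_
  replace hg : (∑ k, if EActs a (g + d k) k then q ^ eExp a (g + d k) k * c (g + d k) else 0) ≠ 0 :=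
    hg
  obtain ⟨k, -, hk⟩ := Finset.exists_ne_zero_of_sum_ne_zero hg
  refine ⟨k, fun h0 => hk ?_⟩
  simp [h0]

open Classical in
theorem FFun_mem (a : ℤ) (c : ZFun m n → Qq) (hc : c ∈ tHatSubmodule m n) :
    FFun a c ∈ tHatSubmodule m n := by
  refine mem_of_shift hc (fun k => - d k) 1
    (fun k i => by have := (abs_le.1 (abs_d_le k i)).1; simp only [Pi.neg_apply]; linarith)
    fun g hg => ?_
  replace hg : (∑ k, if FActs a (g - d k) k then q ^ fExp a (g - d k) k * c (g - d k) else 0) ≠ 0 :=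
    hg
  obtain ⟨k, -, hk⟩ := Finset.exists_ne_zero_of_sum_ne_zero hg
  refine ⟨k, fun h0 => hk ?_⟩
  rw [← sub_eq_add_neg] at h0
  simp [h0]

/-- The action of `E_a` on the completed tensor space. -/
def E (a : ℤ) : THat m n →ₗ[Qq] THat m n := mkOp (EFun a) (EFun_mem a)

/-- The action of `F_a` on the completed tensor space. -/
def F (a : ℤ) : THat m n →ₗ[Qq] THat m n := mkOp (FFun a) (FFun_mem a)

/-- The action of `K_a ^ s` for `s = ±1`: the vector `M_f` has weight `wt(f)`. -/
def KFun (a s : ℤ) : (ZFun m n → Qq) →ₗ[Qq] (ZFun m n → Qq) where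
  toFun c g := q ^ (s * wt g a) * c g
  map_add' b c := by funext g; simp [mul_add]
  map_smul' r c := by funext g; simp; ring

theorem KFun_mem (a s : ℤ) (c : ZFun m n → Qq) (hc : c ∈ tHatSubmodule m n) :
    KFun a s c ∈ tHatSubmodule m n := by
  intro e
  refine (hc e).subset ?_
  rintro f ⟨hf, hne⟩
  exact ⟨hf, fun h' => hne (by simp [KFun, h'])⟩

/-- The action of `K_a` on the completed tensor space. -/
def Kact (a : ℤ) : THat m n →ₗ[Qq] THat m n := mkOp (KFun a 1) (KFun_mem a 1)

/-- The action of `K_a⁻¹` on the completed tensor space. -/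
def KactInv (a : ℤ) : THat m n →ₗ[Qq] THat m n := mkOp (KFun a (-1)) (KFun_mem a (-1))

open Classical in
theorem E_M (a : ℤ) (f : ZFun m n) :
    E a (M f) = ∑ k with EActs a f k, q ^ eExp a f k • M (f - d k) := by
  apply coeff_injective
  funext g
  rw [map_sum, Finset.sum_apply, Finset.sum_filter]
  change (∑ k, if EActs a (g + d k) k then q ^ eExp a (g + d k) k * coeff (M f) (g + d k) else 0) = _
  refine Finset.sum_congr rfl fun k _ => ?_
  rw [coeff_M, map_smul, Pi.smul_apply, coeff_M]
  by_cases h : g = f - d k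
  · subst h
    simp
  · have h' : g + d k ≠ f := fun h' => h (eq_sub_of_add_eq h')
    simp [h, h']

open Classical in
theorem F_M (a : ℤ) (f : ZFun m n) :
    F a (M f) = ∑ k with FActs a f k, q ^ fExp a f k • M (f + d k) := by
  apply coeff_injective
  funext g
  rw [map_sum, Finset.sum_apply, Finset.sum_filter]
  change (∑ k, if FActs a (g - d k) k then q ^ fExp a (g - d k) k * coeff (M f) (g - d k) else 0) = _
  refine Finset.sum_congr rfl fun k _ => ?_
  rw [coeff_M, map_smul, Pi.smul_apply, coeff_M]
  by_cases h : g = f + d k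
  · subst h
    simp
  · have h' : g - d k ≠ f := fun h' => h (eq_add_of_sub_eq h')
    simp [h, h']

/-! ### The action of the Iwahori-Hecke algebra -/

/-- `S_{m|n} = S_m × S_n`. -/
abbrev Smn (m n : ℕ) : Type := Equiv.Perm (Fin m) × Equiv.Perm (Fin n)

/-- The right action `f · x = f ∘ x` of `S_{m|n}` on `ℤ^{m|n}`. -/
def act (f : ZFun m n) (x : Smn m n) : ZFun m n := f ∘ Sum.map x.1 x.2

/-- The positions `m-1, n-1` of the basic transpositions. -/
abbrev SIdx (m n : ℕ) : Type := Fin (m - 1) ⊕ Fin (n - 1)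

/-- The left one of the two neighbouring positions interchanged by a basic transposition. -/
def lo : SIdx m n → Idx m n
  | Sum.inl k => Sum.inl ⟨k, by omega⟩
  | Sum.inr k => Sum.inr ⟨k, by omega⟩

/-- The right one of the two neighbouring positions interchanged by a basic transposition. -/
def hi : SIdx m n → Idx m n
  | Sum.inl k => Sum.inl ⟨k + 1, by omega⟩
  | Sum.inr k => Sum.inr ⟨k + 1, by omega⟩

/-- The basic transpositions. -/
def simpleRefl : SIdx m n → Smn m n
  | Sum.inl k => (Equiv.swap ⟨k, by omega⟩ ⟨k + 1, by omega⟩, 1)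
  | Sum.inr k => (1, Equiv.swap ⟨k, by omega⟩ ⟨k + 1, by omega⟩)

theorem simpleRefl_generate (x : Smn m n) :
    ∃ w : List (SIdx m n), (w.map simpleRefl).prod = x := by
  have key : ∀ k : ℕ, ∀ x : Equiv.Perm (Fin k), x ∈ Submonoid.closure (Set.range
      fun i : Fin (k - 1) => Equiv.swap (⟨i, by omega⟩ : Fin k) ⟨i + 1, by omega⟩) := by
    intro k x
    rcases k with _ | k
    · rw [Subsingleton.elim x 1]
      exact Submonoid.one_mem _
    · have h : x ∈ Submonoid.closure
          (Set.range fun i : Fin k => Equiv.swap i.castSucc i.succ) := by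
        rw [Equiv.Perm.mclosure_swap_castSucc_succ]; trivial
      exact h
  have h1 : ∀ x : Equiv.Perm (Fin m), ∃ w : List (SIdx m n),
      (w.map simpleRefl).prod = (x, 1) := by
    intro x
    induction key m x using Submonoid.closure_induction with
    | mem y hy =>
      obtain ⟨i, rfl⟩ := hy
      exact ⟨[Sum.inl i], by simp [simpleRefl]⟩
    | one => exact ⟨[], rfl⟩
    | mul y z _ _ hy hz =>
      obtain ⟨v, hv⟩ := hy
      obtain ⟨w, hw⟩ := hz
      exact ⟨v ++ w, by simp [hv, hw]⟩
  have h2 : ∀ x : Equiv.Perm (Fin n), ∃ w : List (SIdx m n),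
      (w.map simpleRefl).prod = (1, x) := by
    intro x
    induction key n x using Submonoid.closure_induction with
    | mem y hy =>
      obtain ⟨i, rfl⟩ := hy
      exact ⟨[Sum.inr i], by simp [simpleRefl]⟩
    | one => exact ⟨[], rfl⟩
    | mul y z _ _ hy hz =>
      obtain ⟨v, hv⟩ := hy
      obtain ⟨w, hw⟩ := hz
      exact ⟨v ++ w, by simp [hv, hw]⟩
  obtain ⟨v, hv⟩ := h1 x.1
  obtain ⟨w, hw⟩ := h2 x.2
  exact ⟨v ++ w, by simp [hv, hw]⟩

/-- `w` is a reduced expression of `x`. -/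
def IsReducedWord (w : List (SIdx m n)) (x : Smn m n) : Prop :=
  (w.map simpleRefl).prod = x ∧
    ∀ w' : List (SIdx m n), (w'.map simpleRefl).prod = x → w.length ≤ w'.length

theorem exists_reducedWord (x : Smn m n) : ∃ w : List (SIdx m n), IsReducedWord w x := by
  classical
  have h : ∃ k, ∃ w : List (SIdx m n), (w.map simpleRefl).prod = x ∧ w.length = k := by
    obtain ⟨w, hw⟩ := simpleRefl_generate x
    exact ⟨_, w, hw, rfl⟩
  obtain ⟨w, hw, hl⟩ := Nat.find_spec h
  exact ⟨w, hw, fun w' hw' => hl ▸ Nat.find_min' h ⟨w', hw', rfl⟩⟩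

/-- A reduced expression of `x`. -/
def reducedWord (x : Smn m n) : List (SIdx m n) := (exists_reducedWord x).choose

/-- The length function on `S_{m|n}`. -/
def len (x : Smn m n) : ℕ := (reducedWord x).length

/-- The longest element of `S_{m|n}`. -/
def w0 : Smn m n := (Fin.revPerm, Fin.revPerm)

/-- `f · s_i` is smaller than `f` in the Bruhat ordering. -/
def Descends (f : ZFun m n) : SIdx m n → Prop
  | Sum.inl k => f (lo (Sum.inl k)) < f (hi (Sum.inl k))
  | Sum.inr k => f (hi (Sum.inr k)) < f (lo (Sum.inr k))

open Classical in
/-- The right action of the generator `H_i`, on coefficients. -/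
def HFun (i : SIdx m n) : (ZFun m n → Qq) →ₗ[Qq] (ZFun m n → Qq) where
  toFun c g :=
    if act g (simpleRefl i) = g then q⁻¹ * c g
    else c (act g (simpleRefl i)) - if Descends g i then (q - q⁻¹) * c g else 0
  map_add' b c := by
    funext g
    simp only [Pi.add_apply]
    split_ifs <;> ring
  map_smul' r c := by
    funext g
    simp only [Pi.smul_apply, smul_eq_mul, RingHom.id_apply]
    split_ifs <;> ring

theorem act_simpleRefl (g : ZFun m n) (i : SIdx m n) :
    act g (simpleRefl i) = g ∘ Equiv.swap (lo i) (hi i) := by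
  funext j
  simp only [act, Function.comp_apply]
  congr 1
  rcases i with i | i <;> rcases j with j | j <;>
    simp [simpleRefl, lo, hi, Equiv.swap_apply_def] <;> split_ifs <;> rfl

theorem HFun_mem (i : SIdx m n) (c : ZFun m n → Qq) (hc : c ∈ tHatSubmodule m n) :
    HFun i c ∈ tHatSubmodule m n := by
  intro e
  refine ((hc e).union ((hc e).preimage
    (f := fun g : ZFun m n => g ∘ Equiv.swap (lo i) (hi i)) ?_)).subset ?_
  · intro a _ b _ hab
    exact (Equiv.swap (lo i) (hi i)).surjective.injective_comp_right hab
  · rintro g ⟨hg, hne⟩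
    by_cases h1 : c g = 0
    · right
      refine ⟨fun j => hg _, fun h2 => hne ?_⟩
      change c (g ∘ Equiv.swap (lo i) (hi i)) = 0 at h2
      rw [← act_simpleRefl] at h2
      simp [HFun, h1, h2]
    · exact Or.inl ⟨hg, h1⟩

/-- The right action of the generator `H_i` on the completed tensor space. -/
def H (i : SIdx m n) : THat m n →ₗ[Qq] THat m n := mkOp (HFun i) (HFun_mem i)

open Classical in
theorem H_M (f : ZFun m n) (i : SIdx m n) :
    H i (M f) =
      if act f (simpleRefl i) = f then q⁻¹ • M f
      else if Descends f i then M (act f (simpleRefl i)) - (q - q⁻¹) • M f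
      else M (act f (simpleRefl i)) := by
  have hinv : ∀ g : ZFun m n, act (act g (simpleRefl i)) (simpleRefl i) = g := by
    intro g
    rw [act_simpleRefl, act_simpleRefl]
    funext j
    simp
  apply coeff_injective
  funext g
  change (if act g (simpleRefl i) = g then q⁻¹ * coeff (M f) g
    else coeff (M f) (act g (simpleRefl i)) -
      if Descends g i then (q - q⁻¹) * coeff (M f) g else 0) = _
  by_cases hgf : g = f
  · subst hgf
    by_cases h1 : act g (simpleRefl i) = g
    · simp [h1, coeff_M]
    · have h1' : ¬ g = act g (simpleRefl i) := fun h => h1 h.symm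
      by_cases h2 : Descends g i <;> simp [h1, h1', h2, coeff_M]
  · by_cases hgf2 : g = act f (simpleRefl i)
    · subst hgf2
      have h3 : ¬ act f (simpleRefl i) = f := hgf
      have h4 : ¬ f = act f (simpleRefl i) := fun h => h3 h.symm
      rw [hinv, if_neg h4, if_neg h3]
      by_cases h2 : Descends f i <;> simp [h3, h2, coeff_M]
    · have h5 : ¬ act g (simpleRefl i) = f := fun h => hgf2 (by rw [← h, hinv])
      split_ifs <;> simp [coeff_M, hgf, hgf2, h5]

/-! ### The two actions commute -/

theorem lo_ne_hi (i : SIdx m n) : lo i ≠ hi i := by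
  rcases i with i | i <;> simp [lo, hi]

theorem sgn_lo_eq (i : SIdx m n) : sgn (lo i) = sgn (hi i) := by
  rcases i with i | i <;> rfl

theorem act_eq_iff (g : ZFun m n) (i : SIdx m n) :
    act g (simpleRefl i) = g ↔ g (lo i) = g (hi i) := by
  rw [act_simpleRefl]
  constructor
  · intro h
    have := congrFun h (lo i)
    simpa using this.symm
  · intro h
    funext j
    by_cases h1 : j = lo i
    · subst h1; simp [h]
    · by_cases h2 : j = hi i
      · subst h2; simp [h]
      · simp [Equiv.swap_apply_of_ne_of_ne h1 h2]

open Classical in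
theorem comm_aux (i : SIdx m n) (t : ℤ) (τ : Idx m n → ZFun m n)
    (hlo : τ (lo i) = Pi.single (lo i) t) (hhi : τ (hi i) = Pi.single (hi i) t)
    (hτ : ∀ k, k ≠ lo i → k ≠ hi i → τ k (lo i) = 0 ∧ τ k (hi i) = 0)
    (φ : ZFun m n → Idx m n → Qq)
    (hφ : ∀ g k, k ≠ lo i → k ≠ hi i → φ (act g (simpleRefl i)) k = φ g k)
    (e : ZFun m n → Qq) (he : ∀ g, e (act g (simpleRefl i)) = e g)
    (P Q : ℤ → ℤ → Qq) (hP : ∀ g, φ g (lo i) = e g * P (g (lo i)) (g (hi i)))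
    (hQ : ∀ g, φ g (hi i) = e g * Q (g (lo i)) (g (hi i)))
    (D : ℤ → ℤ → Prop) (hD : ∀ g : ZFun m n, Descends g i ↔ D (g (lo i)) (g (hi i)))
    (hid : ∀ (x y : ℤ) (C : ℤ → ℤ → Qq),
      P x y * (if x + t = y then q⁻¹ * C (x + t) y else
        C y (x + t) - if D (x + t) y then (q - q⁻¹) * C (x + t) y else 0) +
      Q x y * (if x = y + t then q⁻¹ * C x (y + t) else
        C (y + t) x - if D x (y + t) then (q - q⁻¹) * C x (y + t) else 0) =
      if x = y then q⁻¹ * (P x y * C (x + t) y + Q x y * C x (y + t)) else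
        (P y x * C (y + t) x + Q y x * C y (x + t)) -
          if D x y then (q - q⁻¹) * (P x y * C (x + t) y + Q x y * C x (y + t)) else 0)
    (T : (ZFun m n → Qq) →ₗ[Qq] (ZFun m n → Qq))
    (hT : ∀ c g, T c g = ∑ k, φ g k * c (g + τ k)) (c : ZFun m n → Qq) :
    T (HFun i c) = HFun i (T c) := by
  funext g
  have hne := lo_ne_hi i
  set s := Equiv.swap (lo i) (hi i) with hs
  have hH : ∀ (c : ZFun m n → Qq) (g : ZFun m n), HFun i c g =
      if g (lo i) = g (hi i) then q⁻¹ * c g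
      else c (g ∘ s) - if D (g (lo i)) (g (hi i)) then (q - q⁻¹) * c g else 0 := by
    intro c g
    rw [hs, ← act_simpleRefl]
    change (if act g (simpleRefl i) = g then q⁻¹ * c g else c (act g (simpleRefl i)) -
      if Descends g i then (q - q⁻¹) * c g else 0) = _
    by_cases h1 : g (lo i) = g (hi i)
    · rw [if_pos h1, if_pos ((act_eq_iff g i).2 h1)]
    · rw [if_neg h1, if_neg (fun h => h1 ((act_eq_iff g i).1 h))]
      by_cases h2 : Descends g i
      · rw [if_pos h2, if_pos ((hD g).1 h2)]
      · rw [if_neg h2, if_neg (fun h => h2 ((hD g).2 h))]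
  set C : ℤ → ℤ → Qq := fun x y => c (Function.update (Function.update g (lo i) x) (hi i) y)
    with hC
  have hCg : ∀ (h : ZFun m n), (∀ k, k ≠ lo i → k ≠ hi i → h k = g k) →
      c h = C (h (lo i)) (h (hi i)) := by
    intro h hh
    simp only [hC]
    congr 1
    funext k
    by_cases h2 : k = hi i
    · subst h2; simp
    · by_cases h1 : k = lo i
      · subst h1; simp [hne]
      · simp [h1, h2, hh k h1 h2]
  have hso : ∀ k, k ≠ lo i → k ≠ hi i → s k = k := fun k h1 h2 =>
    Equiv.swap_apply_of_ne_of_ne h1 h2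
  have hsl : s (lo i) = hi i := Equiv.swap_apply_left _ _
  have hsh : s (hi i) = lo i := Equiv.swap_apply_right _ _
  have split : ∀ f : Idx m n → Qq, ∑ k, f k = (f (lo i) + f (hi i)) +
      ∑ k ∈ (Finset.univ.erase (lo i)).erase (hi i), f k := by
    intro f
    rw [← Finset.add_sum_erase _ f (Finset.mem_univ (lo i)),
      ← Finset.add_sum_erase _ f (Finset.mem_erase.2 ⟨hne.symm, Finset.mem_univ (hi i)⟩)]
    ring
  have hφ' : ∀ g k, k ≠ lo i → k ≠ hi i → φ (g ∘ s) k = φ g k := by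
    intro g k h1 h2
    rw [hs, ← act_simpleRefl, hφ g k h1 h2]
  have he' : ∀ g, e (g ∘ s) = e g := by
    intro g
    rw [hs, ← act_simpleRefl, he]
  have hτs : ∀ k, k ≠ lo i → k ≠ hi i → (g + τ k) ∘ s = g ∘ s + τ k := by
    intro k h1 h2
    obtain ⟨h3, h4⟩ := hτ k h1 h2
    funext j
    simp only [Function.comp_apply, Pi.add_apply]
    by_cases h5 : j = lo i
    · subst h5; rw [hsl, h3, h4]
    · by_cases h6 : j = hi i
      · subst h6; rw [hsh, h3, h4]
      · rw [hso j h5 h6]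
  have rest : ∑ k ∈ (Finset.univ.erase (lo i)).erase (hi i), φ g k * HFun i c (g + τ k) =
      if g (lo i) = g (hi i) then
        q⁻¹ * ∑ k ∈ (Finset.univ.erase (lo i)).erase (hi i), φ g k * c (g + τ k)
      else (∑ k ∈ (Finset.univ.erase (lo i)).erase (hi i), φ (g ∘ s) k * c (g ∘ s + τ k)) -
        if D (g (lo i)) (g (hi i)) then
          (q - q⁻¹) * ∑ k ∈ (Finset.univ.erase (lo i)).erase (hi i), φ g k * c (g + τ k)
        else 0 := by
    have : ∀ k ∈ (Finset.univ.erase (lo i)).erase (hi i), φ g k * HFun i c (g + τ k) =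
        if g (lo i) = g (hi i) then q⁻¹ * (φ g k * c (g + τ k))
        else φ (g ∘ s) k * c (g ∘ s + τ k) -
          if D (g (lo i)) (g (hi i)) then (q - q⁻¹) * (φ g k * c (g + τ k)) else 0 := by
      intro k hk
      simp only [Finset.mem_erase, Finset.mem_univ, and_true] at hk
      obtain ⟨h3, h4⟩ := hτ k hk.2 hk.1
      rw [hH, hφ' g k hk.2 hk.1, hτs k hk.2 hk.1]
      simp only [Pi.add_apply, h3, h4, add_zero]
      split_ifs <;> ring
    rw [Finset.sum_congr rfl this]
    split_ifs
    · rw [Finset.mul_sum]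
    · rw [Finset.sum_sub_distrib, Finset.mul_sum]
    · simp
  have key := hid (g (lo i)) (g (hi i)) C
  rw [hT, hH, hT, hT, split, split, split, rest]
  have e1 : ∀ k, k ≠ lo i → k ≠ hi i → (g + τ (lo i)) k = g k := by
    intro k h1 h2; simp [hlo, h1]
  have e2 : ∀ k, k ≠ lo i → k ≠ hi i → (g + τ (hi i)) k = g k := by
    intro k h1 h2; simp [hhi, h2]
  have l1 : (g + τ (lo i)) (lo i) = g (lo i) + t := by simp [hlo]
  have l2 : (g + τ (lo i)) (hi i) = g (hi i) := by simp [hlo, hne.symm]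
  have l3 : (g + τ (hi i)) (lo i) = g (lo i) := by simp [hhi, hne]
  have l4 : (g + τ (hi i)) (hi i) = g (hi i) + t := by simp [hhi]
  have c1 : c (g + τ (lo i)) = C (g (lo i) + t) (g (hi i)) := by rw [hCg _ e1, l1, l2]
  have c2 : c (g + τ (hi i)) = C (g (lo i)) (g (hi i) + t) := by rw [hCg _ e2, l3, l4]
  have c3 : c ((g + τ (lo i)) ∘ s) = C (g (hi i)) (g (lo i) + t) := by
    rw [hCg]
    · simp only [Function.comp_apply, hsl, hsh, l1, l2]
    · intro k h1 h2; rw [Function.comp_apply, hso k h1 h2, e1 k h1 h2]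
  have c4 : c ((g + τ (hi i)) ∘ s) = C (g (hi i) + t) (g (lo i)) := by
    rw [hCg]
    · simp only [Function.comp_apply, hsl, hsh, l3, l4]
    · intro k h1 h2; rw [Function.comp_apply, hso k h1 h2, e2 k h1 h2]
  have c5 : c (g ∘ s + τ (lo i)) = C (g (hi i) + t) (g (lo i)) := by
    rw [hCg]
    · simp [hsl, hsh, hlo, hne.symm]
    · intro k h1 h2; simp [hso k h1 h2, hlo, h1]
  have c6 : c (g ∘ s + τ (hi i)) = C (g (hi i)) (g (lo i) + t) := by
    rw [hCg]
    · simp [hsl, hsh, hhi, hne]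
    · intro k h1 h2; simp [hso k h1 h2, hhi, h2]
  have p1 : φ (g ∘ s) (lo i) = e g * P (g (hi i)) (g (lo i)) := by
    rw [hP, he']; simp [hsl, hsh]
  have p2 : φ (g ∘ s) (hi i) = e g * Q (g (hi i)) (g (lo i)) := by
    rw [hQ, he']; simp [hsl, hsh]
  rw [hH, hH, l1, l2, l3, l4, c1, c2, c3, c4, c5, c6, p1, p2, hP g, hQ g]
  by_cases hxy : g (lo i) = g (hi i)
  · simp only [hxy, if_true] at key ⊢
    linear_combination (e g) * key
  · by_cases hd : D (g (lo i)) (g (hi i))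
    · simp only [hxy, hd, if_true, if_false] at key ⊢
      linear_combination (e g) * key
    · simp only [hxy, hd, if_false] at key ⊢
      linear_combination (e g) * key

theorem lt_lo_iff (i : SIdx m n) (k : Idx m n) (h1 : k ≠ lo i) (h2 : k ≠ hi i) :
    pos k < pos (lo i) ↔ pos k < pos (hi i) := by
  rcases i with i | i <;> rcases k with k | k <;>
    simp [lo, hi, pos, Fin.ext_iff] at * <;> omega

theorem lo_lt_iff (i : SIdx m n) (k : Idx m n) (h1 : k ≠ lo i) (h2 : k ≠ hi i) :
    pos (lo i) < pos k ↔ pos (hi i) < pos k := by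
  rcases i with i | i <;> rcases k with k | k <;>
    simp [lo, hi, pos, Fin.ext_iff] at * <;> omega

theorem lo_lt_hi (i : SIdx m n) : pos (lo i) < pos (hi i) := by
  rcases i with i | i <;> simp [lo, hi, pos]

theorem sgn_swap (i : SIdx m n) (j : Idx m n) : sgn (Equiv.swap (lo i) (hi i) j) = sgn j := by
  rw [Equiv.swap_apply_def]
  split_ifs with h1 h2
  · rw [h1, sgn_lo_eq]
  · rw [h2, sgn_lo_eq]
  · rfl

/-- A sum over a set of positions that is stable under a basic transposition. -/
theorem sum_swap (i : SIdx m n) (p : Idx m n → Prop) [DecidablePred p]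
    (hp : p (lo i) ↔ p (hi i)) (b c : ℤ) (g : ZFun m n) :
    ∑ j with p j, kExp b c (act g (simpleRefl i)) j = ∑ j with p j, kExp b c g j := by
  have hp' : ∀ j, p (Equiv.swap (lo i) (hi i) j) ↔ p j := by
    intro j
    rw [Equiv.swap_apply_def]
    split_ifs with h1 h2
    · rw [h1, hp]
    · rw [h2, hp]
    · rfl
  refine Finset.sum_equiv (Equiv.swap (lo i) (hi i)) (fun j => by simp [hp']) fun j _ => ?_
  rw [act_simpleRefl]
  simp [kExp, sgn_swap]

theorem kExp_congr {b c : ℤ} {f g : ZFun m n} {j : Idx m n} (h : f j = g j) :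
    kExp b c f j = kExp b c g j := by
  simp [kExp, h]

theorem d_apply_ne {k j : Idx m n} (h : j ≠ k) : d k j = 0 := by
  simp [d, h]

theorem eExp_add_d (a : ℤ) (g : ZFun m n) (k : Idx m n) : eExp a (g + d k) k = eExp a g k := by
  refine Finset.sum_congr rfl fun j hj => kExp_congr ?_
  have hj' : pos k < pos j := by simpa using hj
  have : j ≠ k := fun h => by subst h; exact lt_irrefl _ hj'
  simp [d_apply_ne this]

theorem fExp_sub_d (a : ℤ) (g : ZFun m n) (k : Idx m n) : fExp a (g - d k) k = fExp a g k := by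
  refine Finset.sum_congr rfl fun j hj => kExp_congr ?_
  have hj' : pos j < pos k := by simpa using hj
  have : j ≠ k := fun h => by subst h; exact lt_irrefl _ hj'
  simp [d_apply_ne this]

theorem eExp_lo (a : ℤ) (g : ZFun m n) (i : SIdx m n) :
    eExp a g (lo i) = kExp (a + 1) a g (hi i) + eExp a g (hi i) := by
  unfold eExp
  rw [← Finset.sum_insert (by simp)]
  refine Finset.sum_congr ?_ fun _ _ => rfl
  ext j
  simp only [Finset.mem_filter, Finset.mem_univ, true_and, Finset.mem_insert]
  by_cases h1 : j = lo i
  · subst h1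
    simp [lo_ne_hi, (lo_lt_hi i).le]
  · by_cases h2 : j = hi i
    · subst h2; simp [lo_lt_hi]
    · simp [h2, lo_lt_iff i j h1 h2]

theorem fExp_hi (a : ℤ) (g : ZFun m n) (i : SIdx m n) :
    fExp a g (hi i) = kExp a (a + 1) g (lo i) + fExp a g (lo i) := by
  unfold fExp
  rw [← Finset.sum_insert (by simp)]
  refine Finset.sum_congr ?_ fun _ _ => rfl
  ext j
  simp only [Finset.mem_filter, Finset.mem_univ, true_and, Finset.mem_insert]
  by_cases h1 : j = lo i
  · subst h1; simp [lo_lt_hi]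
  · by_cases h2 : j = hi i
    · subst h2
      simp [(lo_ne_hi i).symm, (lo_lt_hi i).le]
    · simp [h1, lt_lo_iff i j h1 h2]

theorem d_lo_hi (i : SIdx m n) (k : Idx m n) (h1 : k ≠ lo i) (h2 : k ≠ hi i) :
    d k (lo i) = 0 ∧ d k (hi i) = 0 :=
  ⟨d_apply_ne h1.symm, d_apply_ne h2.symm⟩

/-- The entry at `k` for which `E_a` produces a basis vector from its neighbour. -/
theorem EActs_add_d (a : ℤ) (g : ZFun m n) (k : Idx m n) :
    EActs a (g + d k) k ↔ g k = if sgn k = 1 then a else a + 1 := by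
  rcases k with k | k
  · simp [EActs, d, sgn]; omega
  · simp [EActs, d, sgn]

theorem FActs_sub_d (a : ℤ) (g : ZFun m n) (k : Idx m n) :
    FActs a (g - d k) k ↔ g k = if sgn k = 1 then a + 1 else a := by
  rcases k with k | k
  · simp [FActs, d, sgn]
  · simp [FActs, d, sgn]; omega

theorem Descends_iff (g : ZFun m n) (i : SIdx m n) :
    Descends g i ↔ if sgn (lo i) = 1 then g (hi i) < g (lo i) else g (lo i) < g (hi i) := by
  rcases i with i | i <;> simp [Descends, lo, sgn]

theorem act_apply_ne (g : ZFun m n) (i : SIdx m n) (k : Idx m n) (h1 : k ≠ lo i)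
    (h2 : k ≠ hi i) : act g (simpleRefl i) k = g k := by
  rw [act_simpleRefl]
  simp [Equiv.swap_apply_of_ne_of_ne h1 h2]

theorem E_local (a x y : ℤ) (C : ℤ → ℤ → Qq) (sg : ℤ) (hsg : sg = 1 ∨ sg = -1)
    (x0 : ℤ) (hx0 : x0 = if sg = 1 then a else a + 1)
    (D : ℤ → ℤ → Prop) [∀ x y, Decidable (D x y)]
    (hD : ∀ x y, D x y ↔ if sg = 1 then y < x else x < y)
    (P Q : ℤ → ℤ → Qq)
    (hP : P = fun x y => if x = x0 then
      q ^ (sg * ((if y = a + 1 then 1 else 0) - (if y = a then 1 else 0))) else 0)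
    (hQ : Q = fun _ y => if y = x0 then 1 else 0) :
    P x y * (if x + sg = y then q⁻¹ * C (x + sg) y else
        C y (x + sg) - if D (x + sg) y then (q - q⁻¹) * C (x + sg) y else 0) +
      Q x y * (if x = y + sg then q⁻¹ * C x (y + sg) else
        C (y + sg) x - if D x (y + sg) then (q - q⁻¹) * C x (y + sg) else 0) =
      if x = y then q⁻¹ * (P x y * C (x + sg) y + Q x y * C x (y + sg)) else
        (P y x * C (y + sg) x + Q y x * C y (x + sg)) -
          if D x y then (q - q⁻¹) * (P x y * C (x + sg) y + Q x y * C x (y + sg)) else 0 := by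
  have hX : (q : Qq) ≠ 0 := RatFunc.X_ne_zero
  have hDe : D = fun x y => if sg = 1 then y < x else x < y := by
    funext x y; exact propext (hD x y)
  subst hP hQ hDe hx0
  rcases hsg with rfl | rfl
  · simp only [if_true, one_mul]
    by_cases hx : x = a
    · subst hx
      by_cases hy : y = x
      · subst hy
        simp
        field_simp
        ring
      · by_cases hy2 : y = x + 1
        · subst hy2
          simp
          field_simp
          try ring
        · have e1 : ¬ x + 1 = y := fun h => hy2 h.symm
          have e2 : ¬ x = y := fun h => hy h.symm
          have e3 : y < x + 1 ↔ y < x := by omega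
          simp [hy, hy2, e1, e2, e3]
    · by_cases hy : y = a
      · subst hy
        by_cases hx2 : x = y + 1
        · subst hx2
          simp
          field_simp
          try ring
        · have e3 : y < x ↔ y + 1 < x := by omega
          simp [hx, hx2, e3]
      · simp [hx, hy]
  · have h1 : ¬ ((-1 : ℤ) = 1) := by norm_num
    simp only [h1, if_false]
    by_cases hx : x = a + 1
    · subst hx
      by_cases hy : y = a + 1
      · subst hy
        simp
        field_simp
        try ring
      · by_cases hy2 : y = a
        · subst hy2
          simp
          field_simp
          try ring
        · have e1 : ¬ a = y := fun h => hy2 h.symm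
          have e2 : ¬ a + 1 = y := fun h => hy h.symm
          have e3 : a < y ↔ a + 1 < y := by omega
          simp [hy, hy2, e1, e2, e3]
    · by_cases hy : y = a + 1
      · subst hy
        by_cases hx2 : x = a
        · subst hx2
          simp
          field_simp
          try ring
        · have e3 : x < a + 1 ↔ x < a := by omega
          simp [hx, hx2, e3]
      · simp [hx, hy]

theorem F_local (a x y : ℤ) (C : ℤ → ℤ → Qq) (sg : ℤ) (hsg : sg = 1 ∨ sg = -1)
    (x0 : ℤ) (hx0 : x0 = if sg = 1 then a + 1 else a)
    (D : ℤ → ℤ → Prop) [∀ x y, Decidable (D x y)]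
    (hD : ∀ x y, D x y ↔ if sg = 1 then y < x else x < y)
    (P Q : ℤ → ℤ → Qq)
    (hP : P = fun x _ => if x = x0 then 1 else 0)
    (hQ : Q = fun x y => if y = x0 then
      q ^ (sg * ((if x = a then 1 else 0) - (if x = a + 1 then 1 else 0))) else 0) :
    P x y * (if x + -sg = y then q⁻¹ * C (x + -sg) y else
        C y (x + -sg) - if D (x + -sg) y then (q - q⁻¹) * C (x + -sg) y else 0) +
      Q x y * (if x = y + -sg then q⁻¹ * C x (y + -sg) else
        C (y + -sg) x - if D x (y + -sg) then (q - q⁻¹) * C x (y + -sg) else 0) =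
      if x = y then q⁻¹ * (P x y * C (x + -sg) y + Q x y * C x (y + -sg)) else
        (P y x * C (y + -sg) x + Q y x * C y (x + -sg)) -
          if D x y then (q - q⁻¹) * (P x y * C (x + -sg) y + Q x y * C x (y + -sg)) else 0 := by
  have hX : (q : Qq) ≠ 0 := RatFunc.X_ne_zero
  have hDe : D = fun x y => if sg = 1 then y < x else x < y := by
    funext x y; exact propext (hD x y)
  subst hP hQ hDe hx0
  rcases hsg with rfl | rfl
  · simp only [if_true, one_mul]
    by_cases hx : x = a + 1
    · subst hx
      by_cases hy : y = a + 1
      · subst hy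
        simp
        field_simp
        try ring
      · by_cases hy2 : y = a
        · subst hy2
          simp
          field_simp
          try ring
        · have e1 : ¬ a = y := fun h => hy2 h.symm
          have e2 : ¬ a + 1 = y := fun h => hy h.symm
          have e3 : y < a + 1 ↔ y < a := by omega
          simp [hy, hy2, e1, e2, e3]
    · by_cases hy : y = a + 1
      · subst hy
        by_cases hx2 : x = a
        · subst hx2
          simp
          field_simp
          try ring
        · have e3 : a < x ↔ a + 1 < x := by omega
          simp [hx, hx2, e3]
      · simp [hx, hy]
  · have h1 : ¬ ((-1 : ℤ) = 1) := by norm_num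
    simp only [h1, if_false, neg_neg]
    by_cases hx : x = a
    · subst hx
      by_cases hy : y = x
      · subst hy
        simp
        field_simp
        try ring
      · by_cases hy2 : y = x + 1
        · subst hy2
          simp
          field_simp
          try ring
        · have e1 : ¬ x + 1 = y := fun h => hy2 h.symm
          have e2 : ¬ x = y := fun h => hy h.symm
          have e3 : x < y ↔ x + 1 < y := by omega
          simp [hy, hy2, e1, e2, e3]
    · by_cases hy : y = a
      · subst hy
        by_cases hx2 : x = y + 1
        · subst hx2
          simp
          field_simp
          try ring
        · have e3 : x < y + 1 ↔ x < y := by omega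
          simp [hx, hx2, e3]
      · simp [hx, hy]

theorem sgn_cases (k : Idx m n) : sgn k = 1 ∨ sgn k = -1 := by
  rcases k with k | k <;> simp [sgn]

open Classical in
theorem EFun_HFun (a : ℤ) (i : SIdx m n) (c : ZFun m n → Qq) :
    EFun a (HFun i c) = HFun i (EFun a c) := by
  have hX : (q : Qq) ≠ 0 := RatFunc.X_ne_zero
  refine comm_aux i (sgn (lo i)) d rfl (by rw [sgn_lo_eq]; rfl) (d_lo_hi i)
    (fun g k => if g k = (if sgn k = 1 then a else a + 1) then q ^ eExp a g k else 0) ?_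
    (fun g => q ^ eExp a g (hi i)) ?_ _ _ ?_ ?_
    (fun x y => if sgn (lo i) = 1 then y < x else x < y) (fun g => Descends_iff g i)
    (fun x y C => @E_local a x y C (sgn (lo i)) (sgn_cases _) _ rfl _
      (fun _ _ => Classical.propDecidable _) (fun _ _ => Iff.rfl) _ _ rfl rfl) (EFun a) ?_ c
  · intro g k h1 h2
    have : eExp a (act g (simpleRefl i)) k = eExp a g k :=
      sum_swap i (fun j => pos k < pos j) (lt_lo_iff i k h1 h2) _ _ g
    simp only [this, act_apply_ne g i k h1 h2]
  · intro g
    have : eExp a (act g (simpleRefl i)) (hi i) = eExp a g (hi i) := by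
      refine sum_swap i (fun j => pos (hi i) < pos j) ?_ _ _ g
      have := lo_lt_hi i
      simp only [lt_irrefl, iff_false, not_lt]
      exact this.le
    simp only [this]
  · intro g
    rw [eExp_lo, zpow_add₀ hX]
    unfold kExp
    rw [← sgn_lo_eq]
    split_ifs <;> simp [mul_comm]
  · intro g
    simp only [← sgn_lo_eq]
    split_ifs <;> simp
  · intro c g
    change (∑ k, if EActs a (g + d k) k then q ^ eExp a (g + d k) k * c (g + d k) else 0) = _
    refine Finset.sum_congr rfl fun k _ => ?_
    rw [eExp_add_d]
    by_cases h : EActs a (g + d k) k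
    · rw [if_pos h, if_pos ((EActs_add_d a g k).1 h)]
    · rw [if_neg h, if_neg (fun h' => h ((EActs_add_d a g k).2 h')), zero_mul]

open Classical in
theorem FFun_HFun (a : ℤ) (i : SIdx m n) (c : ZFun m n → Qq) :
    FFun a (HFun i c) = HFun i (FFun a c) := by
  have hX : (q : Qq) ≠ 0 := RatFunc.X_ne_zero
  have hneg : ∀ (k : Idx m n) (t : ℤ), -(Pi.single k t : ZFun m n) = Pi.single k (-t) := by
    intro k t; rw [Pi.single_neg]
  refine comm_aux i (-sgn (lo i)) (fun k => -d k) (hneg _ _)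
    (by rw [sgn_lo_eq]; exact hneg _ _)
    (fun k h1 h2 => by simpa using d_lo_hi i k h1 h2)
    (fun g k => if g k = (if sgn k = 1 then a + 1 else a) then q ^ fExp a g k else 0) ?_
    (fun g => q ^ fExp a g (lo i)) ?_ _ _ ?_ ?_
    (fun x y => if sgn (lo i) = 1 then y < x else x < y) (fun g => Descends_iff g i)
    (fun x y C => @F_local a x y C (sgn (lo i)) (sgn_cases _) _ rfl _
      (fun _ _ => Classical.propDecidable _) (fun _ _ => Iff.rfl) _ _ rfl rfl) (FFun a) ?_ c
  · intro g k h1 h2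
    have : fExp a (act g (simpleRefl i)) k = fExp a g k :=
      sum_swap i (fun j => pos j < pos k) (lo_lt_iff i k h1 h2) _ _ g
    simp only [this, act_apply_ne g i k h1 h2]
  · intro g
    have : fExp a (act g (simpleRefl i)) (lo i) = fExp a g (lo i) := by
      refine sum_swap i (fun j => pos j < pos (lo i)) ?_ _ _ g
      have := lo_lt_hi i
      simp only [lt_irrefl, false_iff, not_lt]
      exact this.le
    simp only [this]
  · intro g
    split_ifs <;> simp
  · intro g
    rw [fExp_hi, zpow_add₀ hX]
    unfold kExp
    rw [← sgn_lo_eq]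
    split_ifs <;> simp [mul_comm]
  · intro c g
    change (∑ k, if FActs a (g - d k) k then q ^ fExp a (g - d k) k * c (g - d k) else 0) = _
    refine Finset.sum_congr rfl fun k _ => ?_
    rw [fExp_sub_d, ← sub_eq_add_neg]
    by_cases h : FActs a (g - d k) k
    · rw [if_pos h, if_pos ((FActs_sub_d a g k).1 h)]
    · rw [if_neg h, if_neg (fun h' => h ((FActs_sub_d a g k).2 h')), zero_mul]

theorem wt_act (g : ZFun m n) (x : Smn m n) : wt (act g x) = wt g := by
  unfold wt act
  refine Fintype.sum_equiv (Equiv.sumCongr x.1 x.2) _ _ fun j => ?_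
  rcases j with j | j <;> simp [sgn]

theorem KFun_HFun (a s : ℤ) (i : SIdx m n) (c : ZFun m n → Qq) :
    KFun a s (HFun i c) = HFun i (KFun a s c) := by
  funext g
  simp only [KFun, HFun, LinearMap.coe_mk, AddHom.coe_mk, wt_act]
  split_ifs <;> ring

theorem E_H (a : ℤ) (i : SIdx m n) (u : THat m n) : E a (H i u) = H i (E a u) :=
  coeff_injective (EFun_HFun a i (coeff u))

theorem F_H (a : ℤ) (i : SIdx m n) (u : THat m n) : F a (H i u) = H i (F a u) :=
  coeff_injective (FFun_HFun a i (coeff u))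

theorem Kact_H (a : ℤ) (i : SIdx m n) (u : THat m n) : Kact a (H i u) = H i (Kact a u) :=
  coeff_injective (KFun_HFun a 1 i (coeff u))

theorem KactInv_H (a : ℤ) (i : SIdx m n) (u : THat m n) :
    KactInv a (H i u) = H i (KactInv a u) :=
  coeff_injective (KFun_HFun a (-1) i (coeff u))

/-! ### The exterior algebra -/

/-- The right action of `H_{i_1} ⋯ H_{i_r}`. -/
def Hword : List (SIdx m n) → THat m n →ₗ[Qq] THat m n
  | [] => LinearMap.id
  | i :: w => (Hword w).comp (H i)

/-- The right action of `H_x`, the product of the generators along a reduced expression of `x`. -/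
def Hx (x : Smn m n) : THat m n →ₗ[Qq] THat m n := Hword (reducedWord x)

/-- The right action of `H_0 = ∑_x (-q)^{ℓ(x) - ℓ(w_0)} H_x`. -/
def H0 : THat m n →ₗ[Qq] THat m n :=
  ∑ x : Smn m n, (-q) ^ ((len x : ℤ) - (len (w0 : Smn m n) : ℤ)) • Hx x

/-- The completion of `ℰ^{m|n} = 𝒯^{m|n} H_0`, with the subspace topology. -/
abbrev EHat (m n : ℕ) : Submodule Qq (THat m n) := LinearMap.range H0

theorem comm_H0 (T : THat m n →ₗ[Qq] THat m n) (hT : ∀ i u, T (H i u) = H i (T u))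
    (u : THat m n) : T (H0 u) = H0 (T u) := by
  have hw : ∀ (w : List (SIdx m n)) u, T (Hword w u) = Hword w (T u) := by
    intro w
    induction w with
    | nil => intro u; rfl
    | cons i w ih =>
      intro u
      change T (Hword w (H i u)) = Hword w (H i (T u))
      rw [ih, hT]
  simp only [H0, LinearMap.sum_apply, LinearMap.smul_apply, map_sum, map_smul, Hx, hw]

theorem mem_EHat_of_comm (T : THat m n →ₗ[Qq] THat m n) (hT : ∀ i u, T (H i u) = H i (T u)) :
    ∀ u ∈ EHat m n, T u ∈ EHat m n := by
  rintro _ ⟨u, rfl⟩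
  exact ⟨T u, (comm_H0 T hT u).symm⟩

/-- The action of `E_a` on the completed exterior algebra. -/
def EE (a : ℤ) : EHat m n →ₗ[Qq] EHat m n := (E a).restrict (mem_EHat_of_comm _ (E_H a))

/-- The action of `F_a` on the completed exterior algebra. -/
def EF (a : ℤ) : EHat m n →ₗ[Qq] EHat m n := (F a).restrict (mem_EHat_of_comm _ (F_H a))

/-- The action of `K_a` on the completed exterior algebra. -/
def EK (a : ℤ) : EHat m n →ₗ[Qq] EHat m n := (Kact a).restrict (mem_EHat_of_comm _ (Kact_H a))

/-- The action of `K_a⁻¹` on the completed exterior algebra. -/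
def EKInv (a : ℤ) : EHat m n →ₗ[Qq] EHat m n :=
  (KactInv a).restrict (mem_EHat_of_comm _ (KactInv_H a))

/-- The monomial basis vector `K_f = M_{f · w_0} H_0`. -/
def K (f : ZPlus m n) : EHat m n := ⟨H0 (M (act f.1 w0)), LinearMap.mem_range_self _ _⟩

/-- `bar` is a bar involution of the completed exterior algebra: it is a continuous antilinear
map with `bar (K_f) = K_f` for all typical `f` and `bar (X u) = bar(X) bar(u)` for all `X` in the
quantum group, whose bar involution is the antilinear algebra automorphism with
`E_a ↦ E_a`, `F_a ↦ F_a`, `K_a ↦ K_a⁻¹`. -/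
structure IsBar (bar : EHat m n →ₛₗ[barQ] EHat m n) : Prop where
  continuous : Continuous bar
  typical : ∀ f : ZPlus m n, Typical f.1 → bar (K f) = K f
  bar_E : ∀ a u, bar (EE a u) = EE a (bar u)
  bar_F : ∀ a u, bar (EF a u) = EF a (bar u)
  bar_K : ∀ a u, bar (EK a u) = EKInv a (bar u)
  bar_KInv : ∀ a u, bar (EKInv a u) = EK a (bar u)

/-- `U` is a topological basis: every element is, in a unique way, a convergent (possibly
infinite) linear combination of the `U_f`. -/
def IsTopBasis (U : ZPlus m n → EHat m n) : Prop :=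
  ∀ u : EHat m n, ∃! c : ZPlus m n → Qq, HasSum (fun f => c f • U f) u

/-- The element `p(q)` of `ℚ(q)` for an integer polynomial `p`. -/
def polyQ (p : Polynomial ℤ) : Qq := Polynomial.aeval q p

/-- `U` is the canonical basis with respect to the bar involution `bar`: a topological basis
of bar invariant elements `U_f ∈ K_f + ∑_g q ℤ[q] K_g` (possibly infinite sum). -/
structure IsCanonicalBasis (bar : EHat m n →ₛₗ[barQ] EHat m n)
    (U : ZPlus m n → EHat m n) : Prop where
  topBasis : IsTopBasis U
  bar_inv : ∀ f, bar (U f) = U f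
  expansion : ∀ f, ∃ p : ZPlus m n → Polynomial ℤ,
    HasSum (fun g => (q * polyQ (p g)) • K g) (U f - K f)

/-! ### The lowering operators -/

/-- `f` is conjugate to a dominant function. -/
def Regular (f : ZFun m n) : Prop := ∃ x : Smn m n, Dominant (act f x)

theorem dominant_default :
    Dominant (Sum.elim (fun k : Fin m => (k : ℤ)) (fun k : Fin n => -(k : ℤ)) : ZFun m n) := by
  constructor
  · intro a b hab
    simpa using hab
  · intro a b hab
    simpa using hab

open Classical in
/-- The dominant conjugate `f⁺` of a function `f` that is conjugate to a dominant one
(with an irrelevant value for the other functions). -/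
def dom (f : ZFun m n) : ZPlus m n :=
  if h : Regular f then ⟨act f h.choose, h.choose_spec⟩ else ⟨_, dominant_default⟩

/-- `L_{i,j}(f) = f - a (d_i - d_j)` for `i < 0 < j` with `f(i) = f(j)`, where `a` is the smallest
positive integer such that `f - a (d_i - d_j)` and all `L_{k,l}(f) - a (d_i - d_j)` with
`i < k < 0 < l < j` and `f(k) = f(l)` are conjugate to dominant functions. -/
def lower (f : ZFun m n) (i : Fin m) (j : Fin n) : ZFun m n :=
  f - sInf {a : ℕ | 0 < a ∧ Regular (f - a • (d (Sum.inl i) - d (Sum.inr j))) ∧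
    ∀ k l, i < k → l < j → f (Sum.inl k) = f (Sum.inr l) →
      Regular (lower f k l - a • (d (Sum.inl i) - d (Sum.inr j)))} •
    (d (Sum.inl i) - d (Sum.inr j))
termination_by j

open Classical in
/-- The negative indices `i` such that `f(i) = f(j)` for some positive index `j`. -/
def atypSet (f : ZFun m n) : Finset (Fin m) :=
  Finset.univ.filter fun i => ∃ j : Fin n, f (Sum.inl i) = f (Sum.inr j)

theorem card_atypSet (f : ZPlus m n) : (atypSet f.1).card = atyp f.1 := by
  classical
  set A : Finset ℤ := Finset.univ.image fun i : Fin m => f.1 (Sum.inl i) with hA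
  set B : Finset ℤ := Finset.univ.image fun j : Fin n => f.1 (Sum.inr j) with hB
  have hAc : A.card = m := by
    rw [hA, Finset.card_image_of_injective _ f.2.1.injective, Finset.card_fin]
  have hBc : B.card = n := by
    rw [hB, Finset.card_image_of_injective _ f.2.2.injective, Finset.card_fin]
  have hAB : A ∩ B = (atypSet f.1).image fun i => f.1 (Sum.inl i) := by
    ext a
    simp only [hA, hB, atypSet, Finset.mem_inter, Finset.mem_image, Finset.mem_univ, true_and,
      Finset.mem_filter]
    constructor
    · rintro ⟨⟨i, rfl⟩, j, hj⟩
      exact ⟨i, ⟨j, hj.symm⟩, rfl⟩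
    · rintro ⟨i, ⟨j, hj⟩, rfl⟩
      exact ⟨⟨i, rfl⟩, j, hj.symm⟩
  have hABc : (A ∩ B).card = (atypSet f.1).card := by
    rw [hAB, Finset.card_image_of_injective _ f.2.1.injective]
  have hwt : ∀ a, wt f.1 a = (if a ∈ B then 1 else 0) - (if a ∈ A then 1 else 0) := by
    intro a
    have h1 : ∑ i : Fin m, (if f.1 (Sum.inl i) = a then (-1 : ℤ) else 0) =
        - if a ∈ A then 1 else 0 := by
      by_cases h : a ∈ A
      · obtain ⟨i, -, hi⟩ := Finset.mem_image.1 h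
        rw [if_pos h, Finset.sum_eq_single i, if_pos hi]
        · intro k _ hk
          exact if_neg fun h' => hk (f.2.1.injective (h'.trans hi.symm))
        · simp
      · rw [if_neg h, neg_zero]
        refine Finset.sum_eq_zero fun i _ => if_neg fun hi => h ?_
        exact Finset.mem_image.2 ⟨i, Finset.mem_univ _, hi⟩
    have h2 : ∑ i : Fin n, (if f.1 (Sum.inr i) = a then (1 : ℤ) else 0) =
        if a ∈ B then 1 else 0 := by
      by_cases h : a ∈ B
      · obtain ⟨i, -, hi⟩ := Finset.mem_image.1 h
        rw [if_pos h, Finset.sum_eq_single i, if_pos hi]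
        · intro k _ hk
          exact if_neg fun h' => hk (f.2.2.injective (h'.trans hi.symm))
        · simp
      · rw [if_neg h]
        refine Finset.sum_eq_zero fun i _ => if_neg fun hi => h ?_
        exact Finset.mem_image.2 ⟨i, Finset.mem_univ _, hi⟩
    simp only [wt, Finsupp.finsetSum_apply, Finsupp.single_apply, Fintype.sum_sum_type, sgn,
      Finsupp.add_apply]
    rw [h1, h2]
    ring
  have hsum : ((wt f.1).sum fun _ z => |z|) = m + n - 2 * (atypSet f.1).card := by
    rw [Finsupp.sum_of_support_subset (s := A ∪ B) _ _ _ (by simp)]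
    · have h3 : ∀ a ∈ A ∪ B, |wt f.1 a| = (if a ∈ A then 1 else 0) + (if a ∈ B then 1 else 0) -
          2 * (if a ∈ A ∩ B then 1 else 0) := by
        intro a _
        rw [hwt]
        by_cases h1 : a ∈ A <;> by_cases h2 : a ∈ B <;> simp [h1, h2]
      rw [Finset.sum_congr rfl h3, Finset.sum_sub_distrib, Finset.sum_add_distrib,
        ← Finset.mul_sum]
      simp only [Finset.sum_ite_mem, Finset.union_inter_cancel_left,
        Finset.union_inter_cancel_right, Finset.sum_const]
      have h4 : (A ∪ B) ∩ (A ∩ B) = A ∩ B := by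
        ext a; simp; tauto
      rw [h4, hABc, hAc, hBc]
      simp
    · intro a ha
      by_contra h
      rw [Finset.mem_union, not_or] at h
      exact (Finsupp.mem_support_iff.1 ha) (by rw [hwt]; simp [h.1, h.2])
  unfold atyp
  rw [hsum]
  omega

/-- The indices `i_1 < ⋯ < i_r < 0`, where `r = #f`. -/
def iIdx (f : ZPlus m n) (s : Fin (atyp f.1)) : Fin m :=
  (atypSet f.1).orderEmbOfFin (card_atypSet f) s

theorem exists_jIdx (f : ZPlus m n) (s : Fin (atyp f.1)) :
    ∃ j : Fin n, f.1 (Sum.inl (iIdx f s)) = f.1 (Sum.inr j) := by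
  classical
  have h := (atypSet f.1).orderEmbOfFin_mem (card_atypSet f) s
  exact (Finset.mem_filter.1 h).2

/-- The indices `0 < j_r < ⋯ < j_1` with `f(i_s) = f(j_s)`. -/
def jIdx (f : ZPlus m n) (s : Fin (atyp f.1)) : Fin n := (exists_jIdx f s).choose

theorem iIdx_strictMono (f : ZPlus m n) : StrictMono (iIdx f) :=
  ((atypSet f.1).orderEmbOfFin (card_atypSet f)).strictMono

theorem iIdx_jIdx (f : ZPlus m n) (s : Fin (atyp f.1)) :
    f.1 (Sum.inl (iIdx f s)) = f.1 (Sum.inr (jIdx f s)) := (exists_jIdx f s).choose_spec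

theorem jIdx_strictAnti (f : ZPlus m n) : StrictAnti (jIdx f) := by
  intro s t hst
  have h := f.2.1 (iIdx_strictMono f hst)
  simp only [iIdx_jIdx] at h
  exact f.2.2.lt_iff_gt.1 h

/-- `L_{i_s,j_s}` for the indices attached to `f`. -/
def lowerAt (f : ZPlus m n) (s : Fin (atyp f.1)) (g : ZFun m n) : ZFun m n :=
  lower g (iIdx f s) (jIdx f s)

/-- `L_θ(f) = (L_{i_r,j_r}^{θ_r} ∘ ⋯ ∘ L_{i_1,j_1}^{θ_1} (f))⁺`. -/
def Ltheta (f : ZPlus m n) (θ : Fin (atyp f.1) → ℕ) : ZPlus m n :=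
  dom ((List.finRange (atyp f.1)).foldl (fun g s => (lowerAt f s)^[θ s] g) f.1)

/-- `L'_θ(f) = (L_{i_1,j_1}^{θ_1} ∘ ⋯ ∘ L_{i_r,j_r}^{θ_r} (f))⁺`. -/
def Ltheta' (f : ZPlus m n) (θ : Fin (atyp f.1) → ℕ) : ZPlus m n :=
  dom ((List.finRange (atyp f.1)).foldr (fun s g => (lowerAt f s)^[θ s] g) f.1)

end GLmn
end

/-! Read a dominant `f` as a diagram on the number line. An integer carries a left label if it is a
value of `f` at a negative index only, a right label if at a positive index only, a double label if
at both, and is free if at neither. Since `d` is negative at negative indices, the lowering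
operators push double labels to the right. Join every double label to a free vertex on its right by
noncrossing caps, so that below a cap no free vertex stays unmatched. The candidate `capBasis f` is
the sum of `q ^ |S| K_g` over the sets `S` of caps, where `g` is obtained by moving the double
labels of `S` to the ends of their caps.

On the `K_f`, both `E_a` and `F_a` obey one two-term rule, `LocalRule`, with the two sides exchanged
for `F_a` (`localRule_EE`, `localRule_EF`). Applied to a cap sum, the rule acts by planar surgery as
in the Temperley-Lieb calculus: a generator transposes a label with its neighbour, creates a small
cap, joins or removes caps, or closes a loop. So the result is zero, a cap sum, or `q + q⁻¹` times a
cap sum (`LocalRule.capSum_cases`).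

Moving labels along caps raises the sum of the values of `f`, so the `capBasis f` are unitriangular
over the `K_f` and form a topological basis (`Unitriangular.isTopBasis`). Let `barE` be the
continuous antilinear map fixing them. It commutes with the generators because the scalars 0, 1 and
`q + q⁻¹` are bar invariant, and it fixes typical `K_f`, which have no caps (`isBar_barE`).
Conversely, every cap sum is reached from vectors without caps, which are typical or zero, by
applying `E_a` and `F_a` (`capSum_induction`). So every bar involution fixes all `capBasis f` and
equals `barE`. The canonical basis is unique because zero is the only bar invariant element of
`qℤ[q]` (`eq_zero_of_barQ_eq`).

All this needs coordinates: an element of the exterior algebra is determined by its coefficients at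
dominant functions, which can be any family with finite truncations. The key is `H_H0`: on the image
of `H_0` each `H_i` acts by `-q`. It is checked on antidominant functions, spread to other orders of
the values by means of operators that commute with the Hecke action, and descended to nonregular
orbits as quotients of the regular one. No braid relation is used.

For the two formulas, the minimality in the definition of `lower` is the recursion that determines
cap ends from right to left (`lower_withVals`). In the order of `L_θ` each lowering moves a value to
the end of its own cap, which gives (i). In the order of `L'_θ`, a double label is the sum over a
new cap started there minus `q` times the double label at the next unoccupied vertex; iterating
(`capSum_expand`) gives (ii), convergent because the labels escape to the right. -/

noncomputable section
namespace GLmn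
section

/-! ### Cap diagrams -/

/-- The vertices in `D` are joined by noncrossing caps `c — e c` to vertices on their right; the
vertices in `N` are not part of the diagram, and all others below a cap are ends of caps. -/
structure IsCapping (N D : Finset ℤ) (e : ℤ → ℤ) : Prop where
  lt : ∀ c ∈ D, c < e c
  notMem_N : ∀ c ∈ D, e c ∉ N
  notMem_D : ∀ c ∈ D, e c ∉ D
  disj : ∀ c ∈ D, c ∉ N
  inj : ∀ c ∈ D, ∀ c' ∈ D, e c = e c' → c = c'
  nested : ∀ c ∈ D, ∀ z, c < z → z < e c → z ∉ N → z ∈ D ∨ ∃ c' ∈ D, c < c' ∧ z = e c'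

variable {V : Type*} [AddCommGroup V] [Module Qq V] (κ : Finset ℤ → Finset ℤ → V)

/-- The vertices in `S` are moved to the ends of their caps. -/
def moved (D : Finset ℤ) (e : ℤ → ℤ) (S : Finset ℤ) : Finset ℤ := (D \ S) ∪ S.image e

/-- The sum over all orientations of the caps starting in `D`. -/
def capSum (D : Finset ℤ) (e : ℤ → ℤ) (X Y : Finset ℤ) : V :=
  ∑ S ∈ D.powerset, q ^ S.card • κ (X ∪ moved D e S) (Y ∪ moved D e S)

theorem capSum_empty (e : ℤ → ℤ) (X Y : Finset ℤ) : capSum κ ∅ e X Y = κ X Y := by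
  simp [capSum, moved]

theorem capSum_congr {D : Finset ℤ} {e e' : ℤ → ℤ} (h : ∀ c ∈ D, e c = e' c) (X Y : Finset ℤ) :
    capSum κ D e X Y = capSum κ D e' X Y := by
  refine Finset.sum_congr rfl fun S hS => ?_
  have : S.image e = S.image e' :=
    Finset.image_congr fun c hc => h c (Finset.mem_powerset.1 hS hc)
  simp [moved, this]

/-- Splitting off one cap: its two orientations leave a double label at the start, with weight 1, or
at the end, with weight `q`. All later computations split off just the caps that meet `a` or `a +
1`. -/
theorem capSum_insert {D : Finset ℤ} {c : ℤ} (hc : c ∉ D) (e : ℤ → ℤ) (X Y : Finset ℤ) :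
    capSum κ (insert c D) e X Y = capSum κ D e (insert c X) (insert c Y) +
      q • capSum κ D e (insert (e c) X) (insert (e c) Y) := by
  unfold capSum
  rw [Finset.sum_powerset_insert hc, Finset.smul_sum]
  congr 1
  · refine Finset.sum_congr rfl fun S hS => ?_
    have hcS : c ∉ S := fun h => hc (Finset.mem_powerset.1 hS h)
    have : moved (insert c D) e S = insert c (moved D e S) := by
      unfold moved; rw [Finset.insert_sdiff_of_notMem _ hcS, Finset.insert_union]
    simp [this]
  · refine Finset.sum_congr rfl fun S hS => ?_
    have hcS : c ∉ S := fun h => hc (Finset.mem_powerset.1 hS h)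
    have : moved (insert c D) e (insert c S) = insert (e c) (moved D e S) := by
      ext z; simp only [moved, Finset.mem_union, Finset.mem_sdiff, Finset.mem_insert,
        Finset.mem_image, exists_eq_or_imp]
      grind
    rw [this, Finset.card_insert_of_notMem hcS, smul_smul, pow_succ']
    simp

/-- The action of `E_a` on the basis vector indexed by the values on the left and on the right. -/
def LocalRule (a : ℤ) (Θ : V →ₗ[Qq] V) : Prop :=
  ∀ A B, Θ (κ A B) =
    (if a + 1 ∈ B ∧ a ∉ B then κ A (insert a (B.erase (a + 1))) else 0) +
    if a ∈ A ∧ a + 1 ∉ A then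
      q ^ ((if a + 1 ∈ B then 1 else 0) - (if a ∈ B then 1 else 0) : ℤ) •
        κ (insert (a + 1) (A.erase a)) B else 0

variable {κ} {a : ℤ} {Θ : V →ₗ[Qq] V}

/-- If no cap meets `a` or `a + 1`, the rule sees only `X` and `Y`, in the same way in each term,
and so passes through the sum. -/
theorem LocalRule.capSum (hΘ : LocalRule κ a Θ) {D : Finset ℤ} {e : ℤ → ℤ} (h1 : a ∉ D) (h2 : a + 1 ∉ D)
    (h3 : ∀ c ∈ D, e c ≠ a) (h4 : ∀ c ∈ D, e c ≠ a + 1) (X Y : Finset ℤ) :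
    Θ (capSum κ D e X Y) =
      (if a + 1 ∈ Y ∧ a ∉ Y then GLmn.capSum κ D e X (insert a (Y.erase (a + 1))) else 0) +
      if a ∈ X ∧ a + 1 ∉ X then
        q ^ ((if a + 1 ∈ Y then 1 else 0) - (if a ∈ Y then 1 else 0) : ℤ) •
          GLmn.capSum κ D e (insert (a + 1) (X.erase a)) Y else 0 := by
  unfold GLmn.capSum
  rw [map_sum]
  have key : ∀ S ∈ D.powerset, Θ (q ^ S.card • κ (X ∪ moved D e S) (Y ∪ moved D e S)) =
      (if a + 1 ∈ Y ∧ a ∉ Y then q ^ S.card • κ (X ∪ moved D e S)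
        ((insert a (Y.erase (a + 1))) ∪ moved D e S) else 0) +
      if a ∈ X ∧ a + 1 ∉ X then
        q ^ ((if a + 1 ∈ Y then 1 else 0) - (if a ∈ Y then 1 else 0) : ℤ) •
          q ^ S.card • κ ((insert (a + 1) (X.erase a)) ∪ moved D e S) (Y ∪ moved D e S)
        else 0 := by
    intro S hS
    rw [Finset.mem_powerset] at hS
    have m1 : a ∉ moved D e S := by
      simp only [moved, Finset.mem_union, Finset.mem_sdiff, Finset.mem_image]; grind
    have m2 : a + 1 ∉ moved D e S := by
      simp only [moved, Finset.mem_union, Finset.mem_sdiff, Finset.mem_image]; grind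
    rw [map_smul, hΘ]
    generalize moved D e S = W at m1 m2
    have e1 : insert a ((Y ∪ W).erase (a + 1)) = insert a (Y.erase (a + 1)) ∪ W := by grind
    have e2 : insert (a + 1) ((X ∪ W).erase a) = insert (a + 1) (X.erase a) ∪ W := by grind
    rw [e1, e2]
    simp only [Finset.mem_union, m1, m2, or_false, smul_add, smul_ite, smul_zero]
    congr 2
    rw [smul_comm]
  rw [Finset.sum_congr rfl key, Finset.sum_add_distrib]
  congr 1
  · split_ifs <;> simp
  · split_ifs <;> simp [Finset.smul_sum]

/-- The table for double labels on `a` and `a + 1`, once the caps there are split off. Exactly one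
double label always yields the same vector, with a left label at `a + 1` and a right label at `a`;
none or two yield zero. -/
theorem LocalRule.capSum_caps_end (hΘ : LocalRule κ a Θ) {D : Finset ℤ} {e : ℤ → ℤ} (h1 : a ∉ D) (h2 : a + 1 ∉ D)
    (h3 : ∀ c ∈ D, e c ≠ a) (h4 : ∀ c ∈ D, e c ≠ a + 1) {X Y : Finset ℤ}
    (h5 : a ∉ X) (h6 : a + 1 ∉ X) (h7 : a ∉ Y) (h8 : a + 1 ∉ Y) :
    Θ (GLmn.capSum κ D e (insert a X) (insert a Y)) =
        q⁻¹ • GLmn.capSum κ D e (insert (a + 1) X) (insert a Y) ∧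
    Θ (GLmn.capSum κ D e (insert (a + 1) X) (insert (a + 1) Y)) =
        GLmn.capSum κ D e (insert (a + 1) X) (insert a Y) ∧
    Θ (GLmn.capSum κ D e X Y) = 0 ∧
    Θ (GLmn.capSum κ D e (insert a (insert (a + 1) X)) (insert a (insert (a + 1) Y))) = 0 := by
  refine ⟨?_, ?_, ?_, ?_⟩ <;> rw [hΘ.capSum h1 h2 h3 h4]
  · simp [h6, h8, Finset.erase_eq_of_notMem h5]
  · simp [h7, Finset.erase_eq_of_notMem h8]
  · simp [h5, h8]
  · simp

end

/-! ### Transport of cap diagrams by adjacent transpositions, and creation of small caps -/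

section

variable {V : Type*} [AddCommGroup V] [Module Qq V] {κ : Finset ℤ → Finset ℤ → V}
  {a : ℤ} {Θ : V →ₗ[Qq] V}

theorem capSum_map (σ : Equiv.Perm ℤ) (D : Finset ℤ) (e : ℤ → ℤ) (X Y : Finset ℤ) :
    capSum κ (D.image σ) (σ ∘ e ∘ σ.symm) (X.image σ) (Y.image σ) =
      capSum (fun A B => κ (A.image σ) (B.image σ)) D e X Y := by
  unfold capSum
  rw [Finset.powerset_image, Finset.sum_image]
  · refine Finset.sum_congr rfl fun S hS => ?_
    have h : moved (D.image σ) (σ ∘ e ∘ σ.symm) (S.image σ) = (moved D e S).image σ := by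
      simp only [moved, Finset.image_union, Finset.image_sdiff _ _ σ.injective, Finset.image_image]
      congr 2
      funext z
      simp
    rw [h, Finset.card_image_of_injective _ σ.injective, ← Finset.image_union, ← Finset.image_union]
  · exact (Finset.image_injective σ.injective).injOn

/-- A cap diagram depends only on the order of the vertices outside `N`, so a permutation that
respects this order transports it. -/
theorem IsCapping.map {N D : Finset ℤ} {e : ℤ → ℤ} (h : IsCapping N D e) (σ : Equiv.Perm ℤ)
    (hσ : ∀ u v, u ∉ N → v ∉ N → u < v → σ u < σ v) :
    IsCapping (N.image σ) (D.image σ) (σ ∘ e ∘ σ.symm) := by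
  have hmem : ∀ (S : Finset ℤ) z, σ z ∈ S.image σ ↔ z ∈ S := fun S z => by simp
  have hσ' : ∀ u v, u ∉ N → v ∉ N → σ u < σ v → u < v := by
    intro u v hu hv huv
    rcases lt_trichotomy u v with h1 | h1 | h1
    · exact h1
    · subst h1; exact absurd huv (lt_irrefl _)
    · exact absurd (hσ v u hv hu h1) (not_lt.2 huv.le)
  have hD : ∀ c ∈ D.image σ, ∃ d ∈ D, c = σ d := by
    intro c hc
    obtain ⟨d, hd, rfl⟩ := Finset.mem_image.1 hc
    exact ⟨d, hd, rfl⟩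
  constructor
  · intro c hc
    obtain ⟨d, hd, rfl⟩ := hD c hc
    simpa using hσ _ _ (h.disj d hd) (h.notMem_N d hd) (h.lt d hd)
  · intro c hc
    obtain ⟨d, hd, rfl⟩ := hD c hc
    simpa using h.notMem_N d hd
  · intro c hc
    obtain ⟨d, hd, rfl⟩ := hD c hc
    simpa using h.notMem_D d hd
  · intro c hc
    obtain ⟨d, hd, rfl⟩ := hD c hc
    rw [hmem]
    exact h.disj d hd
  · intro c hc c' hc' hcc
    obtain ⟨d, hd, rfl⟩ := hD c hc
    obtain ⟨d', hd', rfl⟩ := hD c' hc'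
    rw [h.inj d hd d' hd' (by simpa using hcc)]
  · intro c hc z hz1 hz2 hz3
    obtain ⟨d, hd, rfl⟩ := hD c hc
    obtain ⟨z, rfl⟩ := σ.surjective z
    rw [hmem] at hz3 ⊢
    simp only [Function.comp_apply, Equiv.symm_apply_apply] at hz2
    rcases h.nested d hd z (hσ' _ _ (h.disj d hd) hz3 hz1) (hσ' _ _ hz3 (h.notMem_N d hd) hz2) hz3
      with h1 | ⟨c', hc', h1, h2⟩
    · exact Or.inl h1
    · refine Or.inr ⟨σ c', Finset.mem_image_of_mem _ hc',
        hσ _ _ (h.disj d hd) (h.disj c' hc') h1, ?_⟩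
      simp [h2]

/-- The only order that an adjacent transposition reverses is that of `a` and `a + 1`, and one of
these is in `N`. -/
theorem swap_lt_swap {N : Finset ℤ} (a : ℤ) (h : a ∈ N ∨ a + 1 ∈ N) (u v : ℤ) (hu : u ∉ N)
    (hv : v ∉ N) (huv : u < v) : Equiv.swap a (a + 1) u < Equiv.swap a (a + 1) v := by
  simp only [Equiv.swap_apply_def]
  split_ifs <;> grind

theorem image_swap_of_mem_left {A : Finset ℤ} (h1 : a ∈ A) (h2 : a + 1 ∉ A) :
    A.image (Equiv.swap a (a + 1)) = insert (a + 1) (A.erase a) := by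
  ext z
  simp only [Finset.mem_image, Equiv.swap_apply_def, Finset.mem_insert, Finset.mem_erase]
  constructor
  · rintro ⟨w, hw, rfl⟩
    split_ifs <;> grind
  · rintro (rfl | h)
    · exact ⟨a, h1, by simp⟩
    · exact ⟨z, h.2, by grind⟩

theorem image_swap_of_mem_right {A : Finset ℤ} (h1 : a ∉ A) (h2 : a + 1 ∈ A) :
    A.image (Equiv.swap a (a + 1)) = insert a (A.erase (a + 1)) := by
  ext z
  simp only [Finset.mem_image, Equiv.swap_apply_def, Finset.mem_insert, Finset.mem_erase]
  constructor
  · rintro ⟨w, hw, rfl⟩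
    split_ifs <;> grind
  · rintro (rfl | h)
    · exact ⟨z + 1, h2, by simp⟩
    · exact ⟨z, h.2, by grind⟩

theorem image_swap_of_iff {A : Finset ℤ} (h : a ∈ A ↔ a + 1 ∈ A) :
    A.image (Equiv.swap a (a + 1)) = A := by
  ext z
  simp only [Finset.mem_image, Equiv.swap_apply_def]
  constructor
  · rintro ⟨w, hw, rfl⟩
    split_ifs <;> grind
  · intro hz
    refine ⟨Equiv.swap a (a + 1) z, ?_, ?_⟩
    · simp only [Equiv.swap_apply_def]; split_ifs <;> grind
    · simp only [Equiv.swap_apply_def]; split_ifs <;> grind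

theorem moved_subset_free {N D : Finset ℤ} {e : ℤ → ℤ} (h : IsCapping N D e) {S : Finset ℤ}
    (hS : S ⊆ D) {z : ℤ} (hz : z ∈ moved D e S) : z ∉ N := by
  simp only [moved, Finset.mem_union, Finset.mem_sdiff, Finset.mem_image] at hz
  rcases hz with hz | ⟨c, hc, rfl⟩
  · exact h.disj z hz.1
  · exact h.notMem_N c (hS hc)

/-- If exactly one of the vertices `a`, `a + 1` belongs to the cap diagram, and the other one may
be moved, then the two are interchanged. -/
theorem LocalRule.capSum_swap (hΘ : LocalRule κ a Θ) {X Y D : Finset ℤ} {e : ℤ → ℤ}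
    (h : IsCapping (X ∪ Y) D e) (hXY : Disjoint X Y)
    (ha : (a ∈ X ∧ a + 1 ∉ X ∪ Y) ∨ (a ∉ X ∪ Y ∧ a + 1 ∈ Y)) :
    Θ (GLmn.capSum κ D e X Y) =
      GLmn.capSum κ (D.image (Equiv.swap a (a + 1)))
        (Equiv.swap a (a + 1) ∘ e ∘ Equiv.swap a (a + 1))
        (X.image (Equiv.swap a (a + 1))) (Y.image (Equiv.swap a (a + 1))) := by
  have := capSum_map (κ := κ) (Equiv.swap a (a + 1)) D e X Y
  rw [Equiv.symm_swap] at this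
  rw [this]
  unfold GLmn.capSum
  rw [map_sum]
  refine Finset.sum_congr rfl fun S hS => ?_
  rw [map_smul]
  congr 1
  beta_reduce
  have hW : ∀ z ∈ moved D e S, z ∉ X ∪ Y := fun z hz =>
    moved_subset_free h (Finset.mem_powerset.1 hS) hz
  generalize moved D e S = W at hW
  have hd : ∀ z, z ∈ X → z ∉ Y := fun _ h => Finset.disjoint_left.1 hXY h
  simp only [Finset.mem_union, not_or] at ha hW
  rw [hΘ]
  rcases ha with ⟨h1, h2, h3⟩ | ⟨⟨h1, h2⟩, h3⟩
  · have h4 : a ∉ W := fun hw => (hW a hw).1 h1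
    have h5 : a ∉ Y := hd a h1
    -- If `a + 1` carries a double label, its right half moves to `a`, which also exchanges it with
    -- the left label at `a`. Otherwise the left label itself moves.
    by_cases h6 : a + 1 ∈ W
    · rw [if_pos (by simp [h4, h5, h6]), if_neg (by simp [h6]), add_zero,
        image_swap_of_iff (A := X ∪ W) (by simp [h1, h6]),
        image_swap_of_mem_right (A := Y ∪ W) (by simp [h4, h5]) (by simp [h6])]
    · rw [if_neg (by simp [h6, h3]), if_pos (by simp [h1, h2, h6]), zero_add,
        image_swap_of_iff (A := Y ∪ W) (by simp [h4, h5, h6, h3]),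
        image_swap_of_mem_left (A := X ∪ W) (by simp [h1]) (by simp [h2, h6]),
        if_neg (by simp [h6, h3]), if_neg (by simp [h4, h5])]
      simp
  · have h4 : a + 1 ∉ W := fun hw => (hW _ hw).2 h3
    have h5 : a + 1 ∉ X := fun hx => hd _ hx h3
    -- With a double label at `a`, its left half moves past the right label at `a + 1`; the exponent
    -- of `q` is `1 - 1`, so no power of `q` appears.
    by_cases h6 : a ∈ W
    · rw [if_neg (by simp [h6]), if_pos (by simp [h4, h5, h6]), zero_add,
        image_swap_of_iff (A := Y ∪ W) (by simp [h3, h6]),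
        image_swap_of_mem_left (A := X ∪ W) (by simp [h6]) (by simp [h4, h5]),
        if_pos (by simp [h3]), if_pos (by simp [h6])]
      simp
    · rw [if_pos (by simp [h6, h3, h2]), if_neg (by simp [h1, h6]), add_zero,
        image_swap_of_iff (A := X ∪ W) (by simp [h4, h5, h6, h1]),
        image_swap_of_mem_right (A := Y ∪ W) (by simp [h2, h6]) (by simp [h3])]

/-- Two neighbours outside the cap diagram, of different kinds, are replaced by a small cap. -/
theorem LocalRule.capSum_cup (hΘ : LocalRule κ a Θ) {X Y D : Finset ℤ} {e : ℤ → ℤ}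
    (h : IsCapping (X ∪ Y) D e) (hXY : Disjoint X Y) (h1 : a ∈ X) (h2 : a + 1 ∈ Y) :
    Θ (GLmn.capSum κ D e X Y) =
        GLmn.capSum κ (insert a D) (Function.update e a (a + 1)) (X.erase a) (Y.erase (a + 1)) ∧
      IsCapping (X.erase a ∪ Y.erase (a + 1)) (insert a D) (Function.update e a (a + 1)) := by
  have hd : ∀ z, z ∈ X → z ∉ Y := fun _ h => Finset.disjoint_left.1 hXY h
  obtain ⟨c1, c2, c3, c4, c5, c6⟩ := h
  simp only [Finset.mem_union, not_or] at c2 c4 c6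
  have ha : a ∉ D := by grind
  have ha' : a + 1 ∉ D := by grind
  constructor
  · have h3 : a + 1 ∉ X := by grind
    have h4 : a ∉ Y := by grind
    -- Both terms of the rule survive: a double label at `a` with weight 1, and one at `a + 1` with
    -- weight `q` because `a + 1 ∈ Y` and `a ∉ Y`. These are the two orientations of the new cap.
    rw [hΘ.capSum ha ha' (by grind) (by grind), capSum_insert _ ha, if_pos ⟨h2, h4⟩,
      if_pos ⟨h1, h3⟩, if_pos h2, if_neg h4, Function.update_self]
    have hc : ∀ c ∈ D, Function.update e a (a + 1) c = e c := fun c hc =>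
      Function.update_of_ne (by grind) _ _
    rw [capSum_congr _ hc, capSum_congr _ hc, Finset.insert_erase h1, Finset.insert_erase h2]
    simp
  · have hu : ∀ c ∈ D, Function.update e a (a + 1) c = e c := fun c hc =>
      Function.update_of_ne (by grind) _ _
    have hu' : Function.update e a (a + 1) a = a + 1 := Function.update_self ..
    generalize Function.update e a (a + 1) = e' at hu hu'
    constructor <;> simp only [Finset.mem_union, Finset.mem_insert, Finset.mem_erase]
    · grind
    · grind
    · grind
    · grind
    · grind
    · rintro c hc z h1 h2 h3
      by_cases hza : z = a
      · exact Or.inl (Or.inl hza)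
      by_cases hza' : z = a + 1
      · by_cases hca : c = a
        · subst hca; omega
        · exact Or.inr ⟨a, Or.inl rfl, by omega, by omega⟩
      · rcases hc with rfl | hc
        · omega
        · rw [hu c hc] at h2
          rcases c6 c hc z h1 h2 (by grind) with h4 | ⟨c', h4, h5, h6⟩
          · exact Or.inl (Or.inr h4)
          · exact Or.inr ⟨c', Or.inr h4, h5, by rw [hu c' h4, h6]⟩

end

/-! ### Surgery on cap diagrams at two neighbouring vertices -/

section

variable {N D : Finset ℤ} {e : ℤ → ℤ} {a : ℤ}

/-- A longer cap at `a` would have `a + 1` below it, and then `a + 1` would be the end of a cap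
starting strictly between `a` and `a + 1`. -/
theorem IsCapping.end_eq_succ (h : IsCapping N D e) (h1 : a ∈ D) (h2 : a + 1 ∉ N)
    (h3 : a + 1 ∉ D) : e a = a + 1 := by
  have h4 := h.lt a h1
  by_contra h5
  rcases h.nested a h1 (a + 1) (by omega) (by omega) h2 with h6 | ⟨c, hc, h6, h7⟩
  · exact h3 h6
  · have := h.lt c hc
    omega

theorem IsCapping.erase_small (h : IsCapping N D e) (h1 : a ∈ D) (h2 : a + 1 ∉ N)
    (h3 : a + 1 ∉ D) : IsCapping (insert a (insert (a + 1) N)) (D.erase a) e := by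
  have h4 := h.end_eq_succ h1 h2 h3
  obtain ⟨c1, c2, c3, c4, c5, c6⟩ := h
  constructor <;> simp only [Finset.mem_insert, Finset.mem_erase, not_or]
  · grind
  · intro c hc
    refine ⟨fun h => c3 c hc.2 (h ▸ h1), fun h => hc.1 (c5 c hc.2 a h1 (h.trans h4.symm)), c2 c hc.2⟩
  · grind
  · grind
  · grind
  · intro c hc z hz1 hz2 hz3
    rcases c6 c hc.2 z hz1 hz2 hz3.2.2 with h5 | ⟨c', h5, h6, h7⟩
    · exact Or.inl ⟨hz3.1, h5⟩
    · exact Or.inr ⟨c', ⟨fun hca => hz3.2.1 (by rw [h7, hca, h4]), h5⟩, h6, h7⟩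

/-- A cap over the one starting at `a + 1` would also pass over the unmatched vertex `a`. So there
is none, and the end of the erased cap may stay unmatched. -/
theorem IsCapping.erase_right_unmatched (h : IsCapping N D e) (h0 : a ∉ N) (h1 : a ∉ D)
    (h2 : a + 1 ∈ D) (h3 : ∀ c ∈ D, e c ≠ a) :
    IsCapping (insert a (insert (a + 1) N)) (D.erase (a + 1)) e := by
  obtain ⟨c1, c2, c3, c4, c5, c6⟩ := h
  constructor <;> simp only [Finset.mem_insert, Finset.mem_erase, not_or]
  · grind
  · intro c hc
    exact ⟨h3 c hc.2, fun h => c3 c hc.2 (h ▸ h2), c2 c hc.2⟩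
  · grind
  · grind
  · grind
  · intro c hc z hz1 hz2 hz3
    rcases c6 c hc.2 z hz1 hz2 hz3.2.2 with h5 | ⟨c', h5, h6, h7⟩
    · exact Or.inl ⟨hz3.2.1, h5⟩
    · refine Or.inr ⟨c', ⟨fun hca => ?_, h5⟩, h6, h7⟩
      subst hca
      have h8 : c ≠ a := fun h => h1 (h ▸ hc.2)
      have h9 := c1 (a + 1) h2
      rcases c6 c hc.2 a (by omega) (by omega) h0 with h10 | ⟨c', h10, -, h11⟩
      · exact h1 h10
      · exact h3 c' h10 h11.symm

/-- Caps that meet at the removed pair, one ending at `a` and one starting at `a + 1`, are fused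
into a single cap. -/
theorem IsCapping.join_right (h : IsCapping N D e) {c₀ : ℤ} (hc₀ : c₀ ∈ D) (h1 : e c₀ = a)
    (h2 : a + 1 ∈ D) :
    IsCapping (insert a (insert (a + 1) N)) (D.erase (a + 1))
      (Function.update e c₀ (e (a + 1))) := by
  have hne : c₀ ≠ a + 1 := by have := h.lt c₀ hc₀; omega
  have hu : ∀ c, c ≠ c₀ → Function.update e c₀ (e (a + 1)) c = e c := fun c hc =>
    Function.update_of_ne hc _ _
  have hu' : Function.update e c₀ (e (a + 1)) c₀ = e (a + 1) := Function.update_self ..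
  generalize Function.update e c₀ (e (a + 1)) = e' at hu hu'
  obtain ⟨c1, c2, c3, c4, c5, c6⟩ := h
  have l1 := c1 c₀ hc₀
  have l2 := c1 _ h2
  have haD : a ∉ D := h1 ▸ c3 c₀ hc₀
  have f1 : ∀ c ∈ D, e c ≠ a + 1 := fun c hc h => c3 c hc (h ▸ h2)
  have f2 : ∀ c ∈ D, c ≠ c₀ → e c ≠ a := fun c hc h h' => h (c5 c hc c₀ hc₀ (h'.trans h1.symm))
  constructor <;> simp only [Finset.mem_insert, Finset.mem_erase, not_or]
  · intro c hc
    by_cases hcc : c = c₀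
    · subst hcc; omega
    · rw [hu c hcc]; exact c1 c hc.2
  · intro c hc
    by_cases hcc : c = c₀
    · subst hcc; rw [hu']; exact ⟨by omega, by omega, c2 _ h2⟩
    · rw [hu c hcc]; exact ⟨f2 c hc.2 hcc, f1 c hc.2, c2 c hc.2⟩
  · intro c hc
    by_cases hcc : c = c₀
    · subst hcc; rw [hu']; exact fun h => c3 _ h2 h.2
    · rw [hu c hcc]; exact fun h => c3 c hc.2 h.2
  · grind
  · intro c hc c' hc' hcc'
    by_cases hcc : c = c₀ <;> by_cases hcc2 : c' = c₀
    · rw [hcc, hcc2]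
    · rw [hcc, hu', hu c' hcc2] at hcc'
      exact absurd (c5 _ h2 c' hc'.2 hcc').symm hc'.1
    · rw [hcc2, hu', hu c hcc] at hcc'
      exact absurd (c5 _ hc.2 _ h2 hcc') hc.1
    · rw [hu c hcc, hu c' hcc2] at hcc'
      exact c5 c hc.2 c' hc'.2 hcc'
  · intro c hc z hz1 hz2 hz3
    have conv : ∀ d ∈ D, c < d → z = e d → d ≠ a + 1 →
        (∃ c', (c' ≠ a + 1 ∧ c' ∈ D) ∧ c < c' ∧ z = e' c') := by
      intro d hd hd1 hd2 hd3
      refine ⟨d, ⟨hd3, hd⟩, hd1, ?_⟩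
      rw [hu, hd2]
      rintro rfl
      exact hz3.1 (hd2.trans h1)
    by_cases hcc : c = c₀
    · subst hcc
      rw [hu'] at hz2
      rcases lt_or_ge z a with h5 | h5
      · rcases c6 c hc.2 z hz1 (by omega) hz3.2.2 with h6 | ⟨d, h6, h7, h8⟩
        · exact Or.inl ⟨hz3.2.1, h6⟩
        · exact Or.inr (conv d h6 h7 h8 (by rintro rfl; omega))
      · have h6 : a + 1 < z := by have := hz3.1; have := hz3.2.1; omega
        rcases c6 _ h2 z h6 hz2 hz3.2.2 with h7 | ⟨d, h7, h8, h9⟩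
        · exact Or.inl ⟨hz3.2.1, h7⟩
        · exact Or.inr (conv d h7 (by omega) h9 (by omega))
    · rw [hu c hcc] at hz2
      rcases c6 c hc.2 z hz1 hz2 hz3.2.2 with h6 | ⟨d, h6, h7, h8⟩
      · exact Or.inl ⟨hz3.2.1, h6⟩
      · by_cases hd : d = a + 1
        · subst hd
          refine Or.inr ⟨c₀, ⟨hne, hc₀⟩, ?_, by rw [hu', h8]⟩
          have hca : c ≠ a := fun h => haD (h ▸ hc.2)
          -- A cap over the right one of the fused caps also has `a` below it, hence starts before
          -- `c₀`.
          rcases c6 c hc.2 a (by omega) (by omega) (h1 ▸ c2 c₀ hc₀) with h9 | ⟨d, h9, h10, h11⟩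
          · exact absurd h9 haD
          · rwa [c5 c₀ hc₀ d h9 (h1.trans h11)]
        · exact Or.inr (conv d h6 h7 h8 hd)

/-- Two caps ending at `a` and `a + 1` are nested. When their ends are removed, the outer start is
joined to the inner one, which turns from a start into an end. -/
theorem IsCapping.join_left (h : IsCapping N D e) {c₁ c₂ : ℤ} (hc₁ : c₁ ∈ D) (hc₂ : c₂ ∈ D)
    (h1 : e c₁ = a) (h2 : e c₂ = a + 1) :
    c₂ < c₁ ∧
    IsCapping (insert a (insert (a + 1) N)) (D.erase c₁) (Function.update e c₂ c₁) := by
  have hu : ∀ c, c ≠ c₂ → Function.update e c₂ c₁ c = e c := fun c hc =>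
    Function.update_of_ne hc _ _
  have hu' : Function.update e c₂ c₁ c₂ = c₁ := Function.update_self ..
  generalize Function.update e c₂ c₁ = e' at hu hu'
  obtain ⟨c1, c2, c3, c4, c5, c6⟩ := h
  have l1 := c1 c₁ hc₁
  have l2 := c1 c₂ hc₂
  have haD : a ∉ D := h1 ▸ c3 c₁ hc₁
  have haD' : a + 1 ∉ D := h2 ▸ c3 c₂ hc₂
  have hlt : c₂ < c₁ := by
    have hne : c₂ ≠ a := fun h => haD (h ▸ hc₂)
    rcases c6 c₂ hc₂ a (by omega) (by omega) (h1 ▸ c2 c₁ hc₁) with h3 | ⟨d, h3, h4, h5⟩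
    · exact absurd h3 haD
    · rwa [c5 c₁ hc₁ d h3 (h1.trans h5)]
  refine ⟨hlt, ?_⟩
  have f1 : ∀ c ∈ D, c ≠ c₁ → e c ≠ a := fun c hc h h' => h (c5 c hc c₁ hc₁ (h'.trans h1.symm))
  have f2 : ∀ c ∈ D, c ≠ c₂ → e c ≠ a + 1 := fun c hc h h' =>
    h (c5 c hc c₂ hc₂ (h'.trans h2.symm))
  constructor <;> simp only [Finset.mem_insert, Finset.mem_erase, not_or]
  · intro c hc
    by_cases hcc : c = c₂
    · subst hcc; omega
    · rw [hu c hcc]; exact c1 c hc.2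
  · intro c hc
    by_cases hcc : c = c₂
    · subst hcc; rw [hu']; exact ⟨by omega, by omega, c4 _ hc₁⟩
    · rw [hu c hcc]; exact ⟨f1 c hc.2 hc.1, f2 c hc.2 hcc, c2 c hc.2⟩
  · intro c hc
    by_cases hcc : c = c₂
    · subst hcc; rw [hu']; exact fun h => h.1 rfl
    · rw [hu c hcc]; exact fun h => c3 c hc.2 h.2
  · intro c hc
    exact ⟨fun h => haD (h ▸ hc.2), fun h => haD' (h ▸ hc.2), c4 c hc.2⟩
  · intro c hc c' hc' hcc'
    by_cases hcc : c = c₂ <;> by_cases hcc2 : c' = c₂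
    · rw [hcc, hcc2]
    · rw [hcc, hu', hu c' hcc2] at hcc'
      exact absurd (hcc' ▸ hc₁) (c3 c' hc'.2)
    · rw [hcc2, hu', hu c hcc] at hcc'
      exact absurd (hcc' ▸ hc₁) (c3 c hc.2)
    · rw [hu c hcc, hu c' hcc2] at hcc'
      exact c5 c hc.2 c' hc'.2 hcc'
  · intro c hc z hz1 hz2 hz3
    have conv : ∀ d ∈ D, c < d → z = e d →
        (∃ c', (c' ≠ c₁ ∧ c' ∈ D) ∧ c < c' ∧ z = e' c') := by
      intro d hd hd1 hd2
      refine ⟨d, ⟨?_, hd⟩, hd1, ?_⟩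
      · rintro rfl
        exact hz3.1 (hd2.trans h1)
      · rw [hu, hd2]
        rintro rfl
        exact hz3.2.1 (hd2.trans h2)
    by_cases hcc : c = c₂
    · subst hcc
      rw [hu'] at hz2
      rcases c6 c hc.2 z hz1 (by omega) hz3.2.2 with h6 | ⟨d, h6, h7, h8⟩
      · exact Or.inl ⟨by omega, h6⟩
      · exact Or.inr (conv d h6 h7 h8)
    · rw [hu c hcc] at hz2
      rcases c6 c hc.2 z hz1 hz2 hz3.2.2 with h6 | ⟨d, h6, h7, h8⟩
      · by_cases hzc : z = c₁
        · subst hzc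
          refine Or.inr ⟨c₂, ⟨by omega, hc₂⟩, ?_, hu'.symm⟩
          -- A cap over `c₁` cannot end before `a`, where the cap of `c₁` ends; avoiding `a` and `a
          -- + 1`, it ends beyond both, and so starts before `c₂` by nesting.
          have l3 : a ≤ e c := by
            by_contra hlt'
            rcases c6 z hc₁ (e c) hz2 (by omega) (c2 c hc.2) with h7 | ⟨d, h7, h8, h9⟩
            · exact c3 c hc.2 h7
            · have := c5 c hc.2 d h7 h9; omega
          have l4 := f1 c hc.2 hc.1
          have l5 := f2 c hc.2 hcc
          rcases c6 c hc.2 (a + 1) (by omega) (by omega) (h2 ▸ c2 c₂ hc₂) with h9 | ⟨d, h9, h10, h11⟩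
          · exact absurd h9 haD'
          · rwa [c5 c₂ hc₂ d h9 (h2.trans h11)]
        · exact Or.inl ⟨hzc, h6⟩
      · exact Or.inr (conv d h6 h7 h8)

/-- By noncrossing, a cap over `c₀` would reach beyond `a + 1`, which is unmatched. So there is
none, and `c₀` may stay unmatched. -/
theorem IsCapping.erase_left_unmatched (h : IsCapping N D e) {c₀ : ℤ} (hc₀ : c₀ ∈ D)
    (h1 : e c₀ = a) (h2 : a + 1 ∉ D) (h2' : a + 1 ∉ N) (h3 : ∀ c ∈ D, e c ≠ a + 1) :
    IsCapping (insert a (insert (a + 1) N)) (D.erase c₀) e := by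
  obtain ⟨c1, c2, c3, c4, c5, c6⟩ := h
  have haD : a ∉ D := h1 ▸ c3 c₀ hc₀
  have l1 := c1 c₀ hc₀
  have f1 : ∀ c ∈ D, c ≠ c₀ → e c ≠ a := fun c hc h h' => h (c5 c hc c₀ hc₀ (h'.trans h1.symm))
  constructor <;> simp only [Finset.mem_insert, Finset.mem_erase, not_or]
  · grind
  · intro c hc
    exact ⟨f1 c hc.2 hc.1, h3 c hc.2, c2 c hc.2⟩
  · grind
  · intro c hc
    exact ⟨fun h => haD (h ▸ hc.2), fun h => h2 (h ▸ hc.2), c4 c hc.2⟩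
  · grind
  · intro c hc z hz1 hz2 hz3
    rcases c6 c hc.2 z hz1 hz2 hz3.2.2 with h5 | ⟨c', h5, h6, h7⟩
    · refine Or.inl ⟨?_, h5⟩
      rintro rfl
      have l3 : a ≤ e c := by
        by_contra hlt'
        rcases c6 z hc₀ (e c) hz2 (by omega) (c2 c hc.2) with h7 | ⟨d, h7, h8, h9⟩
        · exact c3 c hc.2 h7
        · have := c5 c hc.2 d h7 h9; omega
      have l4 := f1 c hc.2 hc.1
      have l5 := h3 c hc.2
      rcases c6 c hc.2 (a + 1) (by omega) (by omega) h2' with h9 | ⟨d, h9, h10, h11⟩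
      · exact h2 h9
      · exact h3 d h9 h11.symm
    · exact Or.inr ⟨c', ⟨fun hca => hz3.1 (by rw [h7, hca, h1]), h5⟩, h6, h7⟩

/-- Two caps starting at `a` and `a + 1` are nested. When their starts are removed, the inner end
becomes the start of a cap to the outer end. -/
theorem IsCapping.join_outer (h : IsCapping N D e) (h1 : a ∈ D) (h2 : a + 1 ∈ D) :
    e (a + 1) < e a ∧
    IsCapping (insert a (insert (a + 1) N)) (insert (e (a + 1)) ((D.erase a).erase (a + 1)))
      (Function.update e (e (a + 1)) (e a)) := by
  have hu : ∀ c, c ≠ e (a + 1) → Function.update e (e (a + 1)) (e a) c = e c := fun c hc =>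
    Function.update_of_ne hc _ _
  have hu' : Function.update e (e (a + 1)) (e a) (e (a + 1)) = e a := Function.update_self ..
  generalize Function.update e (e (a + 1)) (e a) = e' at hu hu'
  obtain ⟨c1, c2, c3, c4, c5, c6⟩ := h
  have l1 := c1 a h1
  have l2 := c1 _ h2
  have f1 : ∀ c ∈ D, e c ≠ a := fun c hc h => c3 c hc (h ▸ h1)
  have f2 : ∀ c ∈ D, e c ≠ a + 1 := fun c hc h => c3 c hc (h ▸ h2)
  have fu : ∀ c ∈ D, c ≠ e (a + 1) := fun c hc h => c3 _ h2 (h ▸ hc)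
  have hlt : e (a + 1) < e a := by
    by_contra hlt
    have l3 := f2 a h1
    have l4 : e a ≠ e (a + 1) := fun h => by have := c5 a h1 _ h2 h; omega
    rcases c6 _ h2 (e a) (by omega) (by omega) (c2 a h1) with h7 | ⟨d, h7, h8, h9⟩
    · exact c3 a h1 h7
    · have := c5 a h1 d h7 h9; omega
  refine ⟨hlt, ?_⟩
  constructor <;> simp only [Finset.mem_insert, Finset.mem_erase, not_or]
  · rintro c (rfl | hc)
    · rw [hu']; exact hlt
    · rw [hu c (fu c hc.2.2)]; exact c1 c hc.2.2
  · rintro c (rfl | hc)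
    · rw [hu']; exact ⟨f1 a h1, f2 a h1, c2 a h1⟩
    · rw [hu c (fu c hc.2.2)]; exact ⟨f1 c hc.2.2, f2 c hc.2.2, c2 c hc.2.2⟩
  · rintro c (rfl | hc)
    · rw [hu']; exact ⟨by omega, fun h => c3 a h1 h.2.2⟩
    · rw [hu c (fu c hc.2.2)]
      exact ⟨fun h => hc.1 (c5 c hc.2.2 _ h2 h), fun h => c3 c hc.2.2 h.2.2⟩
  · rintro c (rfl | hc)
    · exact ⟨f1 _ h2, f2 _ h2, c2 _ h2⟩
    · exact ⟨hc.2.1, hc.1, c4 c hc.2.2⟩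
  · rintro c (rfl | hc) c' (rfl | hc') hcc'
    · rfl
    · rw [hu', hu c' (fu c' hc'.2.2)] at hcc'
      exact absurd (c5 _ h1 c' hc'.2.2 hcc').symm hc'.2.1
    · rw [hu', hu c (fu c hc.2.2)] at hcc'
      exact absurd (c5 _ hc.2.2 _ h1 hcc') hc.2.1
    · rw [hu c (fu c hc.2.2), hu c' (fu c' hc'.2.2)] at hcc'
      exact c5 c hc.2.2 c' hc'.2.2 hcc'
  · rintro c hc z hz1 hz2 hz3
    have conv : ∀ d ∈ D, d ≠ a → d ≠ a + 1 → c < d → z = e d →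
        (∃ c', (c' = e (a + 1) ∨ c' ≠ a + 1 ∧ c' ≠ a ∧ c' ∈ D) ∧ c < c' ∧ z = e' c') := by
      intro d hd hd1 hd2 hd3 hd4
      exact ⟨d, Or.inr ⟨hd2, hd1, hd⟩, hd3, by rw [hu d (fu d hd), hd4]⟩
    rcases hc with rfl | hc
    · rw [hu'] at hz2
      rcases c6 a h1 z (by omega) hz2 hz3.2.2 with h6 | ⟨d, h6, h7, h8⟩
      · exact Or.inl (Or.inr ⟨hz3.2.1, hz3.1, h6⟩)
      · have hd : d ≠ a + 1 := by rintro rfl; omega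
        refine Or.inr (conv d h6 (by omega) hd ?_ h8)
        -- A cap that starts below the inner cap and ends beyond it would cross it.
        by_contra hlt'
        have := fu d h6
        rcases c6 _ h2 d (by omega) (by omega) (c4 d h6) with h9 | ⟨d', h9, -, h11⟩
        · rcases c6 d h6 (e (a + 1)) (by omega) (by omega) (c2 _ h2) with h12 | ⟨d', h12, h13, h14⟩
          · exact c3 _ h2 h12
          · have := c5 _ h2 d' h12 h14; omega
        · exact c3 d' h9 (h11 ▸ h6)
    · rw [hu c (fu c hc.2.2)] at hz2
      rcases c6 c hc.2.2 z hz1 hz2 hz3.2.2 with h6 | ⟨d, h6, h7, h8⟩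
      · exact Or.inl (Or.inr ⟨hz3.2.1, hz3.1, h6⟩)
      · by_cases hd : d = a + 1
        · subst hd
          exact Or.inl (Or.inl h8)
        · by_cases hd' : d = a
          · subst hd'
            exact Or.inr ⟨e (d + 1), Or.inl rfl, by omega, by rw [hu', h8]⟩
          · exact Or.inr (conv d h6 hd' hd h7 h8)

end

/-! ### Stability of cap sums under the generators, and their generation from vectors without caps
-/

section

variable {V : Type*} [AddCommGroup V] [Module Qq V] {κ : Finset ℤ → Finset ℤ → V}
  {a : ℤ} {Θ : V →ₗ[Qq] V}

theorem q_ne_zero : (q : Qq) ≠ 0 := RatFunc.X_ne_zero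

/-- Case distinction on whether `a` and `a + 1` are starts of caps, ends of caps, or unmatched.
Splitting off the caps there reduces each case to the table `capSum_caps_end`; the loose ends of the
caps are then joined or left free. The factor `q + q⁻¹` arises only from a cap joining `a` to `a +
1`, as the value of a closed loop. -/
theorem LocalRule.capSum_free (hΘ : LocalRule κ a Θ) {X Y D : Finset ℤ} {e : ℤ → ℤ}
    (h : IsCapping (X ∪ Y) D e) (ha : a ∉ X ∪ Y) (ha' : a + 1 ∉ X ∪ Y) :
    Θ (GLmn.capSum κ D e X Y) = 0 ∨ ∃ D' e',
      IsCapping (insert (a + 1) X ∪ insert a Y) D' e' ∧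
      (Θ (GLmn.capSum κ D e X Y) = GLmn.capSum κ D' e' (insert (a + 1) X) (insert a Y) ∨
        Θ (GLmn.capSum κ D e X Y) =
          (q + q⁻¹) • GLmn.capSum κ D' e' (insert (a + 1) X) (insert a Y)) := by
  have hN : insert (a + 1) X ∪ insert a Y = insert a (insert (a + 1) (X ∪ Y)) := by
    ext z; simp
  rw [hN]
  have ha0 := ha
  have ha0' := ha'
  simp only [Finset.mem_union, not_or] at ha ha'
  obtain ⟨hx, hy⟩ := ha
  obtain ⟨hx', hy'⟩ := ha'
  have eN : ∀ c ∈ D, e c ∉ D := h.notMem_D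
  by_cases h1 : a ∈ D
  · by_cases h2 : a + 1 ∈ D
    · right
      obtain ⟨hlt, hcap⟩ := h.join_outer h1 h2
      refine ⟨_, _, hcap, Or.inl ?_⟩
      obtain ⟨D₀, hD₀⟩ : ∃ D₀, D₀ = (D.erase a).erase (a + 1) := ⟨_, rfl⟩
      have hD : D = insert a (insert (a + 1) D₀) := by
        rw [hD₀, Finset.insert_erase (by simp [h2]), Finset.insert_erase h1]
      have hin : ∀ c ∈ D₀, c ∈ D := fun c hc => by rw [hD]; simp [hc]
      have m1 : a ∉ D₀ := by simp [hD₀]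
      have m2 : a + 1 ∉ D₀ := by simp [hD₀]
      have m3 : ∀ c ∈ D₀, e c ≠ a := fun c hc hca => eN c (hin c hc) (hca ▸ h1)
      have m4 : ∀ c ∈ D₀, e c ≠ a + 1 := fun c hc hca => eN c (hin c hc) (hca ▸ h2)
      have n1 : e (a + 1) ∉ D₀ := fun hc => eN _ h2 (hin _ hc)
      have k1 : e a ≠ a := (h.lt a h1).ne'
      have k2 : e a ≠ a + 1 := fun hc => eN a h1 (hc ▸ h2)
      have k3 : e (a + 1) ≠ a + 1 := (h.lt _ h2).ne'
      have k4 : e (a + 1) ≠ a := by have := h.lt _ h2; omega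
      rw [← hD₀, capSum_insert _ n1, Function.update_self]
      have hc : ∀ c ∈ D₀, Function.update e (e (a + 1)) (e a) c = e c := fun c hc =>
        Function.update_of_ne (by rintro rfl; exact n1 hc) _ _
      rw [capSum_congr _ hc, capSum_congr _ hc]
      rw [hD, capSum_insert _ (by simp [m1]), capSum_insert _ m2, capSum_insert _ m2]
      have s1 := (hΘ.capSum_caps_end m1 m2 m3 m4 (X := X) (Y := Y) hx hx' hy hy').2.2.2
      have s2 := (hΘ.capSum_caps_end m1 m2 m3 m4 (X := insert (e (a + 1)) X)
        (Y := insert (e (a + 1)) Y) (by simp [hx, k4.symm]) (by simp [hx', k3.symm])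
        (by simp [hy, k4.symm]) (by simp [hy', k3.symm])).1
      have s3 := (hΘ.capSum_caps_end m1 m2 m3 m4 (X := insert (e a) X)
        (Y := insert (e a) Y) (by simp [hx, k1.symm]) (by simp [hx', k2.symm])
        (by simp [hy, k1.symm]) (by simp [hy', k2.symm])).2.1
      have s4 := (hΘ.capSum_caps_end m1 m2 m3 m4 (X := insert (e (a + 1)) (insert (e a) X))
        (Y := insert (e (a + 1)) (insert (e a) Y))
        (by simp [hx, k1.symm, k4.symm]) (by simp [hx', k2.symm, k3.symm])
        (by simp [hy, k1.symm, k4.symm]) (by simp [hy', k2.symm, k3.symm])).2.2.1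
      rw [Finset.insert_comm (e (a + 1)) a, Finset.insert_comm (e (a + 1)) a,
        Finset.insert_comm (a + 1) a, Finset.insert_comm (a + 1) a]
      simp only [map_add, map_smul, s1, s2, s3, s4]
      -- Moving the inner cap alone has total weight `q * q⁻¹ = 1` and leaves a double label at `e
      -- (a + 1)`; moving the outer cap alone has weight `q` and leaves one at `e a`. These are the
      -- orientations of the joined cap.
      rw [zero_add, smul_zero, add_zero, smul_inv_smul₀ q_ne_zero,
        Finset.insert_comm (a + 1), Finset.insert_comm a, Finset.insert_comm (a + 1) (e a),
        Finset.insert_comm a (e a)]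
    · right
      have h3 := h.end_eq_succ h1 ha0' h2
      refine ⟨_, _, h.erase_small h1 ha0' h2, Or.inr ?_⟩
      obtain ⟨D₀, hD₀⟩ : ∃ D₀, D₀ = D.erase a := ⟨_, rfl⟩
      have hD : D = insert a D₀ := by rw [hD₀, Finset.insert_erase h1]
      have hin : ∀ c ∈ D₀, c ∈ D := fun c hc => by rw [hD]; simp [hc]
      have m1 : a ∉ D₀ := by simp [hD₀]
      have m2 : a + 1 ∉ D₀ := fun hc => h2 (hin _ hc)
      have m3 : ∀ c ∈ D₀, e c ≠ a := fun c hc hca => eN c (hin c hc) (hca ▸ h1)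
      have m4 : ∀ c ∈ D₀, e c ≠ a + 1 := fun c hc hca => m1
        (h.inj c (hin c hc) a h1 (hca.trans h3.symm) ▸ hc)
      rw [← hD₀, hD, capSum_insert _ m1, h3]
      obtain ⟨s1, s2, -, -⟩ := hΘ.capSum_caps_end m1 m2 m3 m4 hx hx' hy hy'
      -- The label at the start contributes `q⁻¹` and the label at the end contributes `q`, on the
      -- same vector.
      rw [map_add, map_smul, s1, s2, add_smul, add_comm]
  · by_cases h2 : a + 1 ∈ D
    · right
      have k3 : e (a + 1) ≠ a + 1 := (h.lt _ h2).ne'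
      have k4 : e (a + 1) ≠ a := by have := h.lt _ h2; omega
      by_cases h3 : ∃ c ∈ D, e c = a
      · obtain ⟨c₀, hc₀, h3⟩ := h3
        refine ⟨_, _, h.join_right hc₀ h3 h2, Or.inl ?_⟩
        have k1 : c₀ ≠ a := fun hc => h1 (hc ▸ hc₀)
        have k2 : c₀ ≠ a + 1 := by have := h.lt _ hc₀; omega
        obtain ⟨D₀, hD₀⟩ : ∃ D₀, D₀ = (D.erase (a + 1)).erase c₀ := ⟨_, rfl⟩
        have hD' : D.erase (a + 1) = insert c₀ D₀ := by
          rw [hD₀, Finset.insert_erase (by simp [hc₀, k2])]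
        have hD : D = insert c₀ (insert (a + 1) D₀) := by
          rw [Finset.insert_comm, ← hD', Finset.insert_erase h2]
        have hin : ∀ c ∈ D₀, c ∈ D := fun c hc => by rw [hD]; simp [hc]
        have m0 : c₀ ∉ D₀ := by simp [hD₀]
        have m1 : a ∉ D₀ := fun hc => h1 (hin _ hc)
        have m2 : a + 1 ∉ D₀ := by simp [hD₀]
        have m3 : ∀ c ∈ D₀, e c ≠ a := fun c hc hca => m0
          (h.inj c (hin c hc) c₀ hc₀ (hca.trans h3.symm) ▸ hc)
        have m4 : ∀ c ∈ D₀, e c ≠ a + 1 := fun c hc hca => eN c (hin c hc) (hca ▸ h2)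
        rw [hD', capSum_insert _ m0, Function.update_self]
        have hc : ∀ c ∈ D₀, Function.update e c₀ (e (a + 1)) c = e c := fun c hc =>
          Function.update_of_ne (by rintro rfl; exact m0 hc) _ _
        rw [capSum_congr _ hc, capSum_congr _ hc]
        rw [hD, capSum_insert _ (by simp [m0, k2]), capSum_insert _ m2, capSum_insert _ m2, h3]
        have s1 := (hΘ.capSum_caps_end m1 m2 m3 m4 (X := insert c₀ X) (Y := insert c₀ Y)
          (by simp [hx, k1.symm]) (by simp [hx', k2.symm])
          (by simp [hy, k1.symm]) (by simp [hy', k2.symm])).2.1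
        have s2 := (hΘ.capSum_caps_end m1 m2 m3 m4 (X := insert (e (a + 1)) (insert c₀ X))
          (Y := insert (e (a + 1)) (insert c₀ Y))
          (by simp [hx, k1.symm, k4.symm]) (by simp [hx', k2.symm, k3.symm])
          (by simp [hy, k1.symm, k4.symm]) (by simp [hy', k2.symm, k3.symm])).2.2.1
        have s3 := (hΘ.capSum_caps_end m1 m2 m3 m4 (X := X) (Y := Y) hx hx' hy hy').2.2.2
        have s4 := (hΘ.capSum_caps_end m1 m2 m3 m4 (X := insert (e (a + 1)) X)
          (Y := insert (e (a + 1)) Y) (by simp [hx, k4.symm]) (by simp [hx', k3.symm])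
          (by simp [hy, k4.symm]) (by simp [hy', k3.symm])).1
        rw [Finset.insert_comm (a + 1) a X, Finset.insert_comm (a + 1) a Y,
          Finset.insert_comm (e (a + 1)) a X, Finset.insert_comm (e (a + 1)) a Y]
        simp only [map_add, map_smul, s1, s2, s3, s4]
        rw [zero_add, smul_zero, add_zero, smul_inv_smul₀ q_ne_zero,
          Finset.insert_comm (a + 1) c₀, Finset.insert_comm a c₀, Finset.insert_comm (a + 1),
          Finset.insert_comm a]
      · have h3' : ∀ c ∈ D, e c ≠ a := fun c hc hca => h3 ⟨c, hc, hca⟩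
        refine ⟨_, _, h.erase_right_unmatched ha0 h1 h2 h3', Or.inl ?_⟩
        obtain ⟨D₀, hD₀⟩ : ∃ D₀, D₀ = D.erase (a + 1) := ⟨_, rfl⟩
        have hD : D = insert (a + 1) D₀ := by rw [hD₀, Finset.insert_erase h2]
        have hin : ∀ c ∈ D₀, c ∈ D := fun c hc => by rw [hD]; simp [hc]
        have m1 : a ∉ D₀ := fun hc => h1 (hin _ hc)
        have m2 : a + 1 ∉ D₀ := by simp [hD₀]
        have m3 : ∀ c ∈ D₀, e c ≠ a := fun c hc => h3' c (hin c hc)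
        have m4 : ∀ c ∈ D₀, e c ≠ a + 1 := fun c hc hca => eN c (hin c hc) (hca ▸ h2)
        rw [← hD₀, hD, capSum_insert _ m2]
        have s1 := (hΘ.capSum_caps_end m1 m2 m3 m4 hx hx' hy hy').2.1
        have s2 := (hΘ.capSum_caps_end m1 m2 m3 m4 (X := insert (e (a + 1)) X)
          (Y := insert (e (a + 1)) Y) (by simp [hx, k4.symm]) (by simp [hx', k3.symm])
          (by simp [hy, k4.symm]) (by simp [hy', k3.symm])).2.2.1
        rw [map_add, map_smul, s1, s2, smul_zero, add_zero]
    · by_cases h3 : ∃ c ∈ D, e c = a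
      · right
        obtain ⟨c₁, hc₁, h3⟩ := h3
        have k1 : c₁ ≠ a := fun hc => h1 (hc ▸ hc₁)
        have k2 : c₁ ≠ a + 1 := by have := h.lt _ hc₁; omega
        by_cases h4 : ∃ c ∈ D, e c = a + 1
        · obtain ⟨c₂, hc₂, h4⟩ := h4
          obtain ⟨hlt, hcap⟩ := h.join_left hc₁ hc₂ h3 h4
          refine ⟨_, _, hcap, Or.inl ?_⟩
          have k3 : c₂ ≠ a := fun hc => h1 (hc ▸ hc₂)
          have k4 : c₂ ≠ a + 1 := fun hc => h2 (hc ▸ hc₂)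
          obtain ⟨D₀, hD₀⟩ : ∃ D₀, D₀ = (D.erase c₁).erase c₂ := ⟨_, rfl⟩
          have hD' : D.erase c₁ = insert c₂ D₀ := by
            rw [hD₀, Finset.insert_erase (by simp [hc₂, hlt.ne])]
          have hD : D = insert c₁ (insert c₂ D₀) := by
            rw [← hD', Finset.insert_erase hc₁]
          have hin : ∀ c ∈ D₀, c ∈ D := fun c hc => by rw [hD]; simp [hc]
          have m0 : c₂ ∉ D₀ := by simp [hD₀]
          have m0' : c₁ ∉ D₀ := by simp [hD₀]
          have m1 : a ∉ D₀ := fun hc => h1 (hin _ hc)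
          have m2 : a + 1 ∉ D₀ := fun hc => h2 (hin _ hc)
          have m3 : ∀ c ∈ D₀, e c ≠ a := fun c hc hca => m0'
            (h.inj c (hin c hc) c₁ hc₁ (hca.trans h3.symm) ▸ hc)
          have m4 : ∀ c ∈ D₀, e c ≠ a + 1 := fun c hc hca => m0
            (h.inj c (hin c hc) c₂ hc₂ (hca.trans h4.symm) ▸ hc)
          rw [hD', capSum_insert _ m0, Function.update_self]
          have hc : ∀ c ∈ D₀, Function.update e c₂ c₁ c = e c := fun c hc =>
            Function.update_of_ne (by rintro rfl; exact m0 hc) _ _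
          rw [capSum_congr _ hc, capSum_congr _ hc]
          rw [hD, capSum_insert _ (by simp [m0', hlt.ne']), capSum_insert _ m0,
            capSum_insert _ m0, h3, h4]
          have s1 := (hΘ.capSum_caps_end m1 m2 m3 m4 (X := insert c₂ (insert c₁ X))
            (Y := insert c₂ (insert c₁ Y))
            (by simp [hx, k1.symm, k3.symm]) (by simp [hx', k2.symm, k4.symm])
            (by simp [hy, k1.symm, k3.symm]) (by simp [hy', k2.symm, k4.symm])).2.2.1
          have s2 := (hΘ.capSum_caps_end m1 m2 m3 m4 (X := insert c₁ X) (Y := insert c₁ Y)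
            (by simp [hx, k1.symm]) (by simp [hx', k2.symm])
            (by simp [hy, k1.symm]) (by simp [hy', k2.symm])).2.1
          have s3 := (hΘ.capSum_caps_end m1 m2 m3 m4 (X := insert c₂ X) (Y := insert c₂ Y)
            (by simp [hx, k3.symm]) (by simp [hx', k4.symm])
            (by simp [hy, k3.symm]) (by simp [hy', k4.symm])).1
          have s4 := (hΘ.capSum_caps_end m1 m2 m3 m4 (X := X) (Y := Y) hx hx' hy hy').2.2.2
          rw [Finset.insert_comm c₂ a, Finset.insert_comm c₂ a,
            Finset.insert_comm (a + 1) a, Finset.insert_comm (a + 1) a]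
          simp only [map_add, map_smul, s1, s2, s3, s4]
          rw [zero_add, smul_zero, add_zero, smul_inv_smul₀ q_ne_zero,
            Finset.insert_comm (a + 1) c₁, Finset.insert_comm a c₁, Finset.insert_comm (a + 1),
            Finset.insert_comm a, add_comm]
        · have h4' : ∀ c ∈ D, e c ≠ a + 1 := fun c hc hca => h4 ⟨c, hc, hca⟩
          refine ⟨_, _, h.erase_left_unmatched hc₁ h3 h2 ha0' h4', Or.inl ?_⟩
          obtain ⟨D₀, hD₀⟩ : ∃ D₀, D₀ = D.erase c₁ := ⟨_, rfl⟩
          have hD : D = insert c₁ D₀ := by rw [hD₀, Finset.insert_erase hc₁]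
          have hin : ∀ c ∈ D₀, c ∈ D := fun c hc => by rw [hD]; simp [hc]
          have m0 : c₁ ∉ D₀ := by simp [hD₀]
          have m1 : a ∉ D₀ := fun hc => h1 (hin _ hc)
          have m2 : a + 1 ∉ D₀ := fun hc => h2 (hin _ hc)
          have m3 : ∀ c ∈ D₀, e c ≠ a := fun c hc hca => m0
            (h.inj c (hin c hc) c₁ hc₁ (hca.trans h3.symm) ▸ hc)
          have m4 : ∀ c ∈ D₀, e c ≠ a + 1 := fun c hc => h4' c (hin c hc)
          rw [← hD₀, hD, capSum_insert _ m0, h3]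
          have s1 := (hΘ.capSum_caps_end m1 m2 m3 m4 hx hx' hy hy').1
          have s2 := (hΘ.capSum_caps_end m1 m2 m3 m4 (X := insert c₁ X)
            (Y := insert c₁ Y) (by simp [hx, k1.symm]) (by simp [hx', k2.symm])
            (by simp [hy, k1.symm]) (by simp [hy', k2.symm])).2.2.1
          rw [map_add, map_smul, s1, s2, zero_add, smul_inv_smul₀ q_ne_zero]
      -- If no cap ends at `a`, none ends at `a + 1` either, since it would pass over the unmatched
      -- vertex `a`. So no cap meets the two vertices.
      · left
        have h3' : ∀ c ∈ D, e c ≠ a := fun c hc hca => h3 ⟨c, hc, hca⟩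
        refine (hΘ.capSum_caps_end h1 h2 h3' (fun c hc hca => ?_) hx hx' hy hy').2.2.1
        have h4 := h.lt c hc
        have h5 : c ≠ a := fun h => h1 (h ▸ hc)
        rcases h.nested c hc a (by omega) (by omega) ha0 with h6 | ⟨d, h6, -, h7⟩
        · exact h1 h6
        · exact h3' d h6 h7.symm

/-- If `a` carries a right label only, no right label can move to `a` and no left label can leave
it. A lone left label at `a + 1` blocks both terms of the rule likewise. -/
theorem LocalRule.capSum_eq_zero (hΘ : LocalRule κ a Θ) {X Y D : Finset ℤ} {e : ℤ → ℤ}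
    (h : IsCapping (X ∪ Y) D e) (hXY : Disjoint X Y) (ha : a ∈ Y ∨ a + 1 ∈ X) :
    Θ (GLmn.capSum κ D e X Y) = 0 := by
  unfold GLmn.capSum
  rw [map_sum]
  refine Finset.sum_eq_zero fun S hS => ?_
  have hW : ∀ z ∈ moved D e S, z ∉ X ∪ Y := fun z hz =>
    moved_subset_free h (Finset.mem_powerset.1 hS) hz
  generalize moved D e S = W at hW
  have hd : ∀ z, z ∈ X → z ∉ Y := fun _ h => Finset.disjoint_left.1 hXY h
  simp only [Finset.mem_union, not_or] at hW
  rw [map_smul, hΘ]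
  rcases ha with ha | ha
  · have h1 : a ∉ X := fun hx => hd a hx ha
    have h2 : a ∉ W := fun hw => (hW a hw).2 ha
    simp [ha, h1, h2]
  · have h1 : a + 1 ∉ Y := fun hy => hd _ ha hy
    have h2 : a + 1 ∉ W := fun hw => (hW _ hw).1 ha
    simp [ha, h1, h2]

/-- Each of `a` and `a + 1` has a left label, a right label or neither outside the cap diagram. Five
of the nine combinations give zero; the others are a small cap, two transpositions, and the free
case. -/
theorem LocalRule.capSum_cases (hΘ : LocalRule κ a Θ) {X Y D : Finset ℤ} {e : ℤ → ℤ}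
    (h : IsCapping (X ∪ Y) D e) (hXY : Disjoint X Y) :
    Θ (GLmn.capSum κ D e X Y) = 0 ∨ ∃ X' Y' D' e', IsCapping (X' ∪ Y') D' e' ∧ Disjoint X' Y' ∧
      (Θ (GLmn.capSum κ D e X Y) = GLmn.capSum κ D' e' X' Y' ∨
        Θ (GLmn.capSum κ D e X Y) = (q + q⁻¹) • GLmn.capSum κ D' e' X' Y') := by
  have hd : ∀ z, z ∈ X → z ∉ Y := fun _ h => Finset.disjoint_left.1 hXY h
  by_cases h1 : a ∈ Y ∨ a + 1 ∈ X
  · exact Or.inl (hΘ.capSum_eq_zero h hXY h1)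
  rw [not_or] at h1
  have swap : (a ∈ X ∧ a + 1 ∉ X ∪ Y) ∨ (a ∉ X ∪ Y ∧ a + 1 ∈ Y) →
      ∃ X' Y' D' e', IsCapping (X' ∪ Y') D' e' ∧ Disjoint X' Y' ∧
      (Θ (GLmn.capSum κ D e X Y) = GLmn.capSum κ D' e' X' Y' ∨
        Θ (GLmn.capSum κ D e X Y) = (q + q⁻¹) • GLmn.capSum κ D' e' X' Y') := by
    intro h2
    refine ⟨_, _, _, _, ?_, ?_, Or.inl (hΘ.capSum_swap h hXY h2)⟩
    · rw [← Finset.image_union]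
      have := h.map (Equiv.swap a (a + 1)) (swap_lt_swap a (by
        simp only [Finset.mem_union]
        tauto))
      rwa [Equiv.symm_swap] at this
    · exact (Finset.disjoint_image (Equiv.injective _)).2 hXY
  by_cases h2 : a ∈ X
  · by_cases h3 : a + 1 ∈ Y
    · obtain ⟨h4, h5⟩ := hΘ.capSum_cup h hXY h2 h3
      exact Or.inr ⟨_, _, _, _, h5,
        hXY.mono (Finset.erase_subset _ _) (Finset.erase_subset _ _), Or.inl h4⟩
    · exact Or.inr (swap (Or.inl ⟨h2, by simp [h1.2, h3]⟩))
  · by_cases h3 : a + 1 ∈ Y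
    · exact Or.inr (swap (Or.inr ⟨by simp [h1.1, h2], h3⟩))
    · rcases hΘ.capSum_free h (by simp [h1.1, h2]) (by simp [h1.2, h3]) with h4 | ⟨D', e', h4, h5⟩
      · exact Or.inl h4
      · refine Or.inr ⟨_, _, D', e', h4, ?_, h5⟩
        rw [Finset.disjoint_insert_left, Finset.disjoint_insert_right]
        refine ⟨?_, h2, hXY⟩
        simp [h3]

/-- Every `capSum` is obtained from the basis vectors without caps. -/
theorem capSum_induction (P : V → Prop) (h0 : ∀ A B, Disjoint A B → P (κ A B))
    {ΘE ΘF : ℤ → V →ₗ[Qq] V} (hE : ∀ a, LocalRule κ a (ΘE a))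
    (hF : ∀ a, LocalRule (fun A B => κ B A) a (ΘF a))
    (hPE : ∀ a v, P v → P (ΘE a v)) (hPF : ∀ a v, P v → P (ΘF a v))
    {X Y D : Finset ℤ} {e : ℤ → ℤ} (h : IsCapping (X ∪ Y) D e) (hXY : Disjoint X Y) :
    P (capSum κ D e X Y) := by
  obtain ⟨r, hr⟩ : ∃ r, r = D.card := ⟨_, rfl⟩
  induction r generalizing D e X Y with
  | zero =>
    obtain rfl := Finset.card_eq_zero.1 hr.symm
    rw [capSum_empty]
    exact h0 X Y hXY
  | succ r ih =>
    have hne : D.Nonempty := Finset.card_pos.1 (by omega)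
    -- No cap starts below the cap with the rightmost start, so all vertices below it lie in `X ∪
    -- Y`. The inner induction is on their number `k`.
    obtain ⟨c, hc, hmax⟩ : ∃ c ∈ D, ∀ d ∈ D, d ≤ c :=
      ⟨D.max' hne, D.max'_mem hne, fun d hd => D.le_max' d hd⟩
    obtain ⟨k, hk⟩ : ∃ k : ℕ, e c = c + 1 + k := ⟨(e c - c - 1).toNat, by have := h.lt c hc; omega⟩
    induction k generalizing D e X Y c with
    | zero =>
      have hd : ∀ z, z ∈ X → z ∉ Y := fun _ h => Finset.disjoint_left.1 hXY h
      have h1 : c ∉ X ∪ Y := h.disj c hc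
      have h2 : c + 1 ∉ X ∪ Y := by have := h.notMem_N c hc; rwa [hk, Nat.cast_zero, add_zero] at this
      have h3 : c + 1 ∉ D := by have := h.notMem_D c hc; rwa [hk, Nat.cast_zero, add_zero] at this
      have h4 := h.erase_small hc h2 h3
      have hN : insert c X ∪ insert (c + 1) Y = insert c (insert (c + 1) (X ∪ Y)) := by
        ext z; simp; tauto
      rw [← hN] at h4
      simp only [Finset.mem_union, not_or] at h1 h2
      have hXY' : Disjoint (insert c X) (insert (c + 1) Y) := by
        rw [Finset.disjoint_insert_left, Finset.disjoint_insert_right]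
        exact ⟨by simp [h1.2], h2.1, hXY⟩
      have h5 := ih h4 hXY' (by rw [Finset.card_erase_of_mem hc]; omega)
      -- A small cap is created by `E_c` from a left label at `c` and a right label at `c + 1`, in a
      -- diagram with one cap fewer.
      have h6 := ((hE c).capSum_cup h4 hXY' (by simp) (by simp)).1
      rw [Finset.insert_erase hc, Finset.erase_insert h1.1, Finset.erase_insert h2.2] at h6
      have h7 : ∀ d ∈ D, Function.update e c (c + 1) d = e d := by
        intro d hd
        by_cases hdc : d = c
        · subst hdc; rw [Function.update_self, hk]; simp
        · rw [Function.update_of_ne hdc]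
      rw [capSum_congr _ h7] at h6
      rw [← h6]
      exact hPE _ _ h5
    | succ k ihk =>
      have h1 : c ∉ X ∪ Y := h.disj c hc
      have h2 : c + 1 ∈ X ∪ Y := by
        by_contra h2
        rcases h.nested c hc (c + 1) (by omega) (by omega) h2 with h3 | ⟨d, h3, h4, -⟩
        · have := hmax _ h3; omega
        · have := hmax _ h3; omega
      -- Exchanging `c` with the label at `c + 1` shortens the cap by one. The exchange is undone by
      -- `E_c` if the label is a left one and by `F_c` if it is a right one.
      set σ := Equiv.swap c (c + 1) with hσ
      have hσσ : ∀ S : Finset ℤ, (S.image σ).image σ = S := by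
        intro S
        have : σ ∘ σ = id := by funext z; simp [hσ]
        rw [Finset.image_image, this, Finset.image_id]
      have h3 := h.map σ (swap_lt_swap c (Or.inr h2))
      rw [hσ, Equiv.symm_swap, ← hσ, Finset.image_union] at h3
      have hXY' : Disjoint (X.image σ) (Y.image σ) :=
        (Finset.disjoint_image (Equiv.injective _)).2 hXY
      have h4 : P (capSum κ (D.image σ) (σ ∘ e ∘ σ) (X.image σ) (Y.image σ)) := by
        refine ihk h3 hXY' (by rw [Finset.card_image_of_injective _ σ.injective, hr])
          (by simpa using hne) (c + 1) (Finset.mem_image.2 ⟨c, hc, by simp [hσ]⟩) ?_ ?_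
        · intro d hdσ
          obtain ⟨d, hd, rfl⟩ := Finset.mem_image.1 hdσ
          have := hmax d hd
          simp only [hσ, Equiv.swap_apply_def]
          split_ifs <;> omega
        · have h5 : σ (c + 1) = c := by simp [hσ]
          have h6 : σ (e c) = e c := Equiv.swap_apply_of_ne_of_ne (by omega) (by omega)
          rw [Function.comp_apply, Function.comp_apply, h5, h6, hk]
          push_cast
          ring
      have mem : ∀ S : Finset ℤ, ∀ z, σ z ∈ S.image σ ↔ z ∈ S := fun S z => by simp
      have hc1 : ∀ S : Finset ℤ, c ∈ S.image σ ↔ c + 1 ∈ S := fun S => by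
        rw [← mem S (c + 1)]; simp [hσ]
      have hc2 : ∀ S : Finset ℤ, c + 1 ∈ S.image σ ↔ c ∈ S := fun S => by
        rw [← mem S c]; simp [hσ]
      have hee : σ ∘ (σ ∘ e ∘ σ) ∘ σ = e := by funext z; simp [hσ]
      rw [Finset.mem_union] at h2
      rcases h2 with h2 | h2
      · have h7 := (hE c).capSum_swap h3 hXY'
          (Or.inl ⟨(hc1 X).2 h2, by rw [← Finset.image_union, hc2]; exact h1⟩)
        rw [← hσ, hσσ, hσσ, hσσ, hee] at h7
        rw [← h7]
        exact hPE _ _ h4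
      · rw [Finset.union_comm] at h3 h1
        have h7 := (hF c).capSum_swap h3 hXY'.symm
          (Or.inl ⟨(hc1 Y).2 h2, by rw [← Finset.image_union, hc2]; exact h1⟩)
        rw [← hσ, hσσ, hσσ, hσσ, hee] at h7
        have h8 : ΘF c (capSum κ (D.image σ) (σ ∘ e ∘ σ) (X.image σ) (Y.image σ)) =
          capSum κ D e X Y := h7
        rw [← h8]
        exact hPF _ _ h4

end

section

variable {m n : ℕ}

/-! ### Lengths and inversions -/

theorem act_mul (f : ZFun m n) (x y : Smn m n) : act f (x * y) = act (act f x) y := by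
  funext j
  rcases j with j | j <;> simp [act]

theorem act_one (f : ZFun m n) : act f 1 = f := by
  funext j
  rcases j with j | j <;> simp [act]

theorem simpleRefl_mul_self (i : SIdx m n) : simpleRefl i * simpleRefl i = (1 : Smn m n) := by
  rcases i with i | i <;> simp [simpleRefl]

theorem act_simpleRefl_lo (g : ZFun m n) (i : SIdx m n) : act g (simpleRefl i) (lo i) = g (hi i) := by
  simp [act_simpleRefl]

theorem act_simpleRefl_hi (g : ZFun m n) (i : SIdx m n) : act g (simpleRefl i) (hi i) = g (lo i) := by
  simp [act_simpleRefl]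

theorem pos_injective : Function.Injective (pos : Idx m n → ℕ) := by
  rintro (k | k) (l | l) h <;> simp only [pos] at h
  · exact congrArg _ (Fin.ext h)
  · omega
  · omega
  · exact congrArg _ (Fin.ext (by omega))

theorem pos_hi (i : SIdx m n) : pos (hi i) = pos (lo i) + 1 := by
  rcases i with i | i <;> simp [pos, lo, hi]; omega

/-- The pair of positions `k, l` is inverted in `g`. -/
def Inverted (g : ZFun m n) (k l : Idx m n) : Prop :=
  pos k < pos l ∧ sgn k = sgn l ∧ if sgn k = 1 then g l < g k else g k < g l

open Classical in
/-- The number of pairs of positions that are inverted in `g` and have the same value in `h`. -/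
def invCount (g h : ZFun m n) : ℕ :=
  ((Finset.univ : Finset (Idx m n × Idx m n)).filter
    fun p => Inverted g p.1 p.2 ∧ h p.1 = h p.2).card

theorem descends_act (g : ZFun m n) (i : SIdx m n) (h : g (lo i) ≠ g (hi i)) :
    Descends (act g (simpleRefl i)) i ↔ ¬ Descends g i := by
  rw [Descends_iff, Descends_iff, act_simpleRefl_lo, act_simpleRefl_hi]
  split_ifs <;> omega

open Classical in
-- The transposition carries the inversions of `g` to those of `g · s_i`, except for the pair of
-- positions that it interchanges, which is an inversion of `g` alone.
theorem invCount_of_descends {g : ZFun m n} {i : SIdx m n} (hd : Descends g i) (h : ZFun m n) :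
    invCount g h = invCount (act g (simpleRefl i)) (act h (simpleRefl i)) +
      if h (lo i) = h (hi i) then 1 else 0 := by
  unfold invCount
  set S := (Finset.univ : Finset (Idx m n × Idx m n)).filter
    fun p => Inverted g p.1 p.2 ∧ h p.1 = h p.2 with hS
  set s := Equiv.swap (lo i) (hi i) with hs
  have hlo : s (lo i) = hi i := Equiv.swap_apply_left _ _
  have hhi : s (hi i) = lo i := Equiv.swap_apply_right _ _
  have hne := lo_ne_hi i
  have hss : ∀ k, s (s k) = k := fun k => by simp [hs]
  have hpos : ∀ k l, (k, l) ≠ (lo i, hi i) → pos k < pos l → pos (s k) < pos (s l) := by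
    intro k l hkl hlt
    have h1 := pos_hi i
    have key : ∀ k, (pos k = pos (lo i) ∧ pos (s k) = pos (hi i)) ∨
        (pos k = pos (hi i) ∧ pos (s k) = pos (lo i)) ∨
        (pos (s k) = pos k ∧ pos k ≠ pos (lo i) ∧ pos k ≠ pos (hi i)) := by
      intro k
      by_cases h2 : k = lo i
      · exact Or.inl ⟨by rw [h2], by rw [h2, hlo]⟩
      by_cases h3 : k = hi i
      · exact Or.inr (Or.inl ⟨by rw [h3], by rw [h3, hhi]⟩)
      · exact Or.inr (Or.inr ⟨by rw [hs, Equiv.swap_apply_of_ne_of_ne h2 h3],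
          fun h => h2 (pos_injective h), fun h => h3 (pos_injective h)⟩)
    have h2 : ¬ (pos k = pos (lo i) ∧ pos l = pos (hi i)) := fun h =>
      hkl (Prod.ext (pos_injective h.1) (pos_injective h.2))
    have := key k
    have := key l
    omega
  have hInv : ∀ k l, (k, l) ≠ (lo i, hi i) → Inverted g k l →
      Inverted (act g (simpleRefl i)) (s k) (s l) := by
    rintro k l hkl ⟨h1, h2, h3⟩
    refine ⟨hpos k l hkl h1, ?_, ?_⟩
    · rw [hs, sgn_swap, sgn_swap, h2]
    · rw [act_simpleRefl, ← hs]
      simp only [Function.comp_apply, hss]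
      rw [hs, sgn_swap]
      exact h3
  have hInv' : ∀ k l, Inverted (act g (simpleRefl i)) k l → Inverted g (s k) (s l) := by
    rintro k l ⟨h1, h2, h3⟩
    have hkl : (k, l) ≠ (lo i, hi i) := by
      rintro hkl
      obtain ⟨rfl, rfl⟩ := Prod.ext_iff.1 hkl
      rw [act_simpleRefl_lo, act_simpleRefl_hi] at h3
      rw [Descends_iff] at hd
      split_ifs at h3 hd <;> omega
    refine ⟨hpos k l hkl h1, ?_, ?_⟩
    · rw [hs, sgn_swap, sgn_swap, h2]
    · rw [act_simpleRefl, ← hs] at h3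
      simp only [Function.comp_apply] at h3
      rw [hs, sgn_swap]
      exact h3
  have hlohi : Inverted g (lo i) (hi i) := by
    refine ⟨lo_lt_hi i, sgn_lo_eq i, ?_⟩
    exact (Descends_iff g i).1 hd
  have hcard : (S.erase (lo i, hi i)).card =
      ((Finset.univ : Finset (Idx m n × Idx m n)).filter fun p =>
        Inverted (act g (simpleRefl i)) p.1 p.2 ∧
          act h (simpleRefl i) p.1 = act h (simpleRefl i) p.2).card := by
    refine Finset.card_nbij' (fun p => (s p.1, s p.2)) (fun p => (s p.1, s p.2)) ?_ ?_ ?_ ?_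
    · rintro ⟨k, l⟩ hp
      simp only [Finset.coe_erase, Set.mem_sdiff, Finset.mem_coe, hS, Finset.mem_filter,
        Finset.mem_univ, true_and, Set.mem_singleton_iff] at hp
      simp only [Finset.coe_filter, Finset.mem_univ, true_and, Set.mem_ofPred_eq]
      refine ⟨hInv k l hp.2 hp.1.1, ?_⟩
      rw [act_simpleRefl, ← hs]
      simp only [Function.comp_apply, hss]
      exact hp.1.2
    · rintro ⟨k, l⟩ hp
      simp only [Finset.coe_filter, Finset.mem_univ, true_and, Set.mem_ofPred_eq] at hp
      simp only [Finset.coe_erase, Set.mem_sdiff, Finset.mem_coe, hS, Finset.mem_filter,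
        Finset.mem_univ, true_and, Set.mem_singleton_iff]
      refine ⟨⟨hInv' k l hp.1, ?_⟩, ?_⟩
      · have := hp.2
        rw [act_simpleRefl, ← hs] at this
        exact this
      · intro hkl
        obtain ⟨h1, h2⟩ := Prod.ext_iff.1 hkl
        simp only at h1 h2
        have h3 : k = hi i := by rw [← hss k, h1, hlo]
        have h4 : l = lo i := by rw [← hss l, h2, hhi]
        have h5 := hp.1.1
        simp only [h3, h4] at h5
        have h6 := pos_hi i
        omega
    · rintro ⟨k, l⟩ _
      simp [hss]
    · rintro ⟨k, l⟩ _
      simp [hss]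
  rw [← hcard]
  split_ifs with h1
  · have hmem : (lo i, hi i) ∈ S := by simp [hS, hlohi, h1]
    rw [Finset.card_erase_add_one hmem]
  · rw [Finset.erase_eq_of_notMem (by simp [hS, h1]), add_zero]

/-- The number of inversions of `g`. -/
def inv (g : ZFun m n) : ℕ := invCount g 0

theorem inv_of_descends {g : ZFun m n} {i : SIdx m n} (hd : Descends g i) :
    inv g = inv (act g (simpleRefl i)) + 1 := by
  have := invCount_of_descends hd 0
  simpa [inv, act] using this

theorem act_act_simpleRefl (g : ZFun m n) (i : SIdx m n) :
    act (act g (simpleRefl i)) (simpleRefl i) = g := by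
  rw [← act_mul, simpleRefl_mul_self, act_one]

theorem inv_of_not_descends {g : ZFun m n} {i : SIdx m n} (hd : ¬ Descends g i)
    (hne : g (lo i) ≠ g (hi i)) : inv (act g (simpleRefl i)) = inv g + 1 := by
  have := inv_of_descends ((descends_act g i hne).2 hd)
  rwa [act_act_simpleRefl] at this

/-- `f(-m) > ⋯ > f(-1)` and `f(1) < ⋯ < f(n)`. -/
def Antidominant (f : ZFun m n) : Prop :=
  StrictAnti (fun k : Fin m => f (Sum.inl k)) ∧ StrictMono (fun k : Fin n => f (Sum.inr k))

/-- `f` is injective on the negative and on the positive indices. -/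
def SideInjective (f : ZFun m n) : Prop :=
  Function.Injective (fun k : Fin m => f (Sum.inl k)) ∧
    Function.Injective (fun k : Fin n => f (Sum.inr k))

theorem Antidominant.sideInjective {f : ZFun m n} (h : Antidominant f) : SideInjective f :=
  ⟨h.1.injective, h.2.injective⟩

theorem Dominant.sideInjective {f : ZFun m n} (h : Dominant f) : SideInjective f :=
  ⟨h.1.injective, h.2.injective⟩

theorem SideInjective.act {f : ZFun m n} (h : SideInjective f) (x : Smn m n) :
    SideInjective (act f x) :=
  ⟨h.1.comp x.1.injective, h.2.comp x.2.injective⟩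

theorem SideInjective.lo_ne_hi {f : ZFun m n} (h : SideInjective f) (i : SIdx m n) :
    f (lo i) ≠ f (hi i) := by
  rcases i with i | i
  · intro h1
    have := h.1 h1
    simp at this
  · intro h1
    have := h.2 h1
    simp at this

theorem antidominant_of_not_descends {g : ZFun m n} (hg : SideInjective g)
    (h : ∀ i, ¬ Descends g i) : Antidominant g := by
  constructor
  · rcases m with _ | m
    · intro a; exact a.elim0
    · refine Fin.strictAnti_iff_succ_lt.2 fun k => ?_
      have h1 := h (Sum.inl k)
      have h2 := hg.lo_ne_hi (Sum.inl k)
      have h3 : g (hi (Sum.inl k)) < g (lo (Sum.inl k)) := lt_of_le_of_ne (not_lt.1 h1) h2.symm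
      exact h3
  · rcases n with _ | n
    · intro a; exact a.elim0
    · refine Fin.strictMono_iff_lt_succ.2 fun k => ?_
      have h1 := h (Sum.inr k)
      have h2 := hg.lo_ne_hi (Sum.inr k)
      have h3 : g (lo (Sum.inr k)) < g (hi (Sum.inr k)) := lt_of_le_of_ne (not_lt.1 h1) h2
      exact h3

theorem eq_one_of_antidominant {f : ZFun m n} {x : Smn m n} (hf : Antidominant f)
    (hx : Antidominant (act f x)) : x = 1 := by
  have h1 : x.1 = 1 := by
    have h : StrictMono x.1 := fun a b hab => hf.1.lt_iff_gt.1 (hx.1 hab)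
    have := (h.range_inj strictMono_id).1 (by simp [x.1.surjective.range_eq])
    exact Equiv.ext fun a => congrFun this a
  have h2 : x.2 = 1 := by
    have h : StrictMono x.2 := fun a b hab => hf.2.lt_iff_lt.1 (hx.2 hab)
    have := (h.range_inj strictMono_id).1 (by simp [x.2.surjective.range_eq])
    exact Equiv.ext fun a => congrFun this a
  exact Prod.ext h1 h2

theorem act_injective {f : ZFun m n} (hf : SideInjective f) : Function.Injective (act f) := by
  intro x y h
  refine Prod.ext (Equiv.ext fun k => ?_) (Equiv.ext fun k => ?_)
  · exact hf.1 (congrFun h (Sum.inl k))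
  · exact hf.2 (congrFun h (Sum.inr k))

theorem inv_antidominant {f : ZFun m n} (hf : Antidominant f) : inv f = 0 := by
  classical
  unfold inv invCount
  rw [Finset.card_eq_zero, Finset.filter_eq_empty_iff]
  rintro ⟨k | k, l | l⟩ - ⟨⟨h1, h2, h3⟩, -⟩
  · simp [sgn, pos] at h1 h3
    exact absurd (hf.1 h1) (not_lt.2 h3.le)
  · simp [sgn] at h2
  · simp [sgn] at h2
  · simp [sgn, pos] at h1 h3
    exact absurd (hf.2 h1) (not_lt.2 h3.le)

theorem inv_word_le {f : ZFun m n} (hf : Antidominant f) (w : List (SIdx m n)) :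
    inv (act f (w.map simpleRefl).prod) ≤ w.length := by
  induction w using List.reverseRecOn with
  | nil => simp [act_one, inv_antidominant hf]
  | append_singleton w i ih =>
    rw [List.map_append, List.prod_append, act_mul, List.length_append]
    simp only [List.map_cons, List.map_nil, List.prod_cons, List.prod_nil, mul_one,
      List.length_cons, List.length_nil]
    by_cases hd : Descends (act f (w.map simpleRefl).prod) i
    · have := inv_of_descends hd; omega
    · have := inv_of_not_descends hd ((hf.sideInjective.act _).lo_ne_hi i); omega

/-- Sorting: each descent can be removed by one letter, at the cost of one inversion. Without
descents the function is antidominant, and then `x = 1`. -/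
theorem exists_word_length_inv {f : ZFun m n} (hf : Antidominant f) (x : Smn m n) :
    ∃ w : List (SIdx m n), (w.map simpleRefl).prod = x ∧ w.length = inv (act f x) := by
  obtain ⟨k, hk⟩ : ∃ k, inv (act f x) = k := ⟨_, rfl⟩
  induction k generalizing x with
  | zero =>
    refine ⟨[], ?_, hk.symm⟩
    have h : Antidominant (act f x) := by
      refine antidominant_of_not_descends (hf.sideInjective.act x) fun i hd => ?_
      have := inv_of_descends hd
      omega
    rw [eq_one_of_antidominant hf h]
    rfl
  | succ k ih =>
    by_cases hall : ∀ i, ¬ Descends (act f x) i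
    · have h := antidominant_of_not_descends (hf.sideInjective.act x) hall
      rw [inv_antidominant h] at hk
      omega
    · push Not at hall
      obtain ⟨i, hi⟩ := hall
      have h1 := inv_of_descends hi
      rw [← act_mul] at h1
      obtain ⟨w, hw, hl⟩ := ih (x * simpleRefl i) (by omega)
      refine ⟨w ++ [i], ?_, ?_⟩
      · simp [hw, mul_assoc, simpleRefl_mul_self]
      · simp [hl]; omega

theorem len_eq_inv {f : ZFun m n} (hf : Antidominant f) (x : Smn m n) :
    len x = inv (act f x) := by
  have h := (exists_reducedWord x).choose_spec
  change IsReducedWord (reducedWord x) x at h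
  apply le_antisymm
  · obtain ⟨w, hw, hl⟩ := exists_word_length_inv hf x
    rw [← hl]
    exact h.2 w hw
  · have := inv_word_le hf (reducedWord x)
    rwa [h.1] at this

theorem Hword_append (w : List (SIdx m n)) (i : SIdx m n) (u : THat m n) :
    Hword (w ++ [i]) u = H i (Hword w u) := by
  induction w generalizing u with
  | nil => rfl
  | cons j w ih => exact ih (H j u)

theorem H_M_of_not_descends {f : ZFun m n} {i : SIdx m n} (hd : ¬ Descends f i)
    (hne : f (lo i) ≠ f (hi i)) : H i (M f) = M (act f (simpleRefl i)) := by
  rw [H_M, if_neg (fun h => hne ((act_eq_iff f i).1 h)), if_neg hd]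

/-- A letter adds at most one inversion, so a word as long as the number of inversions consists of
ascents only. Each letter then acts by the branch of `H_M` without correction term. -/
theorem Hword_M {f : ZFun m n} (hf : Antidominant f) (w : List (SIdx m n))
    (hw : w.length = inv (act f (w.map simpleRefl).prod)) :
    Hword w (M f) = M (act f (w.map simpleRefl).prod) := by
  induction w using List.reverseRecOn with
  | nil => simp [Hword, act_one]
  | append_singleton w i ih =>
    have h1 : ((w ++ [i]).map simpleRefl).prod = (w.map simpleRefl).prod * simpleRefl i := by simp
    rw [h1, act_mul] at hw ⊢
    rw [List.length_append, List.length_cons, List.length_nil] at hw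
    have h2 := inv_word_le hf w
    have hne := (hf.sideInjective.act (w.map simpleRefl).prod).lo_ne_hi i
    have hd : ¬ Descends (act f (w.map simpleRefl).prod) i := by
      intro hd
      have := inv_of_descends hd
      omega
    have h3 := inv_of_not_descends hd hne
    rw [Hword_append, ih (by omega), H_M_of_not_descends hd hne]

theorem Hx_M {f : ZFun m n} (hf : Antidominant f) (x : Smn m n) : Hx x (M f) = M (act f x) := by
  have h := (exists_reducedWord x).choose_spec
  change IsReducedWord (reducedWord x) x at h
  have h1 := Hword_M hf (reducedWord x)
  rw [h.1] at h1
  exact h1 (len_eq_inv hf x)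

theorem H0_M {f : ZFun m n} (hf : Antidominant f) :
    H0 (M f) = ∑ x : Smn m n, (-q) ^ ((len x : ℤ) - (len (w0 : Smn m n) : ℤ)) • M (act f x) := by
  simp only [H0, LinearMap.sum_apply, LinearMap.smul_apply, Hx_M hf]

-- The lengths of `x` and `x * s_i` differ by one, so their coefficients differ by a factor `-q`. At
-- an ascent this is the claim; at a descent the coefficient is multiplied by `-q⁻¹ - (q - q⁻¹) =
-- -q`.
open Classical in
theorem H_H0_M {f : ZFun m n} (hf : Antidominant f) (i : SIdx m n) :
    H i (H0 (M f)) = (-q) • H0 (M f) := by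
  have hq : (-q : Qq) ≠ 0 := neg_ne_zero.2 q_ne_zero
  rw [H0_M hf, map_sum, Finset.smul_sum]
  set φ : Smn m n → Qq := fun x => (-q) ^ ((len x : ℤ) - (len (w0 : Smn m n) : ℤ)) with hφ
  have h1 : ∀ x : Smn m n, H i (φ x • M (act f x)) = φ x • M (act f (x * simpleRefl i)) -
      (if Descends (act f x) i then (q - q⁻¹) * φ x else 0) • M (act f x) := by
    intro x
    have hne := (hf.sideInjective.act x).lo_ne_hi i
    rw [map_smul, H_M, if_neg (fun h => hne ((act_eq_iff _ i).1 h)), act_mul]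
    split_ifs
    · rw [smul_sub, smul_smul, mul_comm]
    · simp
  have h2 : ∑ x : Smn m n, φ x • M (act f (x * simpleRefl i)) =
      ∑ x : Smn m n, φ (x * simpleRefl i) • M (act f x) := by
    refine Fintype.sum_equiv (Equiv.mulRight (simpleRefl i)) _ _ fun x => ?_
    simp [mul_assoc, simpleRefl_mul_self]
  change ∑ x, H i (φ x • M (act f x)) = ∑ x, -q • φ x • M (act f x)
  rw [Finset.sum_congr rfl fun x _ => h1 x, Finset.sum_sub_distrib, h2, ← Finset.sum_sub_distrib]
  refine Finset.sum_congr rfl fun x _ => ?_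
  rw [← sub_smul, smul_smul]
  congr 1
  have hne := (hf.sideInjective.act x).lo_ne_hi i
  have hl : ∀ y : Smn m n, len y = inv (act f y) := fun y => len_eq_inv hf y
  split_ifs with hd
  · have h3 := inv_of_descends hd
    rw [← act_mul, ← hl, ← hl] at h3
    have h4 : φ x = φ (x * simpleRefl i) * (-q) := by
      simp only [hφ]
      rw [← zpow_add_one₀ hq]
      congr 1
      rw [h3]; push_cast; ring
    rw [h4]
    have := q_ne_zero
    field_simp
    ring
  · have h3 := inv_of_not_descends hd hne
    rw [← act_mul, ← hl, ← hl] at h3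
    have h4 : φ (x * simpleRefl i) = φ x * (-q) := by
      simp only [hφ]
      rw [← zpow_add_one₀ hq]
      congr 1
      rw [h3]; push_cast; ring
    rw [h4]
    ring

end

section

variable {m n : ℕ}

/-! ### The generators of the Hecke algebra act on `𝒯 H_0` by the scalar `-q` -/

/-- The operator `H_0 (H_i + q)`. -/
def heckeDefect (i : SIdx m n) : THat m n →ₗ[Qq] THat m n := (H i).comp H0 + q • H0

theorem heckeDefect_E (i : SIdx m n) (a : ℤ) (u : THat m n) :
    heckeDefect i (E a u) = E a (heckeDefect i u) := by
  simp only [heckeDefect, LinearMap.add_apply, LinearMap.comp_apply, LinearMap.smul_apply, map_add,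
    map_smul, comm_H0 (E a) (E_H a), E_H]

theorem heckeDefect_F (i : SIdx m n) (a : ℤ) (u : THat m n) :
    heckeDefect i (F a u) = F a (heckeDefect i u) := by
  simp only [heckeDefect, LinearMap.add_apply, LinearMap.comp_apply, LinearMap.smul_apply, map_add,
    map_smul, comm_H0 (F a) (F_H a), F_H]

theorem comp_swap_eq_add (g : ZFun m n) {k l : Idx m n} (hkl : k ≠ l) (t : ℤ)
    (h : g l = g k + t) : g + Pi.single k t - Pi.single l t = g ∘ Equiv.swap k l := by
  funext j
  simp only [Pi.add_apply, Pi.sub_apply, Pi.single_apply, Function.comp_apply,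
    Equiv.swap_apply_def]
  by_cases h1 : j = k
  · subst h1; simp [hkl]; omega
  · by_cases h2 : j = l
    · subst h2; simp [h1]; omega
    · simp [h1, h2]

-- `F_a` makes the two values equal, and `E_a` then restores either the old or the exchanged
-- arrangement. All that matters is that both coefficients are nonzero.
open Classical in
theorem E_F_M (a : ℤ) (g : ZFun m n) {k l : Idx m n} (hkl : sgn k = sgn l) (hk : g k = a)
    (hl : g l = a + 1) (h : ∀ j, j ≠ k → j ≠ l → g j ≠ a ∧ g j ≠ a + 1) :
    ∃ s t : ℤ, E a (F a (M g)) = q ^ s • M g + q ^ t • M (g ∘ Equiv.swap k l) := by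
  have hne : k ≠ l := by rintro rfl; omega
  rcases k with k | k <;> rcases l with l | l
  · have h1 : (Finset.univ.filter fun j => FActs a g j) = {Sum.inl l} := by
      ext j
      simp only [Finset.mem_filter, Finset.mem_univ, true_and, Finset.mem_singleton]
      constructor
      · intro hj
        by_contra hjl
        rcases j with j | j
        · by_cases hjk : j = k
          · subst hjk; simp only [FActs] at hj; omega
          · exact (h _ (fun h => hjk (Sum.inl_injective h)) hjl).2 hj
        · exact (h (Sum.inr j) (by simp) (by simp)).1 hj
      · rintro rfl; exact hl
    have hd : ∀ j, d (Sum.inl l : Idx m n) j = if j = Sum.inl l then -1 else 0 := fun j => by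
      simp [d, Pi.single_apply, sgn]
    have h2 : (Finset.univ.filter fun j => EActs a (g + d (Sum.inl l)) j) =
        {Sum.inl l, Sum.inl k} := by
      ext j
      simp only [Finset.mem_filter, Finset.mem_univ, true_and, Finset.mem_singleton,
        Finset.mem_insert]
      rcases j with j | j
      · simp only [EActs, Pi.add_apply, hd, Sum.inl.injEq]
        by_cases hjl : j = l
        · subst hjl; simp [hl]
        · by_cases hjk : j = k
          · subst hjk; simp [hk, hjl]
          · simp [hjl, hjk, (h (Sum.inl j) (by simpa using hjk) (by simpa using hjl)).1]
      · have := h (Sum.inr j) (by simp) (by simp)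
        simp [EActs, hd, this.2]
    refine ⟨fExp a g (Sum.inl l) + eExp a (g + d (Sum.inl l)) (Sum.inl l),
      fExp a g (Sum.inl l) + eExp a (g + d (Sum.inl l)) (Sum.inl k), ?_⟩
    rw [F_M, h1, Finset.sum_singleton, map_smul, E_M, h2, Finset.sum_pair hne.symm, smul_add,
      smul_smul, smul_smul, ← zpow_add₀ q_ne_zero, ← zpow_add₀ q_ne_zero, add_sub_cancel_right]
    congr 3
    rw [Equiv.swap_comm, ← comp_swap_eq_add g hne.symm (-1) (by omega)]
    rfl
  · simp [sgn] at hkl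
  · simp [sgn] at hkl
  · have h1 : (Finset.univ.filter fun j => FActs a g j) = {Sum.inr k} := by
      ext j
      simp only [Finset.mem_filter, Finset.mem_univ, true_and, Finset.mem_singleton]
      constructor
      · intro hj
        by_contra hjk
        rcases j with j | j
        · exact (h (Sum.inl j) (by simp) (by simp)).2 hj
        · by_cases hjl : j = l
          · subst hjl; simp only [FActs] at hj; omega
          · exact (h _ hjk (fun h => hjl (Sum.inr_injective h))).1 hj
      · rintro rfl; exact hk
    have hd : ∀ j, d (Sum.inr k : Idx m n) j = if j = Sum.inr k then 1 else 0 := fun j => by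
      simp [d, Pi.single_apply, sgn]
    have h2 : (Finset.univ.filter fun j => EActs a (g + d (Sum.inr k)) j) =
        {Sum.inr k, Sum.inr l} := by
      ext j
      simp only [Finset.mem_filter, Finset.mem_univ, true_and, Finset.mem_singleton,
        Finset.mem_insert]
      rcases j with j | j
      · have := h (Sum.inl j) (by simp) (by simp)
        simp [EActs, hd, this.1]
      · simp only [EActs, Pi.add_apply, hd, Sum.inr.injEq]
        by_cases hjk : j = k
        · subst hjk; simp [hk]
        · by_cases hjl : j = l
          · subst hjl; simp [hl, hjk]
          · simp [hjl, hjk, (h (Sum.inr j) (by simpa using hjk) (by simpa using hjl)).2]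
    refine ⟨fExp a g (Sum.inr k) + eExp a (g + d (Sum.inr k)) (Sum.inr k),
      fExp a g (Sum.inr k) + eExp a (g + d (Sum.inr k)) (Sum.inr l), ?_⟩
    rw [F_M, h1, Finset.sum_singleton, map_smul, E_M, h2, Finset.sum_pair hne, smul_add,
      smul_smul, smul_smul, ← zpow_add₀ q_ne_zero, ← zpow_add₀ q_ne_zero, add_sub_cancel_right]
    congr 3
    rw [← comp_swap_eq_add g hne 1 (by omega)]
    rfl

/-- The operator commutes with `E_a F_a`, which relates the two arrangements. Its vanishing thus
spreads over an orbit without any relation in the Hecke algebra. -/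
theorem heckeDefect_swap (i : SIdx m n) (a : ℤ) (g : ZFun m n) {k l : Idx m n}
    (hkl : sgn k = sgn l) (hk : g k = a) (hl : g l = a + 1)
    (h : ∀ j, j ≠ k → j ≠ l → g j ≠ a ∧ g j ≠ a + 1) (hg : heckeDefect i (M g) = 0) :
    heckeDefect i (M (g ∘ Equiv.swap k l)) = 0 := by
  obtain ⟨s, t, hst⟩ := E_F_M a g hkl hk hl h
  have h1 := heckeDefect_E i a (F a (M g))
  rw [heckeDefect_F, hg, map_zero, map_zero, hst, map_add, map_smul, map_smul, hg, smul_zero,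
    zero_add] at h1
  exact (smul_eq_zero.1 h1).resolve_left (zpow_ne_zero _ q_ne_zero)

/-- A function with different values at all indices. -/
def genericFun (m n : ℕ) : ZFun m n :=
  Sum.elim (fun k : Fin m => -(k : ℤ) - 2) (fun k : Fin n => (k : ℤ))

theorem genericFun_antidominant : Antidominant (genericFun m n) := by
  constructor
  · intro a b hab
    have : (a : ℕ) < b := hab
    simp only [genericFun, Sum.elim_inl]
    omega
  · intro a b hab
    have : (a : ℕ) < b := hab
    simp only [genericFun, Sum.elim_inr]
    omega

/-- Induction on a word for `y`, starting from the antidominant case. A letter put in front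
exchanges two consecutive values on one side rather than two neighbouring positions, which is what
`heckeDefect_swap` handles. -/
theorem heckeDefect_generic (i : SIdx m n) (y : Smn m n) :
    heckeDefect i (M (act (genericFun m n) y)) = 0 := by
  obtain ⟨w, rfl⟩ := simpleRefl_generate y
  induction w with
  | nil =>
    simp only [List.map_nil, List.prod_nil, act_one, heckeDefect, LinearMap.add_apply,
      LinearMap.comp_apply, LinearMap.smul_apply, H_H0_M genericFun_antidominant]
    rw [neg_smul, neg_add_cancel]
  | cons s w ih =>
    obtain ⟨y, hy⟩ : ∃ y, (w.map simpleRefl).prod = y := ⟨_, rfl⟩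
    rw [List.map_cons, List.prod_cons]
    rw [hy] at ih ⊢
    set τ : Equiv.Perm (Idx m n) := Equiv.sumCongr y.1 y.2 with hτ
    have hact : ∀ f : ZFun m n, act f y = f ∘ τ := fun f => rfl
    have hτs : ∀ j, sgn (τ j) = sgn j := by rintro (j | j) <;> rfl
    have hsw : act (genericFun m n) (simpleRefl s * y) =
        act (genericFun m n) y ∘ Equiv.swap (τ.symm (lo s)) (τ.symm (hi s)) := by
      rw [act_mul, hact, hact, act_simpleRefl]
      funext j
      have := Equiv.swap_apply_apply τ (τ.symm (lo s)) (τ.symm (hi s))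
      simp only [Equiv.apply_symm_apply] at this
      simp [this]
    have hv : ∀ j, act (genericFun m n) y (τ.symm j) = genericFun m n j := fun j => by
      rw [hact]; simp
    have hsgn : ∀ j, sgn (τ.symm j) = sgn j := fun j => by rw [← hτs]; simp
    have hother : ∀ j, j ≠ τ.symm (lo s) → j ≠ τ.symm (hi s) →
        τ j ≠ lo s ∧ τ j ≠ hi s := by
      intro j h1 h2
      exact ⟨fun h => h1 (by rw [← h]; simp), fun h => h2 (by rw [← h]; simp)⟩
    rw [hsw]
    rcases s with s | s
    · rw [Equiv.swap_comm]
      refine heckeDefect_swap i (-(s : ℤ) - 3) _ ?_ ?_ ?_ ?_ ih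
      · rw [hsgn, hsgn]; rfl
      · rw [hv]; simp [genericFun, hi]; ring
      · rw [hv]; simp [genericFun, lo]; ring
      · intro j h1 h2
        obtain ⟨h3, h4⟩ := hother j h2 h1
        rw [hact]
        simp only [Function.comp_apply]
        rcases hj : τ j with j' | j'
        · rw [hj] at h3 h4
          simp only [lo, hi, ne_eq, Sum.inl.injEq, Fin.ext_iff] at h3 h4
          simp only [genericFun, Sum.elim_inl]
          omega
        · simp only [genericFun, Sum.elim_inr]
          omega
    · refine heckeDefect_swap i (s : ℤ) _ ?_ ?_ ?_ ?_ ih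
      · rw [hsgn, hsgn]; rfl
      · rw [hv]; simp [genericFun, lo]
      · rw [hv]; simp [genericFun, hi]
      · intro j h1 h2
        obtain ⟨h3, h4⟩ := hother j h1 h2
        rw [hact]
        simp only [Function.comp_apply]
        rcases hj : τ j with j' | j'
        · simp only [genericFun, Sum.elim_inl]
          omega
        · rw [hj] at h3 h4
          simp only [lo, hi, ne_eq, Sum.inr.injEq, Fin.ext_iff] at h3 h4
          simp only [genericFun, Sum.elim_inr]
          omega

/-- The regular orbit maps equivariantly onto the orbit of `f`; this is the dual map. -/
def pullback (f : ZFun m n) : (ZFun m n → Qq) →ₗ[Qq] (Smn m n → Qq) where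
  toFun c y := q ^ (-(invCount (act (genericFun m n) y) (act f y) : ℤ)) * c (act f y)
  map_add' b c := by funext y; simp [mul_add]
  map_smul' r c := by funext y; simp; ring

open Classical in
/-- The action of `H_i` on functions on the group. -/
def regularH (i : SIdx m n) : (Smn m n → Qq) →ₗ[Qq] (Smn m n → Qq) where
  toFun c y := c (y * simpleRefl i) -
    if Descends (act (genericFun m n) y) i then (q - q⁻¹) * c y else 0
  map_add' b c := by funext y; simp only [Pi.add_apply]; split_ifs <;> ring
  map_smul' r c := by
    funext y; simp only [Pi.smul_apply, smul_eq_mul, RingHom.id_apply]; split_ifs <;> ring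

theorem descends_act_iff {f : ZFun m n} (hf1 : Antitone fun k : Fin m => f (Sum.inl k))
    (hf2 : Monotone fun k : Fin n => f (Sum.inr k)) (y : Smn m n) (i : SIdx m n)
    (hne : act f y (lo i) ≠ act f y (hi i)) :
    Descends (act f y) i ↔ Descends (act (genericFun m n) y) i := by
  have hg := genericFun_antidominant (m := m) (n := n)
  rcases i with i | i
  · simp only [Descends, lo, hi, act, Function.comp_apply, Sum.map_inl] at hne ⊢
    rw [hg.1.lt_iff_gt]
    constructor
    · intro h
      by_contra h'
      exact absurd (hf1 (not_lt.1 h')) (not_le.2 h)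
    · intro h
      exact lt_of_le_of_ne (hf1 h.le) hne
  · simp only [Descends, lo, hi, act, Function.comp_apply, Sum.map_inr] at hne ⊢
    rw [hg.2.lt_iff_lt]
    constructor
    · intro h
      by_contra h'
      exact absurd (hf2 (not_lt.1 h')) (not_le.2 h)
    · intro h
      exact lt_of_le_of_ne (hf2 h.le) hne.symm

/-- At distinct values of `f` the descents are those of the generic function. An inverted pair of
equal values has weight `q⁻¹`, and this produces the scalar `q⁻¹` by which `H_i` acts when `f · s_i
= f`. -/
theorem pullback_HFun {f : ZFun m n} (hf1 : Antitone fun k : Fin m => f (Sum.inl k))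
    (hf2 : Monotone fun k : Fin n => f (Sum.inr k)) (i : SIdx m n) (c : ZFun m n → Qq) :
    pullback f (HFun i c) = regularH i (pullback f c) := by
  classical
  funext y
  have hg := (genericFun_antidominant (m := m) (n := n)).sideInjective
  have hne := (hg.act y).lo_ne_hi i
  have e1 : ∀ g, act g (y * simpleRefl i) = act (act g y) (simpleRefl i) := fun g =>
    act_mul g y (simpleRefl i)
  set g := act (genericFun m n) y with hgdef
  set h := act f y with hh
  change q ^ (-(invCount g h : ℤ)) * (if act h (simpleRefl i) = h then q⁻¹ * c h
    else c (act h (simpleRefl i)) - if Descends h i then (q - q⁻¹) * c h else 0) =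
    q ^ (-(invCount (act (genericFun m n) (y * simpleRefl i)) (act f (y * simpleRefl i)) : ℤ)) *
      c (act f (y * simpleRefl i)) -
    if Descends g i then (q - q⁻¹) * (q ^ (-(invCount g h : ℤ)) * c h) else 0
  rw [e1, e1, ← hgdef, ← hh]
  by_cases heq : h (lo i) = h (hi i)
  · have h1 : act h (simpleRefl i) = h := (act_eq_iff h i).2 heq
    rw [if_pos h1, h1]
    by_cases hd : Descends g i
    · have h2 := invCount_of_descends hd h
      rw [h1, if_pos heq] at h2
      rw [if_pos hd, h2, Nat.cast_add, neg_add, zpow_add₀ q_ne_zero]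
      have := q_ne_zero
      simp only [Nat.cast_one, zpow_neg, zpow_one]
      field_simp
      ring
    · have h2 := invCount_of_descends ((descends_act g i hne).2 hd) h
      rw [act_act_simpleRefl, h1, if_pos heq] at h2
      rw [if_neg hd, h2, Nat.cast_add, neg_add, zpow_add₀ q_ne_zero]
      simp only [Nat.cast_one, zpow_neg, zpow_one]
      ring
  · have h1 : ¬ act h (simpleRefl i) = h := fun h' => heq ((act_eq_iff h i).1 h')
    have h3 : invCount (act g (simpleRefl i)) (act h (simpleRefl i)) = invCount g h := by
      by_cases hd : Descends g i
      · have h2 := invCount_of_descends hd h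
        rw [if_neg heq] at h2
        exact h2.symm
      · have h2 := invCount_of_descends ((descends_act g i hne).2 hd) (act h (simpleRefl i))
        rw [act_act_simpleRefl, act_act_simpleRefl, act_simpleRefl_lo, act_simpleRefl_hi,
          if_neg (fun h' => heq h'.symm)] at h2
        exact h2
    rw [if_neg h1, h3]
    have h4 : Descends h i ↔ Descends g i := descends_act_iff hf1 hf2 y i heq
    by_cases hd : Descends g i
    · rw [if_pos hd, if_pos (h4.2 hd)]; ring
    · rw [if_neg hd, if_neg (fun h' => hd (h4.1 h'))]; ring

/-- The action of `H_{i_1} ⋯ H_{i_r}` on functions on the group. -/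
def regularHword : List (SIdx m n) → (Smn m n → Qq) →ₗ[Qq] (Smn m n → Qq)
  | [] => LinearMap.id
  | i :: w => (regularHword w).comp (regularH i)

/-- The action of `H_0` on functions on the group. -/
def regularH0 : (Smn m n → Qq) →ₗ[Qq] (Smn m n → Qq) :=
  ∑ x : Smn m n, (-q) ^ ((len x : ℤ) - (len (w0 : Smn m n) : ℤ)) • regularHword (reducedWord x)

/-- The action of `H_0 (H_i + q)` on functions on the group. -/
def regularDefect (i : SIdx m n) : (Smn m n → Qq) →ₗ[Qq] (Smn m n → Qq) :=
  (regularH i).comp regularH0 + q • regularH0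

theorem pullback_H {f : ZFun m n} (hf1 : Antitone fun k : Fin m => f (Sum.inl k))
    (hf2 : Monotone fun k : Fin n => f (Sum.inr k)) (i : SIdx m n) (u : THat m n) :
    pullback f (coeff (H i u)) = regularH i (pullback f (coeff u)) :=
  pullback_HFun hf1 hf2 i (coeff u)

theorem pullback_H0 {f : ZFun m n} (hf1 : Antitone fun k : Fin m => f (Sum.inl k))
    (hf2 : Monotone fun k : Fin n => f (Sum.inr k)) (u : THat m n) :
    pullback f (coeff (H0 u)) = regularH0 (pullback f (coeff u)) := by
  have hw : ∀ (w : List (SIdx m n)) u,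
      pullback f (coeff (Hword w u)) = regularHword w (pullback f (coeff u)) := by
    intro w
    induction w with
    | nil => intro u; rfl
    | cons i w ih =>
      intro u
      change pullback f (coeff (Hword w (H i u))) = regularHword w (regularH i _)
      rw [ih, pullback_H hf1 hf2]
  simp only [H0, regularH0, LinearMap.sum_apply, LinearMap.smul_apply, map_sum, map_smul, Hx, hw]

theorem pullback_heckeDefect {f : ZFun m n} (hf1 : Antitone fun k : Fin m => f (Sum.inl k))
    (hf2 : Monotone fun k : Fin n => f (Sum.inr k)) (i : SIdx m n) (u : THat m n) :
    pullback f (coeff (heckeDefect i u)) =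
      regularDefect i (pullback f (coeff u)) := by
  simp only [heckeDefect, regularDefect, LinearMap.add_apply, LinearMap.comp_apply, LinearMap.smul_apply, map_add,
    map_smul, pullback_H hf1 hf2, pullback_H0 hf1 hf2]

/-- The orbit of the generic function is regular and without equal values, so the pullback takes its
basis vectors `M` to the coordinate vectors, and these span the functions on the group. -/
theorem regularDefect_eq_zero (i : SIdx m n) :
    regularDefect i = 0 := by
  classical
  have hg := genericFun_antidominant (m := m) (n := n)
  refine LinearMap.pi_ext' fun y => LinearMap.ext_ring ?_
  have h1 := pullback_heckeDefect hg.1.antitone hg.2.monotone i (M (act (genericFun m n) y))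
  rw [heckeDefect_generic, map_zero, map_zero] at h1
  have h2 : pullback (genericFun m n) (coeff (M (act (genericFun m n) y))) =
      LinearMap.single Qq (fun _ => Qq) y 1 := by
    funext z
    have h3 : invCount (act (genericFun m n) z) (act (genericFun m n) z) = 0 := by
      unfold invCount
      rw [Finset.card_eq_zero, Finset.filter_eq_empty_iff]
      rintro ⟨k, l⟩ - ⟨⟨-, -, h4⟩, h5⟩
      simp only at h4 h5
      split_ifs at h4 <;> omega
    change q ^ (-(invCount (act (genericFun m n) z) (act (genericFun m n) z) : ℤ)) *
      coeff (M (act (genericFun m n) y)) (act (genericFun m n) z) = _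
    simp [h3, coeff_M, (act_injective hg.sideInjective).eq_iff, Pi.single_apply]
  rw [h2] at h1
  simpa using h1.symm

theorem exists_act_sorted (g : ZFun m n) : ∃ y : Smn m n,
    (Antitone fun k : Fin m => act g y (Sum.inl k)) ∧
      Monotone fun k : Fin n => act g y (Sum.inr k) := by
  refine ⟨(Tuple.sort fun k : Fin m => -g (Sum.inl k), Tuple.sort fun k : Fin n => g (Sum.inr k)),
    ?_, ?_⟩
  · intro a b hab
    have := Tuple.monotone_sort (fun k : Fin m => -g (Sum.inl k)) hab
    simpa [act] using this
  · intro a b hab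
    have := Tuple.monotone_sort (fun k : Fin n => g (Sum.inr k)) hab
    simpa [act] using this

/-- Every `g` is conjugate to a sorted function, whose pullback turns the operator into its version
on the group, where it vanishes. The argument is coefficientwise, so it covers infinite sums and
nonregular functions alike. -/
theorem H_H0 (i : SIdx m n) (u : THat m n) : H i (H0 u) = -q • H0 u := by
  have h : heckeDefect i u = 0 := by
    apply coeff_injective
    funext g
    obtain ⟨y, h1, h2⟩ := exists_act_sorted g
    have h3 := pullback_heckeDefect h1 h2 i u
    rw [regularDefect_eq_zero, LinearMap.zero_apply] at h3
    -- Evaluation at `y⁻¹` recovers the coefficient at `g` itself, up to a power of `q`.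
    have h4 := congrFun h3 y⁻¹
    change q ^ (-(invCount _ _ : ℤ)) * coeff (heckeDefect i u) (act (act g y) y⁻¹) = 0 at h4
    rw [← act_mul, mul_inv_cancel, act_one] at h4
    simpa using (mul_eq_zero.1 h4).resolve_left (zpow_ne_zero _ q_ne_zero)
  rw [neg_smul]
  exact eq_neg_of_add_eq_zero_left h

end

section

open Filter Topology

variable {m n : ℕ}

/-! ### Coefficients of elements of the exterior algebra -/

theorem EHat_H (u : EHat m n) (i : SIdx m n) : H i u.1 = -q • u.1 := by
  obtain ⟨_, v, rfl⟩ := u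
  exact H_H0 i v

theorem q_inv_add_q_ne_zero : (q⁻¹ + q : Qq) ≠ 0 := by
  have h := q_ne_zero
  intro h1
  have h2 : (q : Qq) ^ 2 + 1 = 0 := by
    field_simp at h1
    linear_combination h1
  have h3 : algebraMap (Polynomial ℚ) Qq (Polynomial.X ^ 2 + 1) = 0 := by
    rw [map_add, map_pow, map_one, RatFunc.algebraMap_X, h2]
  have h4 : (Polynomial.X ^ 2 + 1 : Polynomial ℚ) = 0 :=
    RatFunc.algebraMap_injective ℚ (by rw [h3, map_zero])
  have h5 := congrArg (Polynomial.eval 0) h4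
  simp at h5

/-- On such a coefficient `H_i` acts both by `q⁻¹` and by `-q`. -/
theorem coeff_of_lo_eq_hi (u : EHat m n) {g : ZFun m n} {i : SIdx m n} (h : g (lo i) = g (hi i)) :
    coeff u.1 g = 0 := by
  classical
  have h1 := congrFun (congrArg coeff (EHat_H u i)) g
  rw [map_smul] at h1
  change (if act g (simpleRefl i) = g then q⁻¹ * coeff u.1 g else _) = -q * coeff u.1 g at h1
  rw [if_pos ((act_eq_iff g i).2 h)] at h1
  have h2 : (q⁻¹ + q) * coeff u.1 g = 0 := by linear_combination h1
  exact (mul_eq_zero.1 h2).resolve_left q_inv_add_q_ne_zero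

theorem coeff_act_simpleRefl (u : EHat m n) {g : ZFun m n} (i : SIdx m n) (h : coeff u.1 g = 0) :
    coeff u.1 (act g (simpleRefl i)) = 0 := by
  classical
  have h1 := congrFun (congrArg coeff (EHat_H u i)) g
  rw [map_smul] at h1
  change (if act g (simpleRefl i) = g then q⁻¹ * coeff u.1 g else
    coeff u.1 (act g (simpleRefl i)) - if Descends g i then (q - q⁻¹) * coeff u.1 g else 0) =
    -q * coeff u.1 g at h1
  rw [h] at h1
  split_ifs at h1 with h2
  · rw [h2, h]
  · simpa using h1
  · simpa using h1

theorem coeff_act (u : EHat m n) {g : ZFun m n} (x : Smn m n) (h : coeff u.1 g = 0) :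
    coeff u.1 (act g x) = 0 := by
  obtain ⟨w, rfl⟩ := simpleRefl_generate x
  induction w using List.reverseRecOn with
  | nil => simpa [act_one] using h
  | append_singleton w i ih =>
    rw [List.map_append, List.prod_append, act_mul]
    simpa using coeff_act_simpleRefl u i ih

theorem coeff_act_iff (u : EHat m n) {g : ZFun m n} (x : Smn m n) :
    coeff u.1 (act g x) = 0 ↔ coeff u.1 g = 0 := by
  refine ⟨fun h => ?_, coeff_act u x⟩
  have := coeff_act u x⁻¹ h
  rwa [← act_mul, mul_inv_cancel, act_one] at this

theorem exists_perm_map {k : ℕ} (i j a b : Fin k) (hij : i ≠ j) (hab : a ≠ b) :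
    ∃ x : Equiv.Perm (Fin k), x i = a ∧ x j = b := by
  refine ⟨(Equiv.swap i a).trans (Equiv.swap (Equiv.swap i a j) b), ?_, ?_⟩
  · simp only [Equiv.trans_apply, Equiv.swap_apply_left]
    refine Equiv.swap_apply_of_ne_of_ne ?_ hab
    intro h
    have h1 := congrArg (Equiv.swap i a) h
    simp at h1
    exact hij h1
  · simp

/-- Vanishing of coefficients is constant on orbits, so the two equal values can be brought to
neighbouring positions. -/
theorem coeff_of_not_sideInjective (u : EHat m n) {g : ZFun m n} (h : ¬ SideInjective g) :
    coeff u.1 g = 0 := by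
  unfold SideInjective at h
  rw [not_and_or] at h
  rcases h with h | h
  · rw [Function.not_injective_iff] at h
    obtain ⟨a, b, h1, h2⟩ := h
    have hm : 1 < m := by
      by_contra hm
      exact h2 (Fin.ext (by omega))
    obtain ⟨x, hx1, hx2⟩ := exists_perm_map (⟨0, by omega⟩ : Fin m) ⟨1, by omega⟩ a b (by simp) h2
    rw [← coeff_act_iff u (x, 1)]
    refine coeff_of_lo_eq_hi u (i := Sum.inl ⟨0, by omega⟩) ?_
    simp only [act, lo, hi, Function.comp_apply, Sum.map_inl, zero_add, hx1, hx2]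
    exact h1
  · rw [Function.not_injective_iff] at h
    obtain ⟨a, b, h1, h2⟩ := h
    have hm : 1 < n := by
      by_contra hm
      exact h2 (Fin.ext (by omega))
    obtain ⟨x, hx1, hx2⟩ := exists_perm_map (⟨0, by omega⟩ : Fin n) ⟨1, by omega⟩ a b (by simp) h2
    rw [← coeff_act_iff u (1, x)]
    refine coeff_of_lo_eq_hi u (i := Sum.inr ⟨0, by omega⟩) ?_
    simp only [act, lo, hi, Function.comp_apply, Sum.map_inr, zero_add, hx1, hx2]
    exact h1

theorem regular_iff (g : ZFun m n) : Regular g ↔ SideInjective g := by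
  constructor
  · rintro ⟨x, hx⟩
    have := hx.sideInjective.act x⁻¹
    rwa [← act_mul, mul_inv_cancel, act_one] at this
  · intro h
    obtain ⟨y, h1, h2⟩ := exists_act_sorted g
    have h3 := h.act y
    refine ⟨y * (Fin.revPerm, Fin.revPerm), ?_⟩
    rw [act_mul]
    constructor
    · intro a b hab
      exact (h1.strictAnti_of_injective h3.1) (Fin.rev_lt_rev.2 hab)
    · intro a b hab
      exact (h2.strictMono_of_injective h3.2) (Fin.rev_lt_rev.2 hab)

theorem Dominant.act_w0 {f : ZFun m n} (h : Dominant f) : Antidominant (act f w0) :=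
  ⟨fun _ _ hab => h.1 (Fin.rev_lt_rev.2 hab), fun _ _ hab => h.2 (Fin.rev_lt_rev.2 hab)⟩

theorem w0_mul_w0 : (w0 * w0 : Smn m n) = 1 := by
  refine Prod.ext (Equiv.ext fun k => ?_) (Equiv.ext fun k => ?_) <;> simp [w0]

theorem eq_one_of_dominant {f : ZFun m n} {x : Smn m n} (hf : Dominant f)
    (hx : Dominant (act f x)) : x = 1 := by
  have h1 : x.1 = 1 := by
    have h : StrictMono x.1 := fun a b hab => hf.1.lt_iff_lt.1 (hx.1 hab)
    have := (h.range_inj strictMono_id).1 (by simp [x.1.surjective.range_eq])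
    exact Equiv.ext fun a => congrFun this a
  have h2 : x.2 = 1 := by
    have h : StrictMono x.2 := fun a b hab => hf.2.lt_iff_gt.1 (hx.2 hab)
    have := (h.range_inj strictMono_id).1 (by simp [x.2.surjective.range_eq])
    exact Equiv.ext fun a => congrFun this a
  exact Prod.ext h1 h2

/-- The coefficients of the `K_f`. -/
def coeffE : EHat m n →ₗ[Qq] (ZPlus m n → Qq) where
  toFun u f := coeff u.1 f.1
  map_add' u v := by funext f; simp
  map_smul' r u := by funext f; simp

theorem coeffE_apply (u : EHat m n) (f : ZPlus m n) : coeffE u f = coeff u.1 f.1 := rfl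

-- Among the functions `f · w₀x` only the one with `x = w₀` is dominant, and the normalization of
-- `H_0` gives it the coefficient `(-q) ^ 0`.
open Classical in
theorem coeffE_K (f g : ZPlus m n) : coeffE (K f) g = if g = f then 1 else 0 := by
  change coeff (H0 (M (act f.1 w0))) g.1 = _
  rw [H0_M f.2.act_w0, map_sum, Finset.sum_apply]
  simp only [map_smul, Pi.smul_apply, coeff_M, smul_eq_mul, mul_ite, mul_one, mul_zero]
  have key : ∀ x : Smn m n, g.1 = act (act f.1 w0) x ↔ g = f ∧ x = w0 := by
    intro x
    rw [← act_mul]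
    constructor
    · intro h
      have h1 := eq_one_of_dominant f.2 (h ▸ g.2)
      rw [h1, act_one] at h
      refine ⟨Subtype.ext h, ?_⟩
      calc x = w0 * (w0 * x) := by rw [← mul_assoc, w0_mul_w0, one_mul]
        _ = w0 := by rw [h1, mul_one]
    · rintro ⟨rfl, rfl⟩
      rw [w0_mul_w0, act_one]
  simp only [key]
  by_cases h : g = f
  · simp [h]
  · simp [h]

/-- All values of `f` are at most `e`. -/
def Below (e : ℤ) (f : ZPlus m n) : Prop := ∀ i, f.1 i ≤ e

theorem below_act {g : ZFun m n} {e : ℤ} (h : ∀ i, g i ≤ e) (x : Smn m n) (i : Idx m n) :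
    act g x i ≤ e := h _

theorem coeff_eq_zero_of_coeffE (u : EHat m n) (e : ℤ) (h : ∀ f, Below e f → coeffE u f = 0)
    (g : ZFun m n) (hg : ∀ i, g i ≤ e) : coeff u.1 g = 0 := by
  by_cases hr : SideInjective g
  · obtain ⟨x, hx⟩ := (regular_iff g).2 hr
    rw [← coeff_act_iff u x]
    exact h ⟨_, hx⟩ (below_act hg x)
  · exact coeff_of_not_sideInjective u hr

theorem exists_le (g : ZFun m n) : ∃ e : ℤ, ∀ i, g i ≤ e := by
  obtain ⟨e, he⟩ := (Set.finite_range g).bddAbove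
  exact ⟨e, fun i => he ⟨i, rfl⟩⟩

theorem coeffE_injective : Function.Injective (coeffE : EHat m n → ZPlus m n → Qq) := by
  rw [injective_iff_map_eq_zero]
  intro u hu
  apply Subtype.ext
  apply coeff_injective
  funext g
  obtain ⟨e, he⟩ := exists_le g
  rw [coeff_eq_zero_of_coeffE u e (fun f _ => congrFun hu f) g he]
  simp

theorem coeffE_finite (u : EHat m n) (e : ℤ) : {f : ZPlus m n | Below e f ∧ coeffE u f ≠ 0}.Finite :=
  (coeff_finite u.1 e).preimage (f := Subtype.val) Subtype.val_injective.injOn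

/-- `u` and `v` have the same truncation. -/
def Agree (e : ℤ) (u v : THat m n) : Prop := ∀ g : ZFun m n, (∀ i, g i ≤ e) → coeff u g = coeff v g

theorem trunc_eq_iff (e : ℤ) (u v : THat m n) : trunc e u = trunc e v ↔ Agree e u v := by
  constructor
  · intro h g hg
    have := congrFun h g
    simpa [trunc, hg] using this
  · intro h
    funext g
    by_cases hg : ∀ i, g i ≤ e
    · simpa [trunc, hg] using h g hg
    · simp only [trunc, if_neg hg]

theorem Agree.H {e : ℤ} {u v : THat m n} (h : Agree e u v) (i : SIdx m n) :
    Agree e (H i u) (H i v) := by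
  classical
  intro g hg
  change (if act g (simpleRefl i) = g then q⁻¹ * coeff u g else
    coeff u (act g (simpleRefl i)) - if Descends g i then (q - q⁻¹) * coeff u g else 0) =
    if act g (simpleRefl i) = g then q⁻¹ * coeff v g else
    coeff v (act g (simpleRefl i)) - if Descends g i then (q - q⁻¹) * coeff v g else 0
  rw [h g hg, h _ (below_act hg (simpleRefl i))]

theorem Agree.H0 {e : ℤ} {u v : THat m n} (h : Agree e u v) : Agree e (H0 u) (H0 v) := by
  have hw : ∀ (w : List (SIdx m n)) u v, Agree e u v → Agree e (Hword w u) (Hword w v) := by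
    intro w
    induction w with
    | nil => intro u v h; exact h
    | cons i w ih => intro u v h; exact ih _ _ (h.H i)
  intro g hg
  simp only [GLmn.H0, LinearMap.sum_apply, LinearMap.smul_apply, map_sum, map_smul,
    Finset.sum_apply, Pi.smul_apply]
  refine Finset.sum_congr rfl fun x _ => ?_
  rw [Hx, hw _ u v h g hg]

-- Apply `H_0` to the combination of the antidominant `M_{f · w₀}` with coefficients `c`. As `H_0`
-- only permutes positions, the part below a bound `e` is computed from a finite partial sum, where
-- `coeffE_K` applies.
open Classical in
theorem exists_coeffE_eq (c : ZPlus m n → Qq) (hc : ∀ e, {f | Below e f ∧ c f ≠ 0}.Finite) :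
    ∃ u : EHat m n, coeffE u = c := by
  set c' : ZFun m n → Qq := fun g => if h : Dominant (act g w0) then c ⟨act g w0, h⟩ else 0
    with hc'
  have hmem : c' ∈ tHatSubmodule m n := by
    intro e
    refine ((hc e).image fun f => act f.1 w0).subset ?_
    rintro g ⟨hg, hne⟩
    have hD : Dominant (act g w0) := by
      by_contra hD
      exact hne (by simp [hc', hD])
    refine ⟨⟨act g w0, hD⟩, ⟨below_act hg w0, ?_⟩, ?_⟩
    · simpa [hc', hD] using hne
    · simp only [← act_mul, w0_mul_w0, act_one]
  let v : THat m n := ⟨c', hmem⟩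
  have hv : ∀ g, coeff v g = c' g := fun g => rfl
  refine ⟨⟨H0 v, LinearMap.mem_range_self _ _⟩, ?_⟩
  funext g
  obtain ⟨e, he⟩ := exists_le g.1
  set S := (hc e).toFinset with hS
  set v' : THat m n := ∑ f ∈ S, c f • M (act f.1 w0) with hv'
  have hagree : Agree e v v' := by
    intro h hh
    rw [hv, hv', map_sum, Finset.sum_apply]
    simp only [map_smul, Pi.smul_apply, coeff_M, smul_eq_mul, mul_ite, mul_one, mul_zero]
    have key : ∀ f : ZPlus m n, h = act f.1 w0 ↔ act h w0 = f.1 := by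
      intro f
      constructor
      · rintro rfl; rw [← act_mul, w0_mul_w0, act_one]
      · intro h1; rw [← h1, ← act_mul, w0_mul_w0, act_one]
    simp only [key]
    by_cases hD : Dominant (act h w0)
    · have : ∀ f : ZPlus m n, act h w0 = f.1 ↔ (⟨act h w0, hD⟩ : ZPlus m n) = f := fun f => by
        rw [Subtype.ext_iff]
      simp only [this, Finset.sum_ite_eq, hc', hD, dite_true]
      split_ifs with h1
      · rfl
      · by_contra h2
        refine h1 ?_
        rw [hS, Set.Finite.mem_toFinset]
        exact ⟨below_act hh w0, h2⟩
    · have : ∀ f : ZPlus m n, ¬ act h w0 = f.1 := fun f hf => hD (hf ▸ f.2)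
      simp [this, hc', hD]
  change coeff (H0 v) g.1 = c g
  rw [hagree.H0 g.1 he, hv', map_sum, map_sum, Finset.sum_apply]
  have h1 : ∀ f ∈ S, coeff (H0 (c f • M (act f.1 w0))) g.1 = if g = f then c f else 0 := by
    intro f _
    have h2 := coeffE_K f g
    rw [coeffE_apply] at h2
    change coeff (H0 (M (act f.1 w0))) g.1 = _ at h2
    rw [map_smul, map_smul, Pi.smul_apply, h2]
    simp
  rw [Finset.sum_congr rfl h1, Finset.sum_ite_eq]
  split_ifs with h2
  · rfl
  · by_contra h3
    refine h2 ?_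
    rw [hS, Set.Finite.mem_toFinset]
    exact ⟨he, fun h => h3 h.symm⟩

/-! ### Topology -/

theorem tendsto_THat {α : Type*} {l : Filter α} {φ : α → THat m n} {u : THat m n} :
    Tendsto φ l (𝓝 u) ↔ ∀ e : ℤ, ∀ᶠ x in l, Agree e (φ x) u := by
  have h : 𝓝 u = ⨅ e : ℤ, comap (trunc e) (pure (trunc e u)) := by
    change @nhds (THat m n) (⨅ e : ℤ, TopologicalSpace.induced (trunc e) ⊥) u = _
    rw [nhds_iInf]
    refine iInf_congr fun e => ?_
    rw [@nhds_induced _ _ ⊥, @nhds_discrete _ ⊥ (@DiscreteTopology.mk _ ⊥ rfl)]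
  rw [h, tendsto_iInf]
  refine forall_congr' fun e => ?_
  rw [tendsto_comap_iff, tendsto_pure]
  simp only [Function.comp_apply, trunc_eq_iff]

theorem tendsto_EHat {α : Type*} {l : Filter α} {φ : α → EHat m n} {u : EHat m n} :
    Tendsto φ l (𝓝 u) ↔
      ∀ e : ℤ, ∀ᶠ x in l, ∀ f, Below e f → coeffE (φ x) f = coeffE u f := by
  rw [tendsto_subtype_rng, tendsto_THat]
  refine forall_congr' fun e => ?_
  refine ⟨fun h => ?_, fun h => ?_⟩
  · filter_upwards [h] with x hx f hf
    exact hx f.1 hf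
  · filter_upwards [h] with x hx g hg
    have := coeff_eq_zero_of_coeffE (φ x - u) e
      (fun f hf => by rw [map_sub, Pi.sub_apply, hx f hf, sub_self]) g hg
    rw [Submodule.coe_sub, map_sub, Pi.sub_apply] at this
    exact sub_eq_zero.1 this

theorem continuous_EHat {T : EHat m n → EHat m n}
    (h : ∀ e, ∃ e', ∀ u v, (∀ f, Below e' f → coeffE u f = coeffE v f) →
      ∀ f, Below e f → coeffE (T u) f = coeffE (T v) f) : Continuous T := by
  rw [continuous_iff_continuousAt]
  intro u
  refine tendsto_EHat.2 fun e => ?_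
  obtain ⟨e', he'⟩ := h e
  have h1 : Tendsto (fun v : EHat m n => v) (𝓝 u) (𝓝 u) := tendsto_id
  filter_upwards [tendsto_EHat.1 h1 e'] with v hv f hf
  exact he' v u hv f hf

theorem hasSum_EHat {ι : Type*} {a : ι → EHat m n} {u : EHat m n} :
    HasSum a u ↔ ∀ e : ℤ, ∃ s : Finset ι, ∀ t, s ⊆ t → ∀ f, Below e f →
      ∑ i ∈ t, coeffE (a i) f = coeffE u f := by
  unfold HasSum
  rw [SummationFilter.unconditional_filter, tendsto_EHat]
  refine forall_congr' fun e => ?_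
  rw [eventually_atTop]
  simp only [map_sum, Finset.sum_apply]

theorem HasSum.unique_EHat {ι : Type*} {a : ι → EHat m n} {u v : EHat m n} (hu : HasSum a u)
    (hv : HasSum a v) : u = v := by
  apply coeffE_injective
  funext f
  obtain ⟨e, he⟩ := exists_le f.1
  obtain ⟨s, hs⟩ := hasSum_EHat.1 hu e
  obtain ⟨t, ht⟩ := hasSum_EHat.1 hv e
  classical
  rw [← hs (s ∪ t) Finset.subset_union_left f he, ht (s ∪ t) Finset.subset_union_right f he]

/-- Past a certain finite set of indices, adding one more must leave the truncation unchanged, so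
that term has none. -/
theorem hasSum_finite {ι : Type*} {a : ι → EHat m n} {u : EHat m n} (hu : HasSum a u) (e : ℤ) :
    {i | ∃ f, Below e f ∧ coeffE (a i) f ≠ 0}.Finite := by
  classical
  obtain ⟨s, hs⟩ := hasSum_EHat.1 hu e
  refine s.finite_toSet.subset ?_
  rintro i ⟨f, hf, hne⟩
  by_contra hi
  have h1 := hs (insert i s) (Finset.subset_insert _ _) f hf
  rw [Finset.sum_insert hi, hs s subset_rfl f hf] at h1
  exact hne (by simpa using h1)

theorem hasSum_of_finite {ι : Type*} {a : ι → EHat m n} {u : EHat m n}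
    (h1 : ∀ e, {i | ∃ f, Below e f ∧ coeffE (a i) f ≠ 0}.Finite)
    (h2 : ∀ f (s : Finset ι), (∀ i, coeffE (a i) f ≠ 0 → i ∈ s) →
      ∑ i ∈ s, coeffE (a i) f = coeffE u f) : HasSum a u := by
  refine hasSum_EHat.2 fun e => ⟨(h1 e).toFinset, fun t ht f hf => h2 f t fun i hi => ht ?_⟩
  rw [Set.Finite.mem_toFinset]
  exact ⟨f, hf, hi⟩

end

section

variable {m n : ℕ}

/-! ### Dominant functions as pairs of sets -/

/-- The values of `f` at the negative indices. -/
def leftSet (f : ZFun m n) : Finset ℤ := Finset.univ.image fun k : Fin m => f (Sum.inl k)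

/-- The values of `f` at the positive indices. -/
def rightSet (f : ZFun m n) : Finset ℤ := Finset.univ.image fun k : Fin n => f (Sum.inr k)

theorem mem_leftSet {f : ZFun m n} {z : ℤ} : z ∈ leftSet f ↔ ∃ k, f (Sum.inl k) = z := by
  simp [leftSet]

theorem mem_rightSet {f : ZFun m n} {z : ℤ} : z ∈ rightSet f ↔ ∃ k, f (Sum.inr k) = z := by
  simp [rightSet]

theorem SideInjective.card_leftSet {f : ZFun m n} (h : SideInjective f) : (leftSet f).card = m := by
  rw [leftSet, Finset.card_image_of_injective _ h.1, Finset.card_fin]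

theorem SideInjective.card_rightSet {f : ZFun m n} (h : SideInjective f) :
    (rightSet f).card = n := by
  rw [rightSet, Finset.card_image_of_injective _ h.2, Finset.card_fin]

/-- The dominant function with given sets of values. -/
def ofSets (A B : Finset ℤ) (hA : A.card = m) (hB : B.card = n) : ZPlus m n :=
  ⟨Sum.elim (A.orderEmbOfFin hA) (fun k => B.orderEmbOfFin hB k.rev),
    fun _ _ hab => (A.orderEmbOfFin hA).strictMono hab,
    fun _ _ hab => (B.orderEmbOfFin hB).strictMono (Fin.rev_lt_rev.2 hab)⟩

theorem leftSet_ofSets {A B : Finset ℤ} (hA : A.card = m) (hB : B.card = n) :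
    leftSet (ofSets A B hA hB).1 = A := by
  change Finset.univ.image (fun k => A.orderEmbOfFin hA k) = A
  rw [← Finset.coe_inj, Finset.coe_image, Finset.coe_univ, Set.image_univ]
  exact Finset.range_orderEmbOfFin A hA

theorem rightSet_ofSets {A B : Finset ℤ} (hA : A.card = m) (hB : B.card = n) :
    rightSet (ofSets A B hA hB).1 = B := by
  change Finset.univ.image (fun k : Fin n => B.orderEmbOfFin hB k.rev) = B
  rw [← Finset.coe_inj, Finset.coe_image, Finset.coe_univ, Set.image_univ]
  have : (fun k : Fin n => B.orderEmbOfFin hB k.rev) = B.orderEmbOfFin hB ∘ Fin.revPerm := rfl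
  rw [this, Set.range_comp, Equiv.range_eq_univ, Set.image_univ]
  exact Finset.range_orderEmbOfFin B hB

theorem ZPlus.ext_sets {f g : ZPlus m n} (h1 : leftSet f.1 = leftSet g.1)
    (h2 : rightSet f.1 = rightSet g.1) : f = g := by
  have e1 : (fun k : Fin m => f.1 (Sum.inl k)) = fun k => g.1 (Sum.inl k) := by
    rw [← f.2.1.range_inj g.2.1]
    simpa [leftSet, ← Finset.coe_inj] using h1
  have e2 : (fun k : Fin n => -f.1 (Sum.inr k)) = fun k => -g.1 (Sum.inr k) := by
    have n1 : StrictMono fun k : Fin n => -f.1 (Sum.inr k) := fun a b h => neg_lt_neg (f.2.2 h)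
    have n2 : StrictMono fun k : Fin n => -g.1 (Sum.inr k) := fun a b h => neg_lt_neg (g.2.2 h)
    rw [← n1.range_inj n2]
    have h3 : Set.range (fun k : Fin n => f.1 (Sum.inr k)) = Set.range fun k => g.1 (Sum.inr k) := by
      simpa [rightSet, ← Finset.coe_inj] using h2
    have h4 : ∀ φ : Fin n → ℤ, Set.range (fun k => -φ k) = Neg.neg '' Set.range φ := fun φ => by
      rw [← Set.range_comp]; rfl
    rw [h4, h4, h3]
  refine Subtype.ext (funext fun i => ?_)
  rcases i with k | k
  · exact congrFun e1 k
  · exact neg_injective (congrFun e2 k)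

/-- The basis vector `K_f` for the dominant function `f` with given sets of values. -/
def Kset (A B : Finset ℤ) : EHat m n :=
  if h : A.card = m ∧ B.card = n then K (ofSets A B h.1 h.2) else 0

theorem Kset_sets (f : ZPlus m n) : Kset (leftSet f.1) (rightSet f.1) = K f := by
  have h : (leftSet f.1).card = m ∧ (rightSet f.1).card = n :=
    ⟨f.2.sideInjective.card_leftSet, f.2.sideInjective.card_rightSet⟩
  rw [Kset, dif_pos h]
  exact congrArg K (ZPlus.ext_sets (leftSet_ofSets _ _) (rightSet_ofSets _ _))

open Classical in
theorem coeffE_Kset (A B : Finset ℤ) (g : ZPlus m n) :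
    coeffE (Kset A B) g = if leftSet g.1 = A ∧ rightSet g.1 = B then 1 else 0 := by
  unfold Kset
  split_ifs with h1 h2 h2
  · rw [coeffE_K, if_pos]
    exact ZPlus.ext_sets (by rw [h2.1, leftSet_ofSets]) (by rw [h2.2, rightSet_ofSets])
  · rw [coeffE_K, if_neg]
    rintro rfl
    exact h2 ⟨leftSet_ofSets _ _, rightSet_ofSets _ _⟩
  · refine absurd ⟨?_, ?_⟩ h1
    · rw [← h2.1, g.2.sideInjective.card_leftSet]
    · rw [← h2.2, g.2.sideInjective.card_rightSet]
  · simp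

theorem add_single_left (g : ZFun m n) (k : Fin m) (t : ℤ) :
    (∀ j, (g + Pi.single (Sum.inl k) t : ZFun m n) (Sum.inl j) = if j = k then g (Sum.inl k) + t
      else g (Sum.inl j)) ∧
    ∀ j, (g + Pi.single (Sum.inl k) t : ZFun m n) (Sum.inr j) = g (Sum.inr j) := by
  constructor
  · intro j
    by_cases h : j = k
    · subst h; simp
    · simp [h]
  · intro j; simp

theorem add_single_right (g : ZFun m n) (k : Fin n) (t : ℤ) :
    (∀ j, (g + Pi.single (Sum.inr k) t : ZFun m n) (Sum.inr j) = if j = k then g (Sum.inr k) + t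
      else g (Sum.inr j)) ∧
    ∀ j, (g + Pi.single (Sum.inr k) t : ZFun m n) (Sum.inl j) = g (Sum.inl j) := by
  constructor
  · intro j
    by_cases h : j = k
    · subst h; simp
    · simp [h]
  · intro j; simp

-- A step of one either runs into another value, where coefficients vanish, or preserves the order
-- of the values, so that the shifted function is again dominant.
open Classical in
theorem coeff_Kset_left (A B : Finset ℤ) (g : ZPlus m n) (k : Fin m) {t : ℤ}
    (ht : t = 1 ∨ t = -1) :
    coeff (Kset A B : EHat m n).1 (g.1 + Pi.single (Sum.inl k) t) =
      if g.1 (Sum.inl k) + t ∉ leftSet g.1 ∧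
        insert (g.1 (Sum.inl k) + t) ((leftSet g.1).erase (g.1 (Sum.inl k))) = A ∧
          rightSet g.1 = B then 1 else 0 := by
  obtain ⟨s1, s2⟩ := add_single_left g.1 k t
  by_cases h : g.1 (Sum.inl k) + t ∈ leftSet g.1
  · rw [if_neg (fun h' => h'.1 h)]
    apply coeff_of_not_sideInjective
    rintro ⟨h1, -⟩
    obtain ⟨j, hj⟩ := mem_leftSet.1 h
    have hjk : j ≠ k := by rintro rfl; omega
    refine hjk (h1 (a₁ := j) (a₂ := k) ?_)
    simp only [s1, hjk, if_false, if_true, hj]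
  · have h0 : ∀ j, g.1 (Sum.inl j) ≠ g.1 (Sum.inl k) + t := fun j hj => h (mem_leftSet.2 ⟨j, hj⟩)
    have hdom : Dominant (g.1 + Pi.single (Sum.inl k) t) := by
      constructor
      · intro i j hij
        have := g.2.1 hij
        have h1 := h0 i
        have h2 := h0 j
        simp only [s1] at *
        by_cases hi : i = k <;> by_cases hj : j = k
        · omega
        · rw [if_pos hi, if_neg hj]; subst hi; omega
        · rw [if_neg hi, if_pos hj]; subst hj; omega
        · rw [if_neg hi, if_neg hj]; omega
      · intro i j hij
        simp only [s2]
        exact g.2.2 hij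
    have h3 : rightSet (g.1 + Pi.single (Sum.inl k) t) = rightSet g.1 := by simp only [rightSet, s2]
    have h4 : leftSet (g.1 + Pi.single (Sum.inl k) t) =
        insert (g.1 (Sum.inl k) + t) ((leftSet g.1).erase (g.1 (Sum.inl k))) := by
      ext z
      simp only [mem_leftSet, Finset.mem_insert, Finset.mem_erase, s1]
      constructor
      · rintro ⟨j, rfl⟩
        by_cases hj : j = k
        · simp [hj]
        · exact Or.inr ⟨by rw [if_neg hj]; exact fun h => hj (g.2.1.injective h),
            j, by rw [if_neg hj]⟩
      · rintro (rfl | ⟨h5, j, rfl⟩)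
        · exact ⟨k, by simp⟩
        · exact ⟨j, by rw [if_neg]; rintro rfl; exact h5 rfl⟩
    have h5 := coeffE_Kset A B ⟨_, hdom⟩
    rw [coeffE_apply, h3, h4] at h5
    rw [h5]
    simp [h]

open Classical in
theorem coeff_Kset_right (A B : Finset ℤ) (g : ZPlus m n) (k : Fin n) {t : ℤ}
    (ht : t = 1 ∨ t = -1) :
    coeff (Kset A B : EHat m n).1 (g.1 + Pi.single (Sum.inr k) t) =
      if g.1 (Sum.inr k) + t ∉ rightSet g.1 ∧
        insert (g.1 (Sum.inr k) + t) ((rightSet g.1).erase (g.1 (Sum.inr k))) = B ∧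
          leftSet g.1 = A then 1 else 0 := by
  obtain ⟨s1, s2⟩ := add_single_right g.1 k t
  by_cases h : g.1 (Sum.inr k) + t ∈ rightSet g.1
  · rw [if_neg (fun h' => h'.1 h)]
    apply coeff_of_not_sideInjective
    rintro ⟨-, h1⟩
    obtain ⟨j, hj⟩ := mem_rightSet.1 h
    have hjk : j ≠ k := by rintro rfl; omega
    refine hjk (h1 (a₁ := j) (a₂ := k) ?_)
    simp only [s1, hjk, if_false, if_true, hj]
  · have h0 : ∀ j, g.1 (Sum.inr j) ≠ g.1 (Sum.inr k) + t := fun j hj => h (mem_rightSet.2 ⟨j, hj⟩)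
    have hdom : Dominant (g.1 + Pi.single (Sum.inr k) t) := by
      constructor
      · intro i j hij
        simp only [s2]
        exact g.2.1 hij
      · intro i j hij
        have := g.2.2 hij
        have h1 := h0 i
        have h2 := h0 j
        simp only [s1] at *
        by_cases hi : i = k <;> by_cases hj : j = k
        · omega
        · rw [if_pos hi, if_neg hj]; subst hi; omega
        · rw [if_neg hi, if_pos hj]; subst hj; omega
        · rw [if_neg hi, if_neg hj]; omega
    have h3 : leftSet (g.1 + Pi.single (Sum.inr k) t) = leftSet g.1 := by simp only [leftSet, s2]
    have h4 : rightSet (g.1 + Pi.single (Sum.inr k) t) =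
        insert (g.1 (Sum.inr k) + t) ((rightSet g.1).erase (g.1 (Sum.inr k))) := by
      ext z
      simp only [mem_rightSet, Finset.mem_insert, Finset.mem_erase, s1]
      constructor
      · rintro ⟨j, rfl⟩
        by_cases hj : j = k
        · simp [hj]
        · exact Or.inr ⟨by rw [if_neg hj]; exact fun h => hj (g.2.2.injective h),
            j, by rw [if_neg hj]⟩
      · rintro (rfl | ⟨h5, j, rfl⟩)
        · exact ⟨k, by simp⟩
        · exact ⟨j, by rw [if_neg]; rintro rfl; exact h5 rfl⟩
    have h5 := coeffE_Kset A B ⟨_, hdom⟩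
    rw [coeffE_apply, h3, h4] at h5
    rw [h5]
    simp only [h, not_false_eq_true, true_and, and_comm]

theorem sum_ite_leftSet (g : ZPlus m n) (a z : ℤ) :
    ∑ k : Fin m, (if g.1 (Sum.inl k) = a then z else 0) = if a ∈ leftSet g.1 then z else 0 := by
  by_cases h : a ∈ leftSet g.1
  · obtain ⟨k, hk⟩ := mem_leftSet.1 h
    rw [if_pos h, Finset.sum_eq_single k, if_pos hk]
    · exact fun j _ hj => if_neg fun h => hj (g.2.1.injective (h.trans hk.symm))
    · simp
  · rw [if_neg h]
    exact Finset.sum_eq_zero fun k _ => if_neg fun hk => h (mem_leftSet.2 ⟨k, hk⟩)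

theorem sum_ite_rightSet (g : ZPlus m n) (a z : ℤ) :
    ∑ k : Fin n, (if g.1 (Sum.inr k) = a then z else 0) = if a ∈ rightSet g.1 then z else 0 := by
  by_cases h : a ∈ rightSet g.1
  · obtain ⟨k, hk⟩ := mem_rightSet.1 h
    rw [if_pos h, Finset.sum_eq_single k, if_pos hk]
    · exact fun j _ hj => if_neg fun h => hj (g.2.2.injective (h.trans hk.symm))
    · simp
  · rw [if_neg h]
    exact Finset.sum_eq_zero fun k _ => if_neg fun hk => h (mem_rightSet.2 ⟨k, hk⟩)

/-- The positions further right have values below `a`, so `K_{a+1} K_a⁻¹` acts trivially there. -/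
theorem eExp_right (g : ZPlus m n) {a : ℤ} {k : Fin n} (hk : g.1 (Sum.inr k) = a) :
    eExp a g.1 (Sum.inr k) = 0 := by
  refine Finset.sum_eq_zero fun i hi => ?_
  have hi' : pos (Sum.inr k : Idx m n) < pos i := by simpa using hi
  rcases i with i | i
  · simp only [pos] at hi'; omega
  · have h1 : k < i := Fin.lt_def.2 (by simp only [pos] at hi'; omega)
    have h2 : g.1 (Sum.inr i) < g.1 (Sum.inr k) := g.2.2 h1
    rw [kExp, if_neg (by omega), if_neg (by omega)]
    simp

/-- The later negative positions have values above `a + 1`, so just the positive ones contribute,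
and all of them do. This is the power of `q` in `LocalRule`. -/
theorem eExp_left (g : ZPlus m n) {a : ℤ} {k : Fin m} (hk : g.1 (Sum.inl k) = a + 1) :
    eExp a g.1 (Sum.inl k) =
      (if a + 1 ∈ rightSet g.1 then 1 else 0) - (if a ∈ rightSet g.1 then 1 else 0) := by
  unfold eExp
  rw [Finset.sum_filter, Fintype.sum_sum_type, Finset.sum_eq_zero, zero_add]
  · rw [← sum_ite_rightSet, ← sum_ite_rightSet, ← Finset.sum_sub_distrib]
    refine Finset.sum_congr rfl fun i _ => ?_
    rw [if_pos (by simp only [pos]; omega)]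
    simp [kExp, sgn]
  · intro i _
    split_ifs with hi
    · have h1 : k < i := hi
      have h2 : g.1 (Sum.inl k) < g.1 (Sum.inl i) := g.2.1 h1
      rw [kExp, if_neg (by omega), if_neg (by omega)]
      simp
    · rfl

theorem fExp_left (g : ZPlus m n) {a : ℤ} {k : Fin m} (hk : g.1 (Sum.inl k) = a) :
    fExp a g.1 (Sum.inl k) = 0 := by
  refine Finset.sum_eq_zero fun i hi => ?_
  have hi' : pos i < pos (Sum.inl k : Idx m n) := by simpa using hi
  rcases i with i | i
  · have h1 : i < k := hi'
    have h2 : g.1 (Sum.inl i) < g.1 (Sum.inl k) := g.2.1 h1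
    rw [kExp, if_neg (by omega), if_neg (by omega)]
    simp
  · simp only [pos] at hi'; omega

theorem fExp_right (g : ZPlus m n) {a : ℤ} {k : Fin n} (hk : g.1 (Sum.inr k) = a + 1) :
    fExp a g.1 (Sum.inr k) =
      (if a + 1 ∈ leftSet g.1 then 1 else 0) - (if a ∈ leftSet g.1 then 1 else 0) := by
  unfold fExp
  rw [Finset.sum_filter, Fintype.sum_sum_type, add_comm, Finset.sum_eq_zero, zero_add]
  · rw [← sum_ite_leftSet, ← sum_ite_leftSet, ← Finset.sum_sub_distrib]
    refine Finset.sum_congr rfl fun i _ => ?_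
    rw [if_pos (by simp only [pos]; omega)]
    simp [kExp, sgn]
  · intro i _
    split_ifs with hi
    · have h1 : i < k := by simp only [pos] at hi; exact Fin.lt_def.2 (by omega)
      have h2 : g.1 (Sum.inr k) < g.1 (Sum.inr i) := g.2.2 h1
      rw [kExp, if_neg (by omega), if_neg (by omega)]
      simp
    · rfl

/-- Moving a value by one step. -/
theorem sum_shift_eq {k : ℕ} {φ : Fin k → ℤ} (hφ : Function.Injective φ) {S : Finset ℤ}
    (hS : ∀ z, z ∈ S ↔ ∃ j, φ j = z) {b b' : ℤ} (hb : b ≠ b') (T : Finset ℤ) (c : Fin k → Qq)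
    (r : Qq) (p : Prop) [Decidable p] [∀ U V : Finset ℤ, Decidable (U = V)]
    (hc : ∀ j, φ j = b → c j = r * if b' ∉ S ∧ insert b' (S.erase b) = T ∧ p then 1 else 0) :
    ∑ j, (if φ j = b then c j else 0) =
      if b' ∈ T ∧ b ∉ T then (if S = insert b (T.erase b') ∧ p then r else 0) else 0 := by
  by_cases h : b ∈ S
  · obtain ⟨j, hj⟩ := (hS b).1 h
    rw [Finset.sum_eq_single j (fun i _ hi => if_neg fun h => hi (hφ (h.trans hj.symm)))
      (by simp), if_pos hj, hc j hj]
    have key : (b' ∉ S ∧ insert b' (S.erase b) = T ∧ p) ↔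
        ((b' ∈ T ∧ b ∉ T) ∧ S = insert b (T.erase b') ∧ p) := by
      constructor
      · rintro ⟨h1, rfl, h3⟩
        refine ⟨⟨by simp, by simp [hb]⟩, ?_, h3⟩
        rw [Finset.erase_insert (by simp [h1]), Finset.insert_erase h]
      · rintro ⟨⟨h1, h2⟩, rfl, h3⟩
        refine ⟨by simp [hb.symm], ?_, h3⟩
        rw [Finset.erase_insert (by simp [h2]), Finset.insert_erase h1]
    rw [← ite_and]
    by_cases h1 : b' ∉ S ∧ insert b' (S.erase b) = T ∧ p
    · rw [if_pos h1, if_pos (key.1 h1), mul_one]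
    · rw [if_neg h1, if_neg (fun h2 => h1 (key.2 h2)), mul_zero]
  · rw [Finset.sum_eq_zero fun j _ => if_neg fun hj => h ((hS b).2 ⟨j, hj⟩)]
    split_ifs with h1 h2
    · rw [h2.1] at h; simp at h
    · rfl
    · rfl

/-- Compare coefficients at a dominant `g`: the positive indices give the first term of the rule and
the negative ones the second. -/
theorem localRule_EE (a : ℤ) : LocalRule (Kset : Finset ℤ → Finset ℤ → EHat m n) a (EE a) := by
  classical
  intro A B
  apply coeffE_injective
  funext g
  have hsplit : coeffE (EE a (Kset A B)) g =
      (∑ k : Fin m, if g.1 (Sum.inl k) = a + 1 then q ^ eExp a g.1 (Sum.inl k) *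
        coeff (Kset A B : EHat m n).1 (g.1 + Pi.single (Sum.inl k) (-1)) else 0) +
      ∑ k : Fin n, if g.1 (Sum.inr k) = a then q ^ eExp a g.1 (Sum.inr k) *
        coeff (Kset A B : EHat m n).1 (g.1 + Pi.single (Sum.inr k) 1) else 0 := by
    change (∑ k, if EActs a (g.1 + d k) k then q ^ eExp a (g.1 + d k) k *
      coeff (Kset A B : EHat m n).1 (g.1 + d k) else 0) = _
    rw [Fintype.sum_sum_type]
    congr 1 <;> refine Finset.sum_congr rfl fun k _ => ?_
    · refine if_congr ?_ (by rw [eExp_add_d]; rfl) rfl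
      rw [EActs_add_d]; rfl
    · refine if_congr ?_ (by rw [eExp_add_d]; rfl) rfl
      rw [EActs_add_d]; rfl
  rw [hsplit, map_add, Pi.add_apply, add_comm]
  congr 1
  · rw [sum_shift_eq g.2.2.injective (S := rightSet g.1) (fun z => mem_rightSet) (b := a)
      (b' := a + 1) (by omega) B _ 1 (leftSet g.1 = A)]
    · split_ifs with h1 h2
      · rw [coeffE_Kset, if_pos ⟨h2.2, h2.1⟩]
      · rw [coeffE_Kset, if_neg (fun h => h2 ⟨h.2, h.1⟩)]
      · simp
    · intro j hj
      rw [eExp_right g hj, coeff_Kset_right A B g j (Or.inl rfl), hj, zpow_zero]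
  · rw [sum_shift_eq g.2.1.injective (S := leftSet g.1) (fun z => mem_leftSet) (b := a + 1)
      (b' := a) (by omega) A _
      (q ^ ((if a + 1 ∈ rightSet g.1 then 1 else 0) - (if a ∈ rightSet g.1 then 1 else 0) : ℤ))
      (rightSet g.1 = B)]
    · by_cases h1 : a ∈ A ∧ a + 1 ∉ A
      · rw [if_pos h1, if_pos h1, map_smul, Pi.smul_apply, coeffE_Kset]
        by_cases h2 : leftSet g.1 = insert (a + 1) (A.erase a) ∧ rightSet g.1 = B
        · rw [if_pos h2, if_pos h2, h2.2, smul_eq_mul, mul_one]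
        · rw [if_neg h2, if_neg h2, smul_zero]
      · rw [if_neg h1, if_neg h1]
        simp
    · intro j hj
      rw [eExp_left g hj, coeff_Kset_left A B g j (Or.inr rfl), hj, add_neg_cancel_right]

/-- In the comultiplication of `F_a` the `K`-factors act on the left of the position instead of the
right, so the two sides exchange their roles. All results on cap sums thereby apply to `F_a` too. -/
theorem localRule_EF (a : ℤ) :
    LocalRule (fun A B => (Kset B A : EHat m n)) a (EF a) := by
  classical
  intro B A
  apply coeffE_injective
  funext g
  have hsplit : coeffE (EF a (Kset A B)) g =
      (∑ k : Fin m, if g.1 (Sum.inl k) = a then q ^ fExp a g.1 (Sum.inl k) *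
        coeff (Kset A B : EHat m n).1 (g.1 + Pi.single (Sum.inl k) 1) else 0) +
      ∑ k : Fin n, if g.1 (Sum.inr k) = a + 1 then q ^ fExp a g.1 (Sum.inr k) *
        coeff (Kset A B : EHat m n).1 (g.1 + Pi.single (Sum.inr k) (-1)) else 0 := by
    change (∑ k, if FActs a (g.1 - d k) k then q ^ fExp a (g.1 - d k) k *
      coeff (Kset A B : EHat m n).1 (g.1 - d k) else 0) = _
    rw [Fintype.sum_sum_type]
    congr 1 <;> refine Finset.sum_congr rfl fun k _ => ?_
    · refine if_congr ?_ ?_ rfl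
      · rw [FActs_sub_d]; rfl
      · rw [fExp_sub_d, sub_eq_add_neg, d, ← Pi.single_neg]; rfl
    · refine if_congr ?_ ?_ rfl
      · rw [FActs_sub_d]; rfl
      · rw [fExp_sub_d, sub_eq_add_neg, d, ← Pi.single_neg]; rfl
  rw [hsplit, map_add, Pi.add_apply]
  congr 1
  · rw [sum_shift_eq g.2.1.injective (S := leftSet g.1) (fun z => mem_leftSet) (b := a)
      (b' := a + 1) (by omega) A _ 1 (rightSet g.1 = B)]
    · split_ifs with h1 h2
      · rw [coeffE_Kset, if_pos h2]
      · rw [coeffE_Kset, if_neg h2]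
      · simp
    · intro j hj
      rw [fExp_left g hj, coeff_Kset_left A B g j (Or.inl rfl), hj, zpow_zero]
  · rw [sum_shift_eq g.2.2.injective (S := rightSet g.1) (fun z => mem_rightSet) (b := a + 1)
      (b' := a) (by omega) B _
      (q ^ ((if a + 1 ∈ leftSet g.1 then 1 else 0) - (if a ∈ leftSet g.1 then 1 else 0) : ℤ))
      (leftSet g.1 = A)]
    · by_cases h1 : a ∈ B ∧ a + 1 ∉ B
      · rw [if_pos h1, if_pos h1, map_smul, Pi.smul_apply, coeffE_Kset]
        by_cases h2 : rightSet g.1 = insert (a + 1) (B.erase a) ∧ leftSet g.1 = A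
        · rw [if_pos h2, if_pos (And.symm h2), h2.2, smul_eq_mul, mul_one]
        · rw [if_neg h2, if_neg (fun h => h2 (And.symm h)), smul_zero]
      · rw [if_neg h1, if_neg h1]
        simp
    · intro j hj
      rw [fExp_right g hj, coeff_Kset_right A B g j (Or.inr rfl), hj, add_neg_cancel_right]

theorem wt_dominant (g : ZPlus m n) (a : ℤ) :
    wt g.1 a = (if a ∈ rightSet g.1 then 1 else 0) - (if a ∈ leftSet g.1 then 1 else 0) := by
  simp only [wt, Finsupp.finsetSum_apply, Finsupp.single_apply, Fintype.sum_sum_type, sgn,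
    Finsupp.add_apply]
  rw [sum_ite_leftSet, sum_ite_rightSet]
  split_ifs <;> simp

theorem EK_Kset (a : ℤ) (A B : Finset ℤ) : EK a (Kset A B : EHat m n) =
    q ^ ((if a ∈ B then 1 else 0) - (if a ∈ A then 1 else 0) : ℤ) • Kset A B := by
  classical
  apply coeffE_injective
  funext g
  change q ^ (1 * wt g.1 a) * coeffE (Kset A B) g = _
  rw [map_smul, Pi.smul_apply, coeffE_Kset, wt_dominant, smul_eq_mul]
  by_cases h : leftSet g.1 = A ∧ rightSet g.1 = B
  · rw [if_pos h, h.1, h.2, one_mul]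
  · rw [if_neg h, mul_zero, mul_zero]

theorem EKInv_Kset (a : ℤ) (A B : Finset ℤ) : EKInv a (Kset A B : EHat m n) =
    q ^ (-((if a ∈ B then 1 else 0) - (if a ∈ A then 1 else 0)) : ℤ) • Kset A B := by
  classical
  apply coeffE_injective
  funext g
  change q ^ (-1 * wt g.1 a) * coeffE (Kset A B) g = _
  rw [map_smul, Pi.smul_apply, coeffE_Kset, wt_dominant, smul_eq_mul]
  by_cases h : leftSet g.1 = A ∧ rightSet g.1 = B
  · rw [if_pos h, h.1, h.2, neg_one_mul]
  · rw [if_neg h, mul_zero, mul_zero]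

end

section

/-! ### The cap diagram with given vertices -/

/-- The least integer larger than `c` that is not in `H`. -/
def nextFree (H : Finset ℤ) (c : ℤ) : ℤ := sInf {z | c < z ∧ z ∉ H}

theorem nextFree_mem (H : Finset ℤ) (c : ℤ) : c < nextFree H c ∧ nextFree H c ∉ H := by
  have hne : {z : ℤ | c < z ∧ z ∉ H}.Nonempty := by
    obtain ⟨z, hz1, hz2⟩ := (Set.Ioi_infinite c).exists_notMem_finset H
    exact ⟨z, hz1, hz2⟩
  exact Int.csInf_mem hne ⟨c, fun z hz => hz.1.le⟩

theorem lt_nextFree (H : Finset ℤ) (c : ℤ) : c < nextFree H c := (nextFree_mem H c).1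

theorem nextFree_notMem (H : Finset ℤ) (c : ℤ) : nextFree H c ∉ H := (nextFree_mem H c).2

theorem nextFree_le {H : Finset ℤ} {c z : ℤ} (h1 : c < z) (h2 : z ∉ H) : nextFree H c ≤ z :=
  csInf_le ⟨c, fun _ hz => hz.1.le⟩ ⟨h1, h2⟩

theorem mem_of_lt_nextFree {H : Finset ℤ} {c z : ℤ} (h1 : c < z) (h2 : z < nextFree H c) :
    z ∈ H := by
  by_contra h
  exact absurd (nextFree_le h1 h) (not_le.2 h2)

theorem nextFree_eq {H : Finset ℤ} {c z : ℤ} (h1 : c < z) (h2 : z ∉ H)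
    (h3 : ∀ y, c < y → y < z → y ∈ H) : nextFree H c = z := by
  refine le_antisymm (nextFree_le h1 h2) (not_lt.1 fun h => nextFree_notMem H c ?_)
  exact h3 _ (lt_nextFree H c) h

/-- What lies below a cap is in `N`, a start, or the end of a cap starting later. So cap ends
satisfy a recursion from right to left; with its converse below, this characterizes cap diagrams. -/
theorem IsCapping.eq_nextFree {N D : Finset ℤ} {e : ℤ → ℤ} (h : IsCapping N D e) {c : ℤ}
    (hc : c ∈ D) : e c = nextFree (N ∪ D ∪ (D.filter (c < ·)).image e) c := by
  symm
  apply nextFree_eq (h.lt c hc)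
  · simp only [Finset.mem_union, Finset.mem_image, Finset.mem_filter, not_or]
    refine ⟨⟨h.notMem_N c hc, h.notMem_D c hc⟩, ?_⟩
    rintro ⟨c', ⟨h1, h2⟩, h3⟩
    exact h2.ne (h.inj c hc c' h1 h3.symm)
  · intro y h1 h2
    simp only [Finset.mem_union, Finset.mem_image, Finset.mem_filter]
    by_cases hN : y ∈ N
    · exact Or.inl (Or.inl hN)
    · rcases h.nested c hc y h1 h2 hN with h3 | ⟨c', h3, h4, h5⟩
      · exact Or.inl (Or.inr h3)
      · exact Or.inr ⟨c', ⟨h3, h4⟩, h5.symm⟩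

theorem isCapping_of_eq_nextFree {N D : Finset ℤ} {e : ℤ → ℤ} (hd : ∀ c ∈ D, c ∉ N)
    (h : ∀ c ∈ D, e c = nextFree (N ∪ D ∪ (D.filter (c < ·)).image e) c) : IsCapping N D e := by
  have key : ∀ c ∈ D, e c ∉ N ∧ e c ∉ D ∧ ∀ c' ∈ D, c < c' → e c ≠ e c' := by
    intro c hc
    have := nextFree_notMem (N ∪ D ∪ (D.filter (c < ·)).image e) c
    rw [← h c hc] at this
    simp only [Finset.mem_union, Finset.mem_image, Finset.mem_filter, not_or] at this
    exact ⟨this.1.1, this.1.2, fun c' h1 h2 h3 => this.2 ⟨c', ⟨h1, h2⟩, h3.symm⟩⟩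
  refine ⟨fun c hc => ?_, fun c hc => (key c hc).1, fun c hc => (key c hc).2.1, hd, ?_, ?_⟩
  · rw [h c hc]; exact lt_nextFree _ _
  · intro c hc c' hc' he
    rcases lt_trichotomy c c' with h1 | h1 | h1
    · exact absurd he ((key c hc).2.2 c' hc' h1)
    · exact h1
    · exact absurd he.symm ((key c' hc').2.2 c hc h1)
  · intro c hc z h1 h2 h3
    rw [h c hc] at h2
    have := mem_of_lt_nextFree h1 h2
    simp only [Finset.mem_union, Finset.mem_image, Finset.mem_filter] at this
    rcases this with (h4 | h4) | ⟨c', ⟨h4, h5⟩, h6⟩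
    · exact absurd h4 h3
    · exact Or.inl h4
    · exact Or.inr ⟨c', h4, h5, h6.symm⟩

/-- Induction on the number of starts to the right of `c`, as the recursion for `e c` refers only to
their ends. -/
theorem IsCapping.unique {N D : Finset ℤ} {e e' : ℤ → ℤ} (h : IsCapping N D e)
    (h' : IsCapping N D e') : ∀ c ∈ D, e c = e' c := by
  have key : ∀ k : ℕ, ∀ c ∈ D, (D.filter (c < ·)).card = k → e c = e' c := by
    intro k
    induction k using Nat.strong_induction_on with
    | _ k ih =>
      intro c hc hk
      rw [h.eq_nextFree hc, h'.eq_nextFree hc]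
      congr 2
      refine Finset.image_congr fun c' hc' => ?_
      have hc'' := Finset.mem_filter.1 hc'
      refine ih _ ?_ c' hc''.1 rfl
      rw [← hk]
      refine Finset.card_lt_card (Finset.ssubset_iff_subset_ne.2 ⟨fun x hx => ?_, fun heq => ?_⟩)
      · rw [Finset.mem_filter] at hx ⊢
        exact ⟨hx.1, hc''.2.trans hx.2⟩
      · have : c' ∈ D.filter (c' < ·) := heq ▸ hc'
        simp at this
  exact fun c hc => key _ c hc rfl

theorem exists_isCapping (N D : Finset ℤ) (hd : ∀ c ∈ D, c ∉ N) : ∃ e, IsCapping N D e := by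
  suffices ∃ e : ℤ → ℤ, ∀ c ∈ D, e c = nextFree (N ∪ D ∪ (D.filter (c < ·)).image e) c by
    obtain ⟨e, he⟩ := this
    exact ⟨e, isCapping_of_eq_nextFree hd he⟩
  -- The recursion is solved on a set `M` of starts that grows from right to left. A new least
  -- element does not enter the equations of the others, while `N ∪ D` stays fixed.
  have key : ∀ M : Finset ℤ, ∃ e : ℤ → ℤ, ∀ c ∈ M,
      e c = nextFree (N ∪ D ∪ (M.filter (c < ·)).image e) c := by
    intro M
    induction M using Finset.induction_on_min with
    | empty => exact ⟨id, by simp⟩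
    | insert a M ha ih =>
      obtain ⟨e, he⟩ := ih
      have haM : a ∉ M := fun h => lt_irrefl _ (ha a h)
      refine ⟨Function.update e a (nextFree (N ∪ D ∪ M.image e) a), fun c hc => ?_⟩
      have hupd : ∀ S ⊆ M, S.image (Function.update e a (nextFree (N ∪ D ∪ M.image e) a)) =
          S.image e := fun S hS => Finset.image_congr fun x hx =>
        Function.update_of_ne (fun h : x = a => haM (h ▸ hS hx)) _ _
      rcases Finset.mem_insert.1 hc with rfl | hc'
      · have : (insert c M).filter (c < ·) = M := by
          ext x; simp only [Finset.mem_filter, Finset.mem_insert]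
          constructor
          · rintro ⟨rfl | h1, h2⟩
            · exact absurd h2 (lt_irrefl _)
            · exact h1
          · exact fun h => ⟨Or.inr h, ha x h⟩
        rw [this, hupd M subset_rfl, Function.update_self]
      · have : (insert a M).filter (c < ·) = M.filter (c < ·) := by
          ext x; simp only [Finset.mem_filter, Finset.mem_insert]
          constructor
          · rintro ⟨rfl | h1, h2⟩
            · exact absurd (ha c hc') (lt_asymm h2)
            · exact ⟨h1, h2⟩
          · exact fun h => ⟨Or.inr h.1, h.2⟩
        rw [this, hupd _ (Finset.filter_subset _ _),
          Function.update_of_ne (by rintro rfl; exact haM hc'), he c hc']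
  exact key D

/-- The ends of the caps of the cap diagram with vertices `D`. -/
def capEnd (N D : Finset ℤ) : ℤ → ℤ :=
  if h : ∀ c ∈ D, c ∉ N then (exists_isCapping N D h).choose else id

theorem isCapping_capEnd {N D : Finset ℤ} (hd : ∀ c ∈ D, c ∉ N) : IsCapping N D (capEnd N D) := by
  rw [capEnd, dif_pos hd]
  exact (exists_isCapping N D hd).choose_spec

end

section

open Filter Topology

variable {m n : ℕ}

/-! ### Unitriangular families -/

/-- The sum of the values of a function. -/
def height (f : ZPlus m n) : ℤ := ∑ i, f.1 i

/-- An upper bound on all values and a lower bound on their sum bound each value from below. -/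
theorem finite_below_height (e N : ℤ) : {f : ZPlus m n | Below e f ∧ N ≤ height f}.Finite := by
  have h : (Set.Icc (fun _ => N - (Finset.card (Finset.univ : Finset (Idx m n)) - 1) * e : ZFun m n)
      (fun _ => e)).Finite := Set.finite_Icc _ _
  refine (h.preimage (f := Subtype.val) Subtype.val_injective.injOn).subset ?_
  rintro f ⟨h1, h2⟩
  refine ⟨fun i => ?_, h1⟩
  have h3 : ∑ j ∈ Finset.univ.erase i, f.1 j ≤
      (Finset.univ.erase i).card • e := Finset.sum_le_card_nsmul _ _ _ fun j _ => h1 j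
  have h4 := Finset.add_sum_erase Finset.univ f.1 (Finset.mem_univ i)
  have h5 : ((Finset.univ.erase i).card : ℤ) = (Finset.univ : Finset (Idx m n)).card - 1 := by
    rw [Finset.card_erase_of_mem (Finset.mem_univ i),
      Nat.cast_sub (Finset.card_pos.2 ⟨i, Finset.mem_univ i⟩)]
    simp
  rw [nsmul_eq_mul, h5] at h3
  unfold height at h2
  change N - _ ≤ f.1 i
  linarith

theorem height_le {e : ℤ} {f : ZPlus m n} (h : Below e f) :
    height f ≤ Finset.card (Finset.univ : Finset (Idx m n)) * e := by
  have := Finset.sum_le_card_nsmul Finset.univ f.1 e fun i _ => h i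
  rwa [nsmul_eq_mul] at this

/-- `U` is unitriangular with respect to the monomial basis. -/
structure Unitriangular (U : ZPlus m n → EHat m n) : Prop where
  diag : ∀ f, coeffE (U f) f = 1
  height_lt : ∀ f g, coeffE (U f) g ≠ 0 → g = f ∨ height f < height g
  below : ∀ f g e, coeffE (U f) g ≠ 0 → Below e g → Below e f

/-- The coefficients of a convergent linear combination. -/
def FiniteBelow (c : ZPlus m n → Qq) : Prop := ∀ e, {f | Below e f ∧ c f ≠ 0}.Finite

theorem FiniteBelow.exists_height {c : ZPlus m n → Qq} (hc : FiniteBelow c) (e : ℤ) :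
    ∃ N, ∀ f, Below e f → c f ≠ 0 → N ≤ height f := by
  obtain ⟨N, hN⟩ := ((hc e).image height).bddBelow
  exact ⟨N, fun f h1 h2 => hN ⟨f, ⟨h1, h2⟩, rfl⟩⟩

theorem HasSum.add_EHat {ι : Type*} {a b : ι → EHat m n} {u v : EHat m n} (hu : HasSum a u)
    (hv : HasSum b v) : HasSum (fun i => a i + b i) (u + v) := by
  classical
  rw [hasSum_EHat] at *
  intro e
  obtain ⟨s, hs⟩ := hu e
  obtain ⟨t, ht⟩ := hv e
  refine ⟨s ∪ t, fun r hr f hf => ?_⟩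
  simp only [map_add, Pi.add_apply, Finset.sum_add_distrib]
  rw [hs r (Finset.union_subset_left hr) f hf, ht r (Finset.union_subset_right hr) f hf]

theorem continuous_smul_EHat (r : Qq) : Continuous fun u : EHat m n => r • u :=
  continuous_EHat fun e => ⟨e, fun u v h f hf => by
    rw [map_smul, map_smul, Pi.smul_apply, Pi.smul_apply, h f hf]⟩

theorem HasSum.smul_EHat {ι : Type*} {a : ι → EHat m n} {u : EHat m n} (hu : HasSum a u) (r : Qq) :
    HasSum (fun i => r • a i) (r • u) :=
  hu.map (DistribSMul.toAddMonoidHom (EHat m n) r) (continuous_smul_EHat r)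

namespace Unitriangular

variable {U : ZPlus m n → EHat m n}

theorem finiteBelow (hU : Unitriangular U) {c : ZPlus m n → Qq} {u : EHat m n}
    (h : HasSum (fun f => c f • U f) u) : FiniteBelow c := by
  intro e
  refine (hasSum_finite h e).subset ?_
  rintro f ⟨h1, h2⟩
  refine ⟨f, h1, ?_⟩
  rwa [map_smul, Pi.smul_apply, hU.diag, smul_eq_mul, mul_one]

/-- A coordinate of minimal height is a coefficient. -/
theorem coeff_of_minimal (hU : Unitriangular U) {c : ZPlus m n → Qq} {u : EHat m n}
    (h : HasSum (fun f => c f • U f) u) {e : ℤ} {f : ZPlus m n} (hf : Below e f)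
    (hmin : ∀ g, Below e g → c g ≠ 0 → height f ≤ height g) : coeffE u f = c f := by
  classical
  obtain ⟨s, hs⟩ := hasSum_EHat.1 h e
  rw [← hs (insert f s) (Finset.subset_insert _ _) f hf,
    Finset.sum_eq_single_of_mem f (Finset.mem_insert_self _ _)]
  · rw [map_smul, Pi.smul_apply, hU.diag, smul_eq_mul, mul_one]
  · intro g _ hgf
    rw [map_smul, Pi.smul_apply, smul_eq_mul]
    by_contra hne
    obtain ⟨h1, h2⟩ := mul_ne_zero_iff.1 hne
    have h3 := hmin g (hU.below g f e h2 hf) h1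
    rcases hU.height_lt g f h2 with h4 | h4
    · exact hgf h4.symm
    · omega

theorem exists_minimal {c : ZPlus m n → Qq} (hc : FiniteBelow c) {e : ℤ} {f : ZPlus m n}
    (hf : Below e f) (hcf : c f ≠ 0) : ∃ f, Below e f ∧ c f ≠ 0 ∧
      ∀ g, Below e g → c g ≠ 0 → height f ≤ height g := by
  obtain ⟨g, hg, hmin⟩ := Set.exists_min_image _ height (hc e) ⟨f, hf, hcf⟩
  exact ⟨g, hg.1, hg.2, fun k h1 h2 => hmin k ⟨h1, h2⟩⟩

/-- A nonzero coordinate of least height below `e` would show up as a coefficient of `u`. -/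
theorem coord_eq_zero (hU : Unitriangular U) {c : ZPlus m n → Qq} {u : EHat m n}
    (h : HasSum (fun f => c f • U f) u) {e : ℤ} (hu : ∀ f, Below e f → coeffE u f = 0)
    {f : ZPlus m n} (hf : Below e f) : c f = 0 := by
  by_contra hne
  obtain ⟨g, h1, h2, h3⟩ := exists_minimal (hU.finiteBelow h) hf hne
  exact h2 ((hU.coeff_of_minimal h h1 h3).symm.trans (hu g h1))

theorem coord_unique (hU : Unitriangular U) {c c' : ZPlus m n → Qq} {u : EHat m n}
    (h : HasSum (fun f => c f • U f) u) (h' : HasSum (fun f => c' f • U f) u) : c = c' := by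
  have h1 := HasSum.add_EHat h (HasSum.smul_EHat h' (-1))
  have h2 : HasSum (fun f => (c f - c' f) • U f) 0 := by
    convert h1 using 1
    · funext f; rw [sub_smul]; simp [sub_eq_add_neg]
    · simp
  funext f
  obtain ⟨e, he⟩ := exists_le f.1
  exact sub_eq_zero.1 (hU.coord_eq_zero h2 (e := e) (by simp) he)

/-- Below `e` only finitely many `c f` matter. Their heights are bounded below, hence so are the
heights in the support of the sum, and `finite_below_height` makes this support finite. -/
theorem exists_hasSum (hU : Unitriangular U) {c : ZPlus m n → Qq} (hc : FiniteBelow c) :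
    ∃ u, HasSum (fun f => c f • U f) u := by
  classical
  have hfin : ∀ e g, Below e g → (Function.support fun f => c f * coeffE (U f) g) ⊆
      {f | Below e f ∧ c f ≠ 0} := by
    intro e g hg f hf
    obtain ⟨h1, h2⟩ := mul_ne_zero_iff.1 hf
    exact ⟨hU.below f g e h2 hg, h1⟩
  obtain ⟨u, hu⟩ := exists_coeffE_eq (fun g => ∑ᶠ f, c f * coeffE (U f) g) (by
    intro e
    obtain ⟨N, hN⟩ := hc.exists_height e
    refine (finite_below_height e N).subset ?_
    rintro g ⟨h1, h2⟩
    refine ⟨h1, ?_⟩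
    obtain ⟨f, hf⟩ : ∃ f, c f * coeffE (U f) g ≠ 0 := by
      by_contra! h0
      exact h2 (finsum_eq_zero_of_forall_eq_zero h0)
    obtain ⟨h3, h4⟩ := mul_ne_zero_iff.1 hf
    have h5 := hN f (hU.below f g e h4 h1) h3
    rcases hU.height_lt f g h4 with rfl | h6
    · exact h5
    · omega)
  refine ⟨u, hasSum_of_finite (fun e => (hc e).subset ?_) fun g s hs => ?_⟩
  · rintro f ⟨g, hg, hne⟩
    exact hfin e g hg (by simpa using hne)
  · simp only [hu]
    rw [finsum_eq_sum_of_support_subset (s := s)]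
    · simp
    · intro f hf
      exact hs f (by simpa using hf)

/-- The operator `∑ c_f K_f ↦ ∑ c_f U_f`. -/
def transition (hU : Unitriangular U) (u : EHat m n) : EHat m n :=
  (hU.exists_hasSum (c := coeffE u) (coeffE_finite u)).choose

theorem hasSum_transition (hU : Unitriangular U) (u : EHat m n) :
    HasSum (fun f => coeffE u f • U f) (hU.transition u) :=
  (hU.exists_hasSum (c := coeffE u) (coeffE_finite u)).choose_spec

theorem transition_sub (hU : Unitriangular U) (u v : EHat m n) :
    hU.transition (u - v) = hU.transition u - hU.transition v := by
  refine HasSum.unique_EHat (hU.hasSum_transition _) ?_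
  have := HasSum.add_EHat (hU.hasSum_transition u)
    (HasSum.smul_EHat (hU.hasSum_transition v) (-1))
  convert this using 1
  · funext f; rw [map_sub, Pi.sub_apply, sub_smul]; simp [sub_eq_add_neg]
  · simp [sub_eq_add_neg]

theorem coeffE_transition_of_zero (hU : Unitriangular U) {u : EHat m n} {e : ℤ}
    (hu : ∀ f, Below e f → coeffE u f = 0) {g : ZPlus m n} (hg : Below e g) :
    coeffE (hU.transition u) g = 0 := by
  obtain ⟨s, hs⟩ := hasSum_EHat.1 (hU.hasSum_transition u) e
  rw [← hs s subset_rfl g hg]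
  refine Finset.sum_eq_zero fun f _ => ?_
  by_cases h : coeffE (U f) g = 0
  · simp [h]
  · simp [hu f (hU.below f g e h hg)]

/-- The diagonal terms cancel, so `1 - transition` raises the least height occurring below `e` by at
least one. -/
theorem coeffE_sub_transition (hU : Unitriangular U) {u : EHat m n} {e N : ℤ}
    (hN : ∀ f, Below e f → coeffE u f ≠ 0 → N ≤ height f) {g : ZPlus m n} (hg : Below e g)
    (hne : coeffE (u - hU.transition u) g ≠ 0) : N + 1 ≤ height g := by
  classical
  obtain ⟨s, hs⟩ := hasSum_EHat.1 (hU.hasSum_transition u) e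
  rw [map_sub, Pi.sub_apply, ← hs (insert g s) (Finset.subset_insert _ _) g hg,
    ← Finset.add_sum_erase _ _ (Finset.mem_insert_self g s), map_smul, Pi.smul_apply, hU.diag,
    smul_eq_mul, mul_one, sub_add_eq_sub_sub, sub_self, zero_sub, neg_ne_zero] at hne
  obtain ⟨f, hf, hne⟩ := Finset.exists_ne_zero_of_sum_ne_zero hne
  rw [map_smul, Pi.smul_apply, smul_eq_mul] at hne
  obtain ⟨h1, h2⟩ := mul_ne_zero_iff.1 hne
  have h3 := hN f (hU.below f g e h2 hg) h1
  rcases hU.height_lt f g h2 with h4 | h4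
  · exact absurd h4.symm (Finset.ne_of_mem_erase hf)
  · omega

/-- Neumann series: with `R = 1 - transition`, a preimage of `u` is the sum of all `R^[j] u`.
Heights below `e` are bounded above, so there the terms vanish for large `j`. -/
theorem transition_surjective (hU : Unitriangular U) : Function.Surjective hU.transition := by
  intro u
  set R : EHat m n → EHat m n := fun v => v - hU.transition v with hR
  have hRN : ∀ e N, (∀ f, Below e f → coeffE u f ≠ 0 → N ≤ height f) → ∀ k : ℕ,
      ∀ f, Below e f → coeffE (R^[k] u) f ≠ 0 → N + k ≤ height f := by
    intro e N hN k
    induction k with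
    | zero => simpa using hN
    | succ k ih =>
      intro f hf hne
      rw [Function.iterate_succ_apply'] at hne
      have := hU.coeffE_sub_transition ih hf hne
      push_cast
      omega
  have hvan : ∀ e, ∃ k₀ : ℕ, ∀ k ≥ k₀, ∀ f, Below e f → coeffE (R^[k] u) f = 0 := by
    intro e
    obtain ⟨N, hN⟩ := FiniteBelow.exists_height (c := coeffE u) (coeffE_finite u) e
    refine ⟨(Finset.card (Finset.univ : Finset (Idx m n)) * e - N + 1).toNat, fun k hk f hf => ?_⟩
    by_contra hne
    have h1 := hRN e N hN k f hf hne
    have h2 := height_le hf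
    omega
  choose k₀ hk₀ using hvan
  set S : ℕ → EHat m n := fun k => ∑ j ∈ Finset.range k, R^[j] u with hS
  have hst : ∀ e k, k₀ e ≤ k → ∀ f, Below e f → coeffE (S k) f = coeffE (S (k₀ e)) f := by
    intro e k hk f hf
    rw [hS]
    simp only [map_sum, Finset.sum_apply]
    symm
    refine Finset.sum_subset (Finset.range_mono hk) fun j _ hj => hk₀ e j ?_ f hf
    simpa using hj
  have htel : ∀ k, hU.transition (S k) = u - R^[k] u := by
    intro k
    induction k with
    | zero =>
      simp only [hS, Finset.range_zero, Finset.sum_empty, Function.iterate_zero, id, sub_self]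
      simpa using hU.transition_sub 0 0
    | succ k ih =>
      have : S k = S (k + 1) - R^[k] u := by
        simp only [hS, Finset.sum_range_succ, add_sub_cancel_right]
      rw [this, transition_sub, sub_eq_iff_eq_add] at ih
      rw [ih, Function.iterate_succ_apply']
      simp only [hR]
      abel
  have hex : ∀ f : ZPlus m n, ∃ e, Below e f := fun f => exists_le f.1
  -- The limit of the partial sums is defined coefficientwise: at `f`, use a partial sum that is
  -- already stable below the bound `b f`.
  choose b hb using id hex
  have hval : ∀ e f, Below e f → coeffE (S (k₀ (b f))) f = coeffE (S (k₀ e)) f := by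
    intro e f hf
    rw [← hst (b f) _ (le_max_left _ (k₀ e)) f (hb f), hst e _ (le_max_right _ _) f hf]
  obtain ⟨v, hv⟩ := exists_coeffE_eq (fun f => coeffE (S (k₀ (b f))) f) (by
    intro e
    refine (coeffE_finite (S (k₀ e)) e).subset ?_
    rintro f ⟨h1, h2⟩
    exact ⟨h1, by rwa [← hval e f h1]⟩)
  refine ⟨v, coeffE_injective (funext fun g => ?_)⟩
  obtain ⟨e, he⟩ := hex g
  have h1 := hU.coeffE_transition_of_zero (u := v - S (k₀ e)) (e := e) (fun f hf => by
    rw [map_sub, Pi.sub_apply, hv]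
    exact sub_eq_zero.2 (hval e f hf)) he
  rw [transition_sub, htel, map_sub, map_sub, Pi.sub_apply, Pi.sub_apply,
    hk₀ e _ le_rfl g he, sub_zero, sub_eq_zero] at h1
  exact h1

theorem isTopBasis (hU : Unitriangular U) : IsTopBasis U := by
  intro u
  obtain ⟨v, rfl⟩ := hU.transition_surjective u
  exact ⟨coeffE v, hU.hasSum_transition v, fun c hc => hU.coord_unique hc (hU.hasSum_transition v)⟩

/-- The coordinates with respect to the basis `U`. -/
def coord (hU : Unitriangular U) (u : EHat m n) : ZPlus m n → Qq := (hU.isTopBasis u).choose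

theorem hasSum_coord (hU : Unitriangular U) (u : EHat m n) :
    HasSum (fun f => hU.coord u f • U f) u := (hU.isTopBasis u).choose_spec.1

theorem ext_semilinear (hU : Unitriangular U) {σ : Qq →+* Qq} {S T : EHat m n →ₛₗ[σ] EHat m n}
    (hS : Continuous S) (hT : Continuous T) (h : ∀ f, S (U f) = T (U f)) : S = T := by
  ext1 u
  have h1 := (hU.hasSum_coord u).map S hS
  have h2 := (hU.hasSum_coord u).map T hT
  refine HasSum.unique_EHat h1 ?_
  convert h2 using 1
  funext f
  simp [h]

theorem finiteBelow_bar (hU : Unitriangular U) (u : EHat m n) :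
    FiniteBelow fun f => barQ (hU.coord u f) := fun e =>
  (hU.finiteBelow (hU.hasSum_coord u) e).subset fun f hf => ⟨hf.1, fun h => hf.2 (by simp [h])⟩

theorem hasSum_bar (hU : Unitriangular U) (u : EHat m n) :
    HasSum (fun f => barQ (hU.coord u f) • U f)
      (hU.exists_hasSum (hU.finiteBelow_bar u)).choose :=
  (hU.exists_hasSum (hU.finiteBelow_bar u)).choose_spec

/-- The antilinear map fixing the basis `U`. -/
def bar (hU : Unitriangular U) : EHat m n →ₛₗ[barQ] EHat m n where
  toFun u := (hU.exists_hasSum (hU.finiteBelow_bar u)).choose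
  map_add' u v := by
    refine HasSum.unique_EHat (hU.hasSum_bar (u + v)) ?_
    convert HasSum.add_EHat (hU.hasSum_bar u) (hU.hasSum_bar v) using 1
    funext f
    have : hU.coord (u + v) = fun f => hU.coord u f + hU.coord v f := by
      refine hU.coord_unique (hU.hasSum_coord _) ?_
      convert HasSum.add_EHat (hU.hasSum_coord u) (hU.hasSum_coord v) using 1
      funext f
      rw [add_smul]
    rw [this, map_add, add_smul]
  map_smul' r u := by
    refine HasSum.unique_EHat (hU.hasSum_bar (r • u)) ?_
    convert HasSum.smul_EHat (hU.hasSum_bar u) (barQ r) using 1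
    funext f
    have : hU.coord (r • u) = fun f => r * hU.coord u f := by
      refine hU.coord_unique (hU.hasSum_coord _) ?_
      convert HasSum.smul_EHat (hU.hasSum_coord u) r using 1
      funext f
      rw [mul_smul]
    rw [this, map_mul, mul_smul]

theorem bar_eq_of_hasSum (hU : Unitriangular U) {c : ZPlus m n → Qq} {u v : EHat m n}
    (hu : HasSum (fun f => c f • U f) u) (hv : HasSum (fun f => barQ (c f) • U f) v) :
    hU.bar u = v := by
  refine HasSum.unique_EHat (hU.hasSum_bar u) ?_
  rwa [hU.coord_unique (hU.hasSum_coord u) hu]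

theorem bar_basis (hU : Unitriangular U) (f : ZPlus m n) : hU.bar (U f) = U f := by
  classical
  have h : ∀ σ : Qq →+* Qq, HasSum (fun g => σ ((Pi.single f 1 : ZPlus m n → Qq) g) • U g) (U f) := by
    intro σ
    have := hasSum_single (f := fun g => σ ((Pi.single f 1 : ZPlus m n → Qq) g) • U g) f (fun g hg => by
      simp [Pi.single_eq_of_ne hg])
    simpa using this
  exact hU.bar_eq_of_hasSum (h (RingHom.id Qq)) (h barQ)

theorem continuous_bar (hU : Unitriangular U) : Continuous hU.bar := by
  refine continuous_EHat fun e => ⟨e, fun u v huv g hg => ?_⟩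
  rw [← sub_eq_zero, ← Pi.sub_apply, ← map_sub, ← map_sub]
  have h0 : ∀ f, Below e f → hU.coord (u - v) f = 0 := fun f hf =>
    hU.coord_eq_zero (hU.hasSum_coord (u - v)) (fun f hf => by
      rw [map_sub, Pi.sub_apply, huv f hf, sub_self]) hf
  obtain ⟨s, hs⟩ := hasSum_EHat.1 (hU.hasSum_bar (u - v)) e
  refine (hs s subset_rfl g hg).symm.trans (Finset.sum_eq_zero fun f _ => ?_)
  by_cases h : coeffE (U f) g = 0
  · simp [h]
  · simp [h0 f (hU.below f g e h hg)]

end Unitriangular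

end

section

open Filter Topology

variable {m n : ℕ}

/-! ### The canonical basis -/

theorem sum_moved {N D : Finset ℤ} {e : ℤ → ℤ} (h : IsCapping N D e) {S : Finset ℤ} (hS : S ⊆ D)
    {A : Type*} [AddCommMonoid A] (φ : ℤ → A) :
    ∑ z ∈ moved D e S, φ z = ∑ z ∈ D \ S, φ z + ∑ c ∈ S, φ (e c) := by
  unfold moved
  rw [Finset.sum_union, Finset.sum_image]
  · exact fun c hc c' hc' => h.inj c (hS hc) c' (hS hc')
  · rw [Finset.disjoint_left]
    intro z hz hz'
    obtain ⟨c, hc, rfl⟩ := Finset.mem_image.1 hz'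
    exact h.notMem_D c (hS hc) (Finset.mem_sdiff.1 hz).1

theorem card_moved {N D : Finset ℤ} {e : ℤ → ℤ} (h : IsCapping N D e) {S : Finset ℤ} (hS : S ⊆ D) :
    (moved D e S).card = D.card := by
  have := sum_moved h hS fun _ => 1
  simp only [Finset.sum_const, smul_eq_mul, mul_one] at this
  rw [this, Finset.card_sdiff_add_card_eq_card hS]

theorem moved_eq_iff {N D : Finset ℤ} {e : ℤ → ℤ} (h : IsCapping N D e) {S : Finset ℤ}
    (hS : S ⊆ D) : moved D e S = D ↔ S = ∅ := by
  constructor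
  · intro heq
    rw [Finset.eq_empty_iff_forall_notMem]
    intro c hc
    exact h.notMem_D c (hS hc)
      (heq ▸ Finset.mem_union_right _ (Finset.mem_image_of_mem _ hc))
  · rintro rfl
    simp [moved]

theorem height_eq (f : ZPlus m n) : height f = ∑ z ∈ leftSet f.1, z + ∑ z ∈ rightSet f.1, z := by
  rw [height, Fintype.sum_sum_type, leftSet, rightSet,
    Finset.sum_image (fun a _ b _ h => f.2.1.injective h),
    Finset.sum_image (fun a _ b _ h => f.2.2.injective h)]

theorem below_iff {e : ℤ} {f : ZPlus m n} :
    Below e f ↔ ∀ z, z ∈ leftSet f.1 ∨ z ∈ rightSet f.1 → z ≤ e := by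
  constructor
  · rintro h z (hz | hz)
    · obtain ⟨k, rfl⟩ := mem_leftSet.1 hz
      exact h _
    · obtain ⟨k, rfl⟩ := mem_rightSet.1 hz
      exact h _
  · rintro h (k | k)
    · exact h _ (Or.inl (mem_leftSet.2 ⟨k, rfl⟩))
    · exact h _ (Or.inr (mem_rightSet.2 ⟨k, rfl⟩))

/-- The values that `f` takes both at a negative and at a positive index. -/
def bothSet (f : ZPlus m n) : Finset ℤ := leftSet f.1 ∩ rightSet f.1

/-- The values that `f` takes only at a negative index. -/
def leftOnly (f : ZPlus m n) : Finset ℤ := leftSet f.1 \ rightSet f.1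

/-- The values that `f` takes only at a positive index. -/
def rightOnly (f : ZPlus m n) : Finset ℤ := rightSet f.1 \ leftSet f.1

/-- The ends of the caps of the cap diagram of `f`. -/
def capOf (f : ZPlus m n) : ℤ → ℤ := capEnd (leftOnly f ∪ rightOnly f) (bothSet f)

theorem isCapping_capOf (f : ZPlus m n) :
    IsCapping (leftOnly f ∪ rightOnly f) (bothSet f) (capOf f) := by
  refine isCapping_capEnd fun c hc => ?_
  simp only [bothSet, leftOnly, rightOnly, Finset.mem_inter, Finset.mem_union,
    Finset.mem_sdiff] at *
  tauto

theorem disjoint_only (f : ZPlus m n) : Disjoint (leftOnly f) (rightOnly f) := by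
  rw [Finset.disjoint_left]
  simp only [leftOnly, rightOnly, Finset.mem_sdiff]
  tauto

theorem leftOnly_union (f : ZPlus m n) : leftOnly f ∪ bothSet f = leftSet f.1 :=
  Finset.sdiff_union_inter _ _

theorem rightOnly_union (f : ZPlus m n) : rightOnly f ∪ bothSet f = rightSet f.1 := by
  rw [bothSet, Finset.inter_comm]
  exact Finset.sdiff_union_inter _ _

/-- The canonical basis vector attached to `f`. -/
def capBasis (f : ZPlus m n) : EHat m n :=
  capSum Kset (bothSet f) (capOf f) (leftOnly f) (rightOnly f)

/-- The labels `X`, `Y`, `D` can be recovered from the two sets of values, and the caps are unique.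
-/
theorem capSum_eq_capBasis {X Y D : Finset ℤ} {e : ℤ → ℤ} (h : IsCapping (X ∪ Y) D e)
    (hXY : Disjoint X Y) {f : ZPlus m n} (hl : leftSet f.1 = X ∪ D) (hr : rightSet f.1 = Y ∪ D) :
    capSum Kset D e X Y = capBasis f := by
  have hd : ∀ z, z ∈ X → z ∉ Y := fun _ h => Finset.disjoint_left.1 hXY h
  have hD : ∀ z ∈ D, z ∉ X ∧ z ∉ Y := fun z hz => by
    simpa only [Finset.mem_union, not_or] using h.disj z hz
  have e1 : bothSet f = D := by
    ext z; have := hd z; have := hD z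
    simp only [bothSet, hl, hr, Finset.mem_inter, Finset.mem_union]; tauto
  have e2 : leftOnly f = X := by
    ext z; have := hd z; have := hD z
    simp only [leftOnly, hl, hr, Finset.mem_sdiff, Finset.mem_union]; tauto
  have e3 : rightOnly f = Y := by
    ext z; have := hd z; have := hD z
    simp only [rightOnly, hl, hr, Finset.mem_sdiff, Finset.mem_union]; tauto
  unfold capBasis
  have h' := isCapping_capOf f
  rw [e1, e2, e3] at *
  exact capSum_congr _ (h.unique h') _ _

/-- Moving labels does not change cardinalities, so either every term is a basis vector or every
term has the default value 0 of `Kset`. -/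
theorem capSum_cases_capBasis {X Y D : Finset ℤ} {e : ℤ → ℤ} (h : IsCapping (X ∪ Y) D e)
    (hXY : Disjoint X Y) :
    (capSum Kset D e X Y : EHat m n) = 0 ∨
      ∃ f : ZPlus m n, capSum Kset D e X Y = capBasis f := by
  have hf : ∀ S ⊆ D, Disjoint X (moved D e S) ∧ Disjoint Y (moved D e S) := fun S hS => by
    have := fun z => moved_subset_free (z := z) h hS
    simp only [Finset.mem_union, not_or] at this
    exact ⟨Finset.disjoint_right.2 fun z hz => (this z hz).1,
      Finset.disjoint_right.2 fun z hz => (this z hz).2⟩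
  have hD := hf ∅ (Finset.empty_subset _)
  rw [(moved_eq_iff h (Finset.empty_subset _)).2 rfl] at hD
  by_cases hc : (X ∪ D).card = m ∧ (Y ∪ D).card = n
  · exact Or.inr ⟨ofSets _ _ hc.1 hc.2,
      capSum_eq_capBasis h hXY (leftSet_ofSets _ _) (rightSet_ofSets _ _)⟩
  · refine Or.inl (Finset.sum_eq_zero fun S hS => ?_)
    have hS := Finset.mem_powerset.1 hS
    rw [Kset, dif_neg, smul_zero]
    rw [Finset.card_union_of_disjoint (hf S hS).1, Finset.card_union_of_disjoint (hf S hS).2,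
      card_moved h hS, ← Finset.card_union_of_disjoint hD.1, ← Finset.card_union_of_disjoint hD.2]
    exact hc

/-- The dominant function `g` arises from `f` by moving the values in `S` to the ends of their
caps. -/
def IsMoved (f g : ZPlus m n) (S : Finset ℤ) : Prop :=
  leftSet g.1 = leftOnly f ∪ moved (bothSet f) (capOf f) S ∧
    rightSet g.1 = rightOnly f ∪ moved (bothSet f) (capOf f) S

open Classical in
theorem coeffE_capBasis (f g : ZPlus m n) : coeffE (capBasis f) g =
    ∑ S ∈ (bothSet f).powerset, if IsMoved f g S then q ^ S.card else 0 := by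
  rw [capBasis, capSum, map_sum, Finset.sum_apply]
  refine Finset.sum_congr rfl fun S _ => ?_
  rw [map_smul, Pi.smul_apply, coeffE_Kset, smul_eq_mul, mul_ite, mul_one, mul_zero]
  exact if_congr Iff.rfl rfl rfl

theorem isMoved_empty {f g : ZPlus m n} : IsMoved f g ∅ ↔ g = f := by
  rw [IsMoved, (moved_eq_iff (isCapping_capOf f) (Finset.empty_subset _)).2 rfl, leftOnly_union,
    rightOnly_union]
  exact ⟨fun h => ZPlus.ext_sets h.1 h.2, by rintro rfl; exact ⟨rfl, rfl⟩⟩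

theorem disjoint_moved {f : ZPlus m n} {S : Finset ℤ} (hS : S ⊆ bothSet f) :
    Disjoint (leftOnly f) (moved (bothSet f) (capOf f) S) ∧
      Disjoint (rightOnly f) (moved (bothSet f) (capOf f) S) := by
  have := fun z => moved_subset_free (z := z) (isCapping_capOf f) hS
  simp only [Finset.mem_union, not_or] at this
  exact ⟨Finset.disjoint_right.2 fun z hz => (this z hz).1,
    Finset.disjoint_right.2 fun z hz => (this z hz).2⟩

/-- A moved double label rises by the length of its cap on both sides, hence the factor 2. -/
theorem IsMoved.height_eq {f g : ZPlus m n} {S : Finset ℤ} (h : IsMoved f g S)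
    (hS : S ⊆ bothSet f) : height g = height f + 2 * ∑ c ∈ S, (capOf f c - c) := by
  have h1 := disjoint_moved hS
  have h2 := disjoint_moved (Finset.empty_subset (bothSet f))
  rw [(moved_eq_iff (isCapping_capOf f) (Finset.empty_subset _)).2 rfl] at h2
  rw [GLmn.height_eq, GLmn.height_eq, h.1, h.2, ← leftOnly_union, ← rightOnly_union,
    Finset.sum_union h1.1, Finset.sum_union h1.2, Finset.sum_union h2.1, Finset.sum_union h2.2,
    sum_moved (isCapping_capOf f) hS, Finset.sum_sub_distrib, ← Finset.sum_sdiff hS]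
  ring

theorem IsMoved.eq_empty_or_lt {f g : ZPlus m n} {S : Finset ℤ} (h : IsMoved f g S)
    (hS : S ⊆ bothSet f) : S = ∅ ∨ height f < height g := by
  rcases S.eq_empty_or_nonempty with h1 | h1
  · exact Or.inl h1
  · right
    rw [h.height_eq hS]
    have : 0 < ∑ c ∈ S, (capOf f c - c) := Finset.sum_pos
      (fun c hc => sub_pos.2 ((isCapping_capOf f).lt c (hS hc))) h1
    linarith

theorem IsMoved.below {f g : ZPlus m n} {S : Finset ℤ} (h : IsMoved f g S)
    {e : ℤ} (hg : Below e g) : Below e f := by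
  rw [below_iff] at *
  rw [← leftOnly_union, ← rightOnly_union]
  rw [h.1, h.2] at hg
  have hb : ∀ z ∈ bothSet f, z ≤ e := fun z hz => by
    by_cases hzS : z ∈ S
    · refine ((isCapping_capOf f).lt z hz).le.trans (hg _ (Or.inl ?_))
      exact Finset.mem_union_right _ (Finset.mem_union_right _ (Finset.mem_image_of_mem _ hzS))
    · refine hg _ (Or.inl (Finset.mem_union_right _ (Finset.mem_union_left _ ?_)))
      exact Finset.mem_sdiff.2 ⟨hz, hzS⟩
  rintro z (hz | hz) <;> rcases Finset.mem_union.1 hz with hz | hz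
  · exact hg z (Or.inl (Finset.mem_union_left _ hz))
  · exact hb z hz
  · exact hg z (Or.inr (Finset.mem_union_left _ hz))
  · exact hb z hz

theorem exists_isMoved {f g : ZPlus m n} (h : coeffE (capBasis f) g ≠ 0) :
    ∃ S ⊆ bothSet f, IsMoved f g S := by
  classical
  rw [coeffE_capBasis] at h
  obtain ⟨S, hS, hne⟩ := Finset.exists_ne_zero_of_sum_ne_zero h
  exact ⟨S, Finset.mem_powerset.1 hS, by by_contra h'; simp [h'] at hne⟩

theorem unitriangular_capBasis : Unitriangular (capBasis : ZPlus m n → EHat m n) where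
  diag f := by
    classical
    rw [coeffE_capBasis, Finset.sum_eq_single_of_mem ∅ (Finset.empty_mem_powerset _),
      if_pos (isMoved_empty.2 rfl), Finset.card_empty, pow_zero]
    intro S hS hne
    refine if_neg fun h => ?_
    rcases h.eq_empty_or_lt (Finset.mem_powerset.1 hS) with h1 | h1
    · exact hne h1
    · exact lt_irrefl _ h1
  height_lt f g h := by
    obtain ⟨S, hS, hm⟩ := exists_isMoved h
    rcases hm.eq_empty_or_lt hS with rfl | h1
    · exact Or.inl (isMoved_empty.1 hm)
    · exact Or.inr h1
  below f g e h hg := by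
    obtain ⟨S, hS, hm⟩ := exists_isMoved h
    exact hm.below hg

theorem unitriangular_K : Unitriangular (K : ZPlus m n → EHat m n) where
  diag f := by rw [coeffE_K, if_pos rfl]
  height_lt f g h := by
    rw [coeffE_K] at h
    exact Or.inl (by by_contra h'; simp [h'] at h)
  below f g e h hg := by
    rw [coeffE_K] at h
    have : g = f := by by_contra h'; simp [h'] at h
    exact this ▸ hg

theorem hasSum_K (u : EHat m n) : HasSum (fun g => coeffE u g • K g) u := by
  classical
  have h : ∀ f g : ZPlus m n, coeffE (coeffE u f • K f : EHat m n) g =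
      if g = f then coeffE u g else 0 := by
    intro f g
    rw [map_smul, Pi.smul_apply, coeffE_K, smul_eq_mul, mul_ite, mul_one, mul_zero]
    split_ifs with h
    · rw [h]
    · rfl
  refine hasSum_of_finite (fun e => (coeffE_finite u e).subset ?_) fun g s hs => ?_
  · rintro f ⟨g, h1, h2⟩
    rw [h] at h2
    split_ifs at h2 with h3
    · subst h3; exact ⟨h1, h2⟩
    · exact absurd rfl h2
  · simp only [h] at hs ⊢
    rw [Finset.sum_ite_eq]
    split_ifs with hg
    · rfl
    · by_contra h0
      exact hg (hs g (by rw [if_pos rfl]; exact fun h' => h0 h'.symm))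

/-! ### The bar involution -/

theorem barQ_add_inv : barQ (q + q⁻¹) = q + q⁻¹ := by
  rw [map_add, map_inv₀, barQ_q, inv_inv, add_comm]

theorem continuous_of_zero {T : EHat m n →ₗ[Qq] EHat m n}
    (h : ∀ e, ∃ e', ∀ u : EHat m n, (∀ g : ZFun m n, (∀ i, g i ≤ e') → coeff u.1 g = 0) →
      ∀ f, Below e f → coeffE (T u) f = 0) : Continuous T := by
  refine continuous_EHat fun e => ?_
  obtain ⟨e', he'⟩ := h e
  refine ⟨e', fun u v huv f hf => ?_⟩
  rw [← sub_eq_zero, ← Pi.sub_apply, ← map_sub, ← map_sub]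
  refine he' _ (fun g hg => ?_) f hf
  exact coeff_eq_zero_of_coeffE (u - v) e' (fun f hf => by
    rw [map_sub, Pi.sub_apply, huv f hf, sub_self]) g hg

theorem continuous_EE (a : ℤ) : Continuous (EE a : EHat m n →ₗ[Qq] EHat m n) := by
  classical
  -- The operator changes one value by one, so a truncation one step larger controls the result.
  refine continuous_of_zero fun e => ⟨e + 1, fun u h f hf => ?_⟩
  change (∑ k, if EActs a (f.1 + d k) k then q ^ eExp a (f.1 + d k) k *
    coeff u.1 (f.1 + d k) else 0) = 0
  refine Finset.sum_eq_zero fun k _ => ?_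
  rw [h (f.1 + d k) fun i => add_le_add (hf i) (abs_le.1 (abs_d_le k i)).2, mul_zero, ite_self]

theorem continuous_EF (a : ℤ) : Continuous (EF a : EHat m n →ₗ[Qq] EHat m n) := by
  classical
  refine continuous_of_zero fun e => ⟨e + 1, fun u h f hf => ?_⟩
  change (∑ k, if FActs a (f.1 - d k) k then q ^ fExp a (f.1 - d k) k *
    coeff u.1 (f.1 - d k) else 0) = 0
  refine Finset.sum_eq_zero fun k _ => ?_
  rw [h _ fun i => ?_, mul_zero, ite_self]
  have h1 := hf i
  have h2 := (abs_le.1 (abs_d_le k i)).1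
  change f.1 i - d k i ≤ e + 1
  linarith

theorem continuous_EK (a : ℤ) : Continuous (EK a : EHat m n →ₗ[Qq] EHat m n) := by
  refine continuous_of_zero fun e => ⟨e, fun u h f hf => ?_⟩
  change q ^ (1 * wt f.1 a) * coeff u.1 f.1 = 0
  rw [h _ hf, mul_zero]

theorem continuous_EKInv (a : ℤ) : Continuous (EKInv a : EHat m n →ₗ[Qq] EHat m n) := by
  refine continuous_of_zero fun e => ⟨e, fun u h f hf => ?_⟩
  change q ^ (-1 * wt f.1 a) * coeff u.1 f.1 = 0
  rw [h _ hf, mul_zero]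

theorem typical_iff (f : ZPlus m n) : Typical f.1 ↔ bothSet f = ∅ := by
  rw [Typical, ← card_atypSet, Finset.card_eq_zero, Finset.eq_empty_iff_forall_notMem,
    Finset.eq_empty_iff_forall_notMem]
  simp only [atypSet, Finset.mem_filter, Finset.mem_univ, true_and, bothSet, Finset.mem_inter,
    mem_leftSet, mem_rightSet]
  constructor
  · rintro h z ⟨⟨i, rfl⟩, j, hj⟩
    exact h i ⟨j, hj.symm⟩
  · rintro h i ⟨j, hj⟩
    exact h _ ⟨⟨i, rfl⟩, j, hj.symm⟩

theorem capBasis_of_typical {f : ZPlus m n} (h : Typical f.1) : capBasis f = K f := by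
  rw [typical_iff] at h
  have h1 := leftOnly_union f
  have h2 := rightOnly_union f
  rw [h, Finset.union_empty] at h1 h2
  rw [capBasis, h, capSum_empty, h1, h2, Kset_sets]

/-- The weight of a vector of the canonical basis. -/
def weight (f : ZPlus m n) (a : ℤ) : ℤ :=
  (if a ∈ rightOnly f then 1 else 0) - if a ∈ leftOnly f then 1 else 0

theorem ite_mem_union_sub {X Y W : Finset ℤ} (h1 : Disjoint X W) (h2 : Disjoint Y W) (a : ℤ) :
    ((if a ∈ Y ∪ W then 1 else 0) - (if a ∈ X ∪ W then 1 else 0) : ℤ) =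
      (if a ∈ Y then 1 else 0) - if a ∈ X then 1 else 0 := by
  rw [Finset.disjoint_right] at h1 h2
  by_cases hW : a ∈ W
  · simp [hW, h1 hW, h2 hW]
  · simp [hW]

/-- Double labels contribute nothing to the weight, so all terms of a cap sum have the same weight.
-/
theorem EK_capBasis (a : ℤ) (f : ZPlus m n) :
    EK a (capBasis f) = q ^ weight f a • capBasis f := by
  rw [capBasis, capSum, map_sum, Finset.smul_sum]
  refine Finset.sum_congr rfl fun S hS => ?_
  have h := disjoint_moved (Finset.mem_powerset.1 hS)
  rw [map_smul, EK_Kset, ite_mem_union_sub h.1 h.2, smul_comm]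
  rfl

theorem EKInv_capBasis (a : ℤ) (f : ZPlus m n) :
    EKInv a (capBasis f) = q ^ (-weight f a) • capBasis f := by
  rw [capBasis, capSum, map_sum, Finset.smul_sum]
  refine Finset.sum_congr rfl fun S hS => ?_
  have h := disjoint_moved (Finset.mem_powerset.1 hS)
  rw [map_smul, EKInv_Kset, ite_mem_union_sub h.1 h.2, smul_comm]
  rfl

/-- The antilinear map fixing the vectors `capBasis f`. -/
def barE (m n : ℕ) : EHat m n →ₛₗ[barQ] EHat m n := unitriangular_capBasis.bar

theorem barE_capBasis (f : ZPlus m n) : barE m n (capBasis f) = capBasis f :=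
  unitriangular_capBasis.bar_basis f

theorem barE_capSum {X Y D : Finset ℤ} {e : ℤ → ℤ} (h : IsCapping (X ∪ Y) D e)
    (hXY : Disjoint X Y) : barE m n (capSum Kset D e X Y) = capSum Kset D e X Y := by
  rcases capSum_cases_capBasis (m := m) (n := n) h hXY with h0 | ⟨f, hf⟩
  · rw [h0, map_zero]
  · rw [hf, barE_capBasis]

theorem barE_localRule {κ : Finset ℤ → Finset ℤ → EHat m n} {a : ℤ}
    {Θ : EHat m n →ₗ[Qq] EHat m n} (hΘ : LocalRule κ a Θ)
    (hκ : ∀ X Y D e, IsCapping (X ∪ Y) D e → Disjoint X Y →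
      barE m n (capSum κ D e X Y) = capSum κ D e X Y)
    {X Y D : Finset ℤ} {e : ℤ → ℤ} (h : IsCapping (X ∪ Y) D e) (hXY : Disjoint X Y) :
    barE m n (Θ (capSum κ D e X Y)) = Θ (capSum κ D e X Y) := by
  rcases hΘ.capSum_cases h hXY with h0 | ⟨X', Y', D', e', h1, h2, h3 | h3⟩
  · rw [h0, map_zero]
  · rw [h3, hκ _ _ _ _ h1 h2]
  · rw [h3, map_smulₛₗ, barQ_add_inv, hκ _ _ _ _ h1 h2]

theorem barE_comm {S T : EHat m n →ₗ[Qq] EHat m n} (hS : Continuous S) (hT : Continuous T)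
    (h : ∀ f, barE m n (S (capBasis f)) = T (capBasis f)) (u : EHat m n) :
    barE m n (S u) = T (barE m n u) := by
  have hb : Continuous (barE m n) := unitriangular_capBasis.continuous_bar
  have := unitriangular_capBasis.ext_semilinear (S := (barE m n).comp S) (T := T.comp (barE m n))
    (hb.comp hS) (hT.comp hb) fun f => by
      rw [LinearMap.comp_apply, LinearMap.comp_apply, h, barE_capBasis]
  exact LinearMap.congr_fun this u

theorem isBar_barE : IsBar (barE m n) where
  continuous := unitriangular_capBasis.continuous_bar
  typical f hf := by rw [← capBasis_of_typical hf, barE_capBasis]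
  bar_E a := barE_comm (continuous_EE a) (continuous_EE a) fun f =>
    barE_localRule (localRule_EE a) (fun _ _ _ _ => barE_capSum) (isCapping_capOf f)
      (disjoint_only f)
  -- For `F_a` the left and right labels change places in the local rule and in the cap diagram.
  bar_F a := barE_comm (continuous_EF a) (continuous_EF a) fun f =>
    barE_localRule (X := rightOnly f) (Y := leftOnly f) (localRule_EF a)
      (fun X Y D e h1 h2 => barE_capSum (X := Y) (Y := X) (Finset.union_comm X Y ▸ h1) h2.symm)
      (Finset.union_comm (leftOnly f) _ ▸ isCapping_capOf f) (disjoint_only f).symm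
  bar_K a := barE_comm (continuous_EK a) (continuous_EKInv a) fun f => by
    rw [EK_capBasis, EKInv_capBasis, map_smulₛₗ, barE_capBasis, map_zpow₀, barQ_q, inv_zpow']
  bar_KInv a := barE_comm (continuous_EKInv a) (continuous_EK a) fun f => by
    rw [EK_capBasis, EKInv_capBasis, map_smulₛₗ, barE_capBasis, map_zpow₀, barQ_q, inv_zpow',
      neg_neg]

/-- Vectors fixed by `bar` are stable under `E_a` and `F_a`, and without caps the sets `A` and `B`
are disjoint, so the basis vector is typical or zero. Now `capSum_induction` applies. -/
theorem IsBar.capBasis {bar : EHat m n →ₛₗ[barQ] EHat m n} (hbar : IsBar bar) (f : ZPlus m n) :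
    bar (capBasis f) = GLmn.capBasis f := by
  refine capSum_induction (κ := Kset) (fun v => bar v = v) ?_ (ΘE := EE) (ΘF := EF) localRule_EE
    localRule_EF (fun a v hv => by rw [hbar.bar_E, hv]) (fun a v hv => by rw [hbar.bar_F, hv])
    (isCapping_capOf f) (disjoint_only f)
  intro A B hAB
  unfold Kset
  split_ifs with hc
  · refine hbar.typical _ ((typical_iff _).2 ?_)
    rw [bothSet, leftSet_ofSets, rightSet_ofSets]
    exact Finset.disjoint_iff_inter_eq_empty.1 hAB
  · exact map_zero bar

theorem IsBar.eq_barE {bar : EHat m n →ₛₗ[barQ] EHat m n} (hbar : IsBar bar) : bar = barE m n :=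
  unitriangular_capBasis.ext_semilinear hbar.continuous isBar_barE.continuous fun f => by
    rw [hbar.capBasis, barE_capBasis]

/-! ### Uniqueness of the canonical basis -/

theorem polyQ_eq (p : Polynomial ℤ) :
    polyQ p = algebraMap (Polynomial ℚ) Qq (p.map (Int.castRingHom ℚ)) := by
  unfold polyQ
  induction p using Polynomial.induction_on' with
  | add a b ha hb => rw [map_add, ha, hb, Polynomial.map_add, map_add]
  | monomial k c =>
    rw [Polynomial.aeval_monomial, Polynomial.map_monomial, ← Polynomial.C_mul_X_pow_eq_monomial]
    simp

/-- For the polynomial `r`, invariance means that its bar image is `q ^ 2 * r`. Multiplied by `q ^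
natDegree r`, that image is the reversed polynomial, whose degree is at most that of `r`. -/
theorem eq_zero_of_barQ_eq {p : Polynomial ℤ} (h : barQ (q * polyQ p) = q * polyQ p) :
    polyQ p = 0 := by
  rw [polyQ_eq] at *
  generalize p.map (Int.castRingHom ℚ) = r at *
  have h1 : ∀ s : Polynomial ℚ, algebraMap (Polynomial ℚ) Qq s = s.eval₂ RatFunc.C q := by
    intro s
    induction s using Polynomial.induction_on' with
    | add a b ha hb => rw [map_add, Polynomial.eval₂_add, ha, hb]
    | monomial k c => rw [Polynomial.eval₂_monomial, ← Polynomial.C_mul_X_pow_eq_monomial]; simp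
  have h2 : barQ (algebraMap (Polynomial ℚ) Qq r) * q ^ r.natDegree =
      algebraMap (Polynomial ℚ) Qq r.reverse := by
    have h3 : barQ (algebraMap (Polynomial ℚ) Qq r) = r.eval₂ RatFunc.C q⁻¹ := by
      unfold barQ
      rw [RatFunc.liftRingHom_algebraMap]
      rfl
    let _ : Invertible ((q : Qq)⁻¹) := invertibleOfNonzero (inv_ne_zero q_ne_zero)
    have h4 := Polynomial.eval₂_reverse_mul_pow (RatFunc.C : ℚ →+* Qq) (q : Qq)⁻¹ r
    have h5 : ⅟((q : Qq)⁻¹) = q := by simp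
    rw [h5] at h4
    rw [h3, ← h4, h1, mul_assoc, ← mul_pow, inv_mul_cancel₀ q_ne_zero, one_pow, mul_one]
  by_contra hne
  have hr : r ≠ 0 := by rintro rfl; simp at hne
  rw [map_mul, barQ_q] at h
  have h5 : algebraMap (Polynomial ℚ) Qq r.reverse =
      algebraMap (Polynomial ℚ) Qq (r * Polynomial.X ^ (r.natDegree + 2)) := by
    rw [← h2, map_mul, map_pow, RatFunc.algebraMap_X]
    have h6 : barQ (algebraMap (Polynomial ℚ) Qq r) = q ^ 2 * algebraMap (Polynomial ℚ) Qq r := by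
      rw [pow_two, mul_assoc, ← h, mul_inv_cancel_left₀ q_ne_zero]
    rw [h6]
    ring
  have h7 := congrArg Polynomial.natDegree (RatFunc.algebraMap_injective ℚ h5)
  rw [Polynomial.natDegree_mul_X_pow _ hr] at h7
  have h8 := Polynomial.reverse_natDegree_le r
  omega

theorem hasSum_coeff_eq {c : ZPlus m n → Qq} {u : EHat m n} (h : HasSum (fun g => c g • K g) u)
    (g : ZPlus m n) : coeffE u g = c g :=
  congrFun (unitriangular_K.coord_unique (hasSum_K u) h) g

theorem isCanonicalBasis_capBasis : IsCanonicalBasis (barE m n) capBasis where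
  topBasis := unitriangular_capBasis.isTopBasis
  bar_inv := barE_capBasis
  expansion f := by
    classical
    -- The empty set accounts for `K f`. Every other `S` has at least one cap, from which the
    -- explicit factor `q` is taken, hence the exponent `S.card - 1`.
    refine ⟨fun g => ∑ S ∈ (bothSet f).powerset.erase ∅,
      if IsMoved f g S then Polynomial.X ^ (S.card - 1) else 0, ?_⟩
    convert hasSum_K (capBasis f - K f) using 2 with g
    congr 1
    rw [map_sub, Pi.sub_apply, coeffE_K, coeffE_capBasis,
      ← Finset.add_sum_erase _ _ (Finset.empty_mem_powerset _), polyQ, map_sum, Finset.mul_sum]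
    simp only [isMoved_empty, Finset.card_empty, pow_zero]
    rw [add_sub_cancel_left]
    refine Finset.sum_congr rfl fun S hS => ?_
    split_ifs
    · rw [map_pow, Polynomial.aeval_X, ← pow_succ', Nat.sub_add_cancel]
      exact Finset.card_pos.2 (Finset.nonempty_iff_ne_empty.2 (Finset.ne_of_mem_erase hS))
    · simp

/-- The difference of two candidates has coefficients in `qℤ[q]` over the `K_g` and bar invariant
coordinates over the `capBasis g`. At least height below a bound the two kinds agree, so a nonzero
coordinate there contradicts `eq_zero_of_barQ_eq`. -/
theorem IsCanonicalBasis.eq_capBasis {U : ZPlus m n → EHat m n}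
    (hU : IsCanonicalBasis (barE m n) U) : U = capBasis := by
  funext f
  obtain ⟨p, hp⟩ := hU.expansion f
  obtain ⟨p', hp'⟩ := isCanonicalBasis_capBasis.expansion f
  rw [← sub_eq_zero]
  set v := U f - capBasis f with hv
  have hvp : ∀ g, coeffE v g = q * polyQ (p g - p' g) := by
    intro g
    have h1 := hasSum_coeff_eq hp g
    have h2 := hasSum_coeff_eq hp' g
    rw [map_sub, Pi.sub_apply] at h1 h2
    rw [hv, map_sub, Pi.sub_apply, polyQ, map_sub, mul_sub]
    unfold polyQ at h1 h2
    linear_combination h1 - h2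
  have hbar : barE m n v = v := by rw [hv, map_sub, hU.bar_inv, barE_capBasis]
  have hT : Unitriangular (capBasis : ZPlus m n → EHat m n) := unitriangular_capBasis
  have hc := hT.hasSum_coord v
  have hcbar : ∀ g, barQ (hT.coord v g) = hT.coord v g := by
    have h1 : HasSum (fun g => barQ (hT.coord v g) • capBasis g) v := by
      have := hT.hasSum_bar v
      change HasSum _ (barE m n v) at this
      rwa [hbar] at this
    exact fun g => congrFun (hT.coord_unique h1 hc) g
  have h0 : ∀ g, hT.coord v g = 0 := by
    intro g
    by_contra hne
    obtain ⟨e, he⟩ := exists_le g.1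
    obtain ⟨g', h1, h2, h3⟩ := Unitriangular.exists_minimal (hT.finiteBelow hc) he hne
    have h4 := hT.coeff_of_minimal hc h1 h3
    rw [hvp] at h4
    have h5 := hcbar g'
    rw [← h4] at h5 h2
    rw [eq_zero_of_barQ_eq h5, mul_zero] at h2
    exact h2 rfl
  refine HasSum.unique_EHat hc ?_
  simp only [h0, zero_smul]
  exact hasSum_zero

end

section

variable {m n : ℕ}

/-! ### The lowering operators on weight diagrams -/

/-- The values that `f` takes at exactly one of the two sides. -/
def onlySet (f : ZPlus m n) : Finset ℤ := leftOnly f ∪ rightOnly f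

/-- The common value of `f` at the indices `i_s` and `j_s`. -/
def atypVal (f : ZPlus m n) (s : Fin (atyp f.1)) : ℤ := f.1 (Sum.inl (iIdx f s))

theorem atypVal_strictMono (f : ZPlus m n) : StrictMono (atypVal f) :=
  f.2.1.comp (iIdx_strictMono f)

theorem mem_range_iIdx {f : ZPlus m n} {i : Fin m} :
    (∃ s, iIdx f s = i) ↔ f.1 (Sum.inl i) ∈ rightSet f.1 := by
  have h : Set.range (iIdx f) = atypSet f.1 := Finset.range_orderEmbOfFin _ (card_atypSet f)
  change i ∈ Set.range (iIdx f) ↔ _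
  rw [h, mem_rightSet]
  simp [atypSet, eq_comm]

theorem mem_range_jIdx {f : ZPlus m n} {j : Fin n} :
    (∃ s, jIdx f s = j) ↔ f.1 (Sum.inr j) ∈ leftSet f.1 := by
  rw [mem_leftSet]
  constructor
  · rintro ⟨s, rfl⟩
    exact ⟨_, iIdx_jIdx f s⟩
  · rintro ⟨i, hi⟩
    obtain ⟨s, rfl⟩ := mem_range_iIdx.2 (mem_rightSet.2 ⟨j, hi.symm⟩)
    exact ⟨s, f.2.2.injective ((iIdx_jIdx f s).symm.trans hi)⟩

theorem image_atypVal (f : ZPlus m n) : Finset.univ.image (atypVal f) = bothSet f := by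
  ext z
  simp only [Finset.mem_image, Finset.mem_univ, true_and, bothSet, Finset.mem_inter]
  constructor
  · rintro ⟨s, rfl⟩
    exact ⟨mem_leftSet.2 ⟨_, rfl⟩, mem_rightSet.2 ⟨_, (iIdx_jIdx f s).symm⟩⟩
  · rintro ⟨h1, h2⟩
    obtain ⟨i, rfl⟩ := mem_leftSet.1 h1
    obtain ⟨s, rfl⟩ := mem_range_iIdx.2 h2
    exact ⟨s, rfl⟩

/-- The function with values `p s` at the indices `i_s` and `j_s`, and those of `f` elsewhere. -/
def withVals (f : ZPlus m n) (p : Fin (atyp f.1) → ℤ) : ZFun m n :=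
  Sum.elim (Function.extend (iIdx f) p fun i => f.1 (Sum.inl i))
    (Function.extend (jIdx f) p fun j => f.1 (Sum.inr j))

section

variable (f : ZPlus m n) (p : Fin (atyp f.1) → ℤ)

theorem withVals_iIdx (s : Fin (atyp f.1)) : withVals f p (Sum.inl (iIdx f s)) = p s := by
  rw [withVals, Sum.elim_inl, (iIdx_strictMono f).injective.extend_apply]

theorem withVals_jIdx (s : Fin (atyp f.1)) : withVals f p (Sum.inr (jIdx f s)) = p s := by
  rw [withVals, Sum.elim_inr, (jIdx_strictAnti f).injective.extend_apply]

theorem withVals_inl {i : Fin m} (h : ¬ ∃ s, iIdx f s = i) :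
    withVals f p (Sum.inl i) = f.1 (Sum.inl i) := by
  rw [withVals, Sum.elim_inl, Function.extend_apply' _ _ _ h]

theorem withVals_inr {j : Fin n} (h : ¬ ∃ s, jIdx f s = j) :
    withVals f p (Sum.inr j) = f.1 (Sum.inr j) := by
  rw [withVals, Sum.elim_inr, Function.extend_apply' _ _ _ h]

theorem withVals_atypVal : withVals f (atypVal f) = f.1 := by
  funext i
  rcases i with i | j
  · by_cases h : ∃ s, iIdx f s = i
    · obtain ⟨s, rfl⟩ := h
      rw [withVals_iIdx]; rfl
    · exact withVals_inl f _ h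
  · by_cases h : ∃ s, jIdx f s = j
    · obtain ⟨s, rfl⟩ := h
      rw [withVals_jIdx]; exact iIdx_jIdx f s
    · exact withVals_inr f _ h

theorem leftSet_withVals : leftSet (withVals f p) = leftOnly f ∪ Finset.univ.image p := by
  ext z
  simp only [mem_leftSet, Finset.mem_union, Finset.mem_image, Finset.mem_univ, true_and, leftOnly,
    Finset.mem_sdiff]
  constructor
  · rintro ⟨i, rfl⟩
    by_cases h : ∃ s, iIdx f s = i
    · obtain ⟨s, rfl⟩ := h
      exact Or.inr ⟨s, (withVals_iIdx f p s).symm⟩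
    · rw [withVals_inl f p h]
      exact Or.inl ⟨⟨i, rfl⟩, fun h' => h (mem_range_iIdx.2 h')⟩
  · rintro (⟨⟨i, rfl⟩, h⟩ | ⟨s, rfl⟩)
    · exact ⟨i, withVals_inl f p fun h' => h (mem_range_iIdx.1 h')⟩
    · exact ⟨_, withVals_iIdx f p s⟩

theorem rightSet_withVals : rightSet (withVals f p) = rightOnly f ∪ Finset.univ.image p := by
  ext z
  simp only [mem_rightSet, Finset.mem_union, Finset.mem_image, Finset.mem_univ, true_and,
    rightOnly, Finset.mem_sdiff]
  constructor
  · rintro ⟨i, rfl⟩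
    by_cases h : ∃ s, jIdx f s = i
    · obtain ⟨s, rfl⟩ := h
      exact Or.inr ⟨s, (withVals_jIdx f p s).symm⟩
    · rw [withVals_inr f p h]
      exact Or.inl ⟨⟨i, rfl⟩, fun h' => h (mem_range_jIdx.2 h')⟩
  · rintro (⟨⟨i, rfl⟩, h⟩ | ⟨s, rfl⟩)
    · exact ⟨i, withVals_inr f p fun h' => h (mem_range_jIdx.1 h')⟩
    · exact ⟨_, withVals_jIdx f p s⟩

theorem regular_withVals :
    Regular (withVals f p) ↔ Function.Injective p ∧ ∀ s, p s ∉ onlySet f := by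
  rw [regular_iff]
  constructor
  · intro h
    refine ⟨fun s t hst => ?_, fun s hs => ?_⟩
    · refine (iIdx_strictMono f).injective (h.1 ?_)
      simp only [withVals_iIdx, hst]
    · simp only [onlySet, leftOnly, rightOnly, Finset.mem_union, Finset.mem_sdiff] at hs
      rcases hs with ⟨h1, h2⟩ | ⟨h1, h2⟩
      · obtain ⟨i, hi⟩ := mem_leftSet.1 h1
        have hn : ¬ ∃ t, iIdx f t = i := fun h' => h2 (hi ▸ mem_range_iIdx.1 h')
        refine hn ⟨s, h.1 ?_⟩
        simp only [withVals_iIdx, withVals_inl f p hn, hi]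
      · obtain ⟨i, hi⟩ := mem_rightSet.1 h1
        have hn : ¬ ∃ t, jIdx f t = i := fun h' => h2 (hi ▸ mem_range_jIdx.1 h')
        refine hn ⟨s, h.2 ?_⟩
        simp only [withVals_jIdx, withVals_inr f p hn, hi]
  · rintro ⟨hp, hN⟩
    simp only [onlySet, leftOnly, rightOnly, Finset.mem_union, Finset.mem_sdiff, not_or] at hN
    constructor
    · intro i i' hii
      simp only at hii
      by_cases h : ∃ s, iIdx f s = i <;> by_cases h' : ∃ s, iIdx f s = i'
      · obtain ⟨s, rfl⟩ := h
        obtain ⟨s', rfl⟩ := h'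
        rw [withVals_iIdx, withVals_iIdx] at hii
        rw [hp hii]
      · obtain ⟨s, rfl⟩ := h
        rw [withVals_iIdx, withVals_inl f p h'] at hii
        exact absurd ⟨hii ▸ mem_leftSet.2 ⟨_, rfl⟩, fun h => h' (mem_range_iIdx.2 (hii ▸ h))⟩
          (hN s).1
      · obtain ⟨s, rfl⟩ := h'
        rw [withVals_iIdx, withVals_inl f p h] at hii
        exact absurd ⟨hii ▸ mem_leftSet.2 ⟨_, rfl⟩, fun h' => h (mem_range_iIdx.2 (hii ▸ h'))⟩
          (hN s).1
      · rw [withVals_inl f p h, withVals_inl f p h'] at hii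
        exact f.2.1.injective hii
    · intro i i' hii
      simp only at hii
      by_cases h : ∃ s, jIdx f s = i <;> by_cases h' : ∃ s, jIdx f s = i'
      · obtain ⟨s, rfl⟩ := h
        obtain ⟨s', rfl⟩ := h'
        rw [withVals_jIdx, withVals_jIdx] at hii
        rw [hp hii]
      · obtain ⟨s, rfl⟩ := h
        rw [withVals_jIdx, withVals_inr f p h'] at hii
        exact absurd ⟨hii ▸ mem_rightSet.2 ⟨_, rfl⟩, fun h => h' (mem_range_jIdx.2 (hii ▸ h))⟩
          (hN s).2
      · obtain ⟨s, rfl⟩ := h'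
        rw [withVals_jIdx, withVals_inr f p h] at hii
        exact absurd ⟨hii ▸ mem_rightSet.2 ⟨_, rfl⟩, fun h' => h (mem_range_jIdx.2 (hii ▸ h'))⟩
          (hN s).2
      · rw [withVals_inr f p h, withVals_inr f p h'] at hii
        exact f.2.2.injective hii

/-- So the side condition in `lower` at the pair of index `s` concerns exactly the pairs of index
`t` with `s < t`. -/
theorem withVals_eq {k : Fin m} {l : Fin n} (hN : ∀ s, p s ∉ onlySet f)
    (hp : Function.Injective p)
    (h : withVals f p (Sum.inl k) = withVals f p (Sum.inr l)) :
    ∃ t, iIdx f t = k ∧ jIdx f t = l := by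
  simp only [onlySet, leftOnly, rightOnly, Finset.mem_union, Finset.mem_sdiff, not_or] at hN
  by_cases hk : ∃ s, iIdx f s = k <;> by_cases hl : ∃ s, jIdx f s = l
  · obtain ⟨s, rfl⟩ := hk
    obtain ⟨t, rfl⟩ := hl
    rw [withVals_iIdx, withVals_jIdx] at h
    exact ⟨s, rfl, by rw [hp h]⟩
  · obtain ⟨s, rfl⟩ := hk
    rw [withVals_iIdx, withVals_inr f p hl] at h
    exact absurd ⟨h ▸ mem_rightSet.2 ⟨_, rfl⟩, fun h' => hl (mem_range_jIdx.2 (h ▸ h'))⟩ (hN s).2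
  · obtain ⟨s, rfl⟩ := hl
    rw [withVals_jIdx, withVals_inl f p hk] at h
    exact absurd ⟨h ▸ mem_leftSet.2 ⟨_, rfl⟩, fun h' => hk (mem_range_iIdx.2 (h ▸ h'))⟩ (hN s).1
  · rw [withVals_inl f p hk, withVals_inr f p hl] at h
    exact absurd (mem_range_iIdx.2 (h ▸ mem_rightSet.2 ⟨_, rfl⟩)) hk

/-- The vector `d` is negative at negative indices, so subtracting `d_i - d_j` raises both values:
lowering moves a double label to the right. -/
theorem withVals_sub (s : Fin (atyp f.1)) (a : ℕ) :
    withVals f p - a • (d (Sum.inl (iIdx f s)) - d (Sum.inr (jIdx f s))) =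
      withVals f (Function.update p s (p s + a)) := by
  funext x
  simp only [Pi.sub_apply, Pi.smul_apply, d, sgn]
  rcases x with i | j
  · rw [Pi.single_eq_of_ne (i := Sum.inr (jIdx f s)) (by simp)]
    by_cases h : ∃ t, iIdx f t = i
    · obtain ⟨t, rfl⟩ := h
      rw [withVals_iIdx, withVals_iIdx]
      by_cases hts : t = s
      · subst hts; simp
      · rw [Function.update_of_ne hts, Pi.single_eq_of_ne]
        · simp
        · exact fun h => hts ((iIdx_strictMono f).injective (Sum.inl_injective h))
    · rw [withVals_inl f _ h, withVals_inl f _ h, Pi.single_eq_of_ne]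
      · simp
      · rintro h'
        exact h ⟨s, (Sum.inl_injective h').symm⟩
  · rw [Pi.single_eq_of_ne (i := Sum.inl (iIdx f s)) (by simp)]
    by_cases h : ∃ t, jIdx f t = j
    · obtain ⟨t, rfl⟩ := h
      rw [withVals_jIdx, withVals_jIdx]
      by_cases hts : t = s
      · subst hts; simp
      · rw [Function.update_of_ne hts, Pi.single_eq_of_ne]
        · simp
        · exact fun h => hts ((jIdx_strictAnti f).injective (Sum.inr_injective h))
    · rw [withVals_inr f _ h, withVals_inr f _ h, Pi.single_eq_of_ne]
      · simp
      · rintro h'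
        exact h ⟨s, (Sum.inr_injective h').symm⟩

end

theorem injective_update {α : Type*} [DecidableEq α] {p : α → ℤ} (hp : Function.Injective p)
    {s : α} {z : ℤ} (hz : ∀ u, u ≠ s → p u ≠ z) : Function.Injective (Function.update p s z) := by
  intro a b hab
  by_cases ha : a = s <;> by_cases hb : b = s
  · rw [ha, hb]
  · subst ha; rw [Function.update_self, Function.update_of_ne hb] at hab
    exact absurd hab.symm (hz b hb)
  · subst hb; rw [Function.update_self, Function.update_of_ne ha] at hab
    exact absurd hab (hz a ha)
  · rw [Function.update_of_ne ha, Function.update_of_ne hb] at hab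
    exact hp hab

/-- The least admissible step takes `p s` to the first vertex that is outside `onlySet f`, not
another value, and, by the side conditions, not the target of a later index. This is the cap
recursion, and the induction on `atyp f.1 - s` provides the later targets. -/
theorem lower_withVals (f : ZPlus m n) {p : Fin (atyp f.1) → ℤ} (hp : Function.Injective p)
    (hN : ∀ s, p s ∉ onlySet f) {ε : Fin (atyp f.1) → ℤ} (s : Fin (atyp f.1))
    (hε : ∀ t, s ≤ t → ε t = nextFree (onlySet f ∪ Finset.univ.image p ∪
      (Finset.univ.filter (t < ·)).image ε) (p t)) :
    lowerAt f s (withVals f p) = withVals f (Function.update p s (ε s)) := by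
  obtain ⟨k, hk⟩ : ∃ k, k = atyp f.1 - s := ⟨_, rfl⟩
  induction k using Nat.strong_induction_on generalizing s with
  | _ k ih =>
    have ih' : ∀ t, s < t → lowerAt f t (withVals f p) =
        withVals f (Function.update p t (ε t)) := fun t hst => by
      have : (s : ℕ) < t := hst
      exact ih _ (by omega) t (fun u hu => hε u (hst.le.trans hu)) rfl
    have hfree : ∀ t, s ≤ t → p t < ε t ∧ ε t ∉ onlySet f ∧ (∀ u, p u ≠ ε t) ∧
        ∀ u, t < u → ε u ≠ ε t := by
      intro t hst
      have h1 := nextFree_mem (onlySet f ∪ Finset.univ.image p ∪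
        (Finset.univ.filter (t < ·)).image ε) (p t)
      rw [← hε t hst] at h1
      simp only [Finset.mem_union, Finset.mem_image, Finset.mem_filter, Finset.mem_univ, true_and,
        not_or] at h1
      exact ⟨h1.1, h1.2.1.1, fun u hu => h1.2.1.2 ⟨u, hu⟩, fun u h2 h3 => h1.2.2 ⟨u, h2, h3⟩⟩
    obtain ⟨hs1, hs2, hs3, hs4⟩ := hfree s le_rfl
    have hleast : IsLeast {a : ℕ | 0 < a ∧
        Regular (withVals f p - a • (d (Sum.inl (iIdx f s)) - d (Sum.inr (jIdx f s)))) ∧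
        ∀ k l, iIdx f s < k → l < jIdx f s →
          withVals f p (Sum.inl k) = withVals f p (Sum.inr l) →
          Regular (lower (withVals f p) k l -
            a • (d (Sum.inl (iIdx f s)) - d (Sum.inr (jIdx f s))))} (ε s - p s).toNat := by
      have hcast : ((ε s - p s).toNat : ℤ) = ε s - p s := Int.toNat_of_nonneg (by omega)
      constructor
      · refine ⟨by omega, ?_, ?_⟩
        · rw [withVals_sub, hcast, add_sub_cancel, regular_withVals]
          refine ⟨injective_update hp fun u _ => hs3 u, fun u => ?_⟩
          by_cases hu : u = s
          · subst hu; rwa [Function.update_self]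
          · rw [Function.update_of_ne hu]; exact hN u
        · intro k l hk hl hkl
          obtain ⟨t, rfl, rfl⟩ := withVals_eq f p hN hp hkl
          have hst : s < t := (iIdx_strictMono f).lt_iff_lt.1 hk
          obtain ⟨ht1, ht2, ht3, -⟩ := hfree t hst.le
          change Regular (lowerAt f t (withVals f p) - _)
          rw [ih' t hst, withVals_sub, Function.update_of_ne hst.ne, hcast, add_sub_cancel,
            regular_withVals]
          refine ⟨injective_update (injective_update hp fun u _ => ht3 u) fun u _ => ?_,
            fun u => ?_⟩
          · by_cases hut : u = t
            · subst hut; rw [Function.update_self]; exact hs4 u hst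
            · rw [Function.update_of_ne hut]; exact hs3 u
          · by_cases hu : u = s
            · subst hu; rwa [Function.update_self]
            · rw [Function.update_of_ne hu]
              by_cases hut : u = t
              · subst hut; rwa [Function.update_self]
              · rw [Function.update_of_ne hut]; exact hN u
      · rintro a ⟨ha, h1, h2⟩
        rw [withVals_sub, regular_withVals] at h1
        have h3 : ε s ≤ p s + a := by
          rw [hε s le_rfl]
          refine nextFree_le (by omega) ?_
          simp only [Finset.mem_union, Finset.mem_image, Finset.mem_filter, Finset.mem_univ,
            true_and, not_or]
          refine ⟨⟨?_, ?_⟩, ?_⟩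
          · simpa using h1.2 s
          · rintro ⟨u, hu⟩
            by_cases hus : u = s
            · subst hus; omega
            · refine hus (h1.1 ?_)
              rw [Function.update_of_ne hus, Function.update_self, hu]
          -- If `p s + a` were the target of `t`, then after lowering at `t` the indices `s` and `t`
          -- would carry the same value.
          · rintro ⟨t, hst, ht⟩
            have h4 := h2 (iIdx f t) (jIdx f t) (iIdx_strictMono f hst) (jIdx_strictAnti f hst)
              (by rw [withVals_iIdx, withVals_jIdx])
            change Regular (lowerAt f t (withVals f p) - _) at h4
            rw [ih' t hst, withVals_sub, regular_withVals] at h4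
            refine hst.ne' (h4.1 ?_)
            rw [Function.update_of_ne hst.ne', Function.update_self, Function.update_self,
              Function.update_of_ne hst.ne, ht]
        omega
    unfold lowerAt
    rw [lower, hleast.csInf_eq, withVals_sub, Int.toNat_of_nonneg (by omega), add_sub_cancel]

theorem leftSet_act (g : ZFun m n) (x : Smn m n) : leftSet (act g x) = leftSet g := by
  ext z
  simp only [mem_leftSet, act, Function.comp_apply, Sum.map_inl]
  exact ⟨fun ⟨k, hk⟩ => ⟨_, hk⟩, fun ⟨k, hk⟩ => ⟨x.1.symm k, by simpa using hk⟩⟩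

theorem rightSet_act (g : ZFun m n) (x : Smn m n) : rightSet (act g x) = rightSet g := by
  ext z
  simp only [mem_rightSet, act, Function.comp_apply, Sum.map_inr]
  exact ⟨fun ⟨k, hk⟩ => ⟨_, hk⟩, fun ⟨k, hk⟩ => ⟨x.2.symm k, by simpa using hk⟩⟩

theorem sets_dom {g : ZFun m n} (h : Regular g) :
    leftSet (dom g).1 = leftSet g ∧ rightSet (dom g).1 = rightSet g := by
  rw [dom, dif_pos h]
  exact ⟨leftSet_act _ _, rightSet_act _ _⟩

theorem sets_dom_withVals (f : ZPlus m n) {p : Fin (atyp f.1) → ℤ} (hp : Function.Injective p)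
    (hN : ∀ s, p s ∉ onlySet f) :
    leftSet (dom (withVals f p)).1 = leftOnly f ∪ Finset.univ.image p ∧
      rightSet (dom (withVals f p)).1 = rightOnly f ∪ Finset.univ.image p := by
  rw [← leftSet_withVals, ← rightSet_withVals]
  exact sets_dom ((regular_withVals f p).2 ⟨hp, hN⟩)

end

section

variable {m n : ℕ}

/-! ### The expansion of the canonical basis -/

theorem atypVal_mem (f : ZPlus m n) (s : Fin (atyp f.1)) : atypVal f s ∈ bothSet f := by
  rw [← image_atypVal]
  exact Finset.mem_image_of_mem _ (Finset.mem_univ s)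

theorem exists_atypVal {f : ZPlus m n} {z : ℤ} (h : z ∈ bothSet f) : ∃ s, atypVal f s = z := by
  rw [← image_atypVal] at h
  simpa using h

open Classical in
/-- Some of the values `f(i_s)` are moved to the ends of their caps. -/
def moveVals (f : ZPlus m n) (P : Fin (atyp f.1) → Prop) (s : Fin (atyp f.1)) : ℤ :=
  if P s then capOf f (atypVal f s) else atypVal f s

theorem moveVals_injective (f : ZPlus m n) (P : Fin (atyp f.1) → Prop) :
    Function.Injective (moveVals f P) := by
  have h := isCapping_capOf f
  intro s t hst
  have hs := atypVal_mem f s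
  have ht := atypVal_mem f t
  unfold moveVals at hst
  split_ifs at hst
  · exact (atypVal_strictMono f).injective (h.inj _ hs _ ht hst)
  · exact absurd (hst ▸ ht) (h.notMem_D _ hs)
  · exact absurd (hst ▸ hs) (h.notMem_D _ ht)
  · exact (atypVal_strictMono f).injective hst

theorem moveVals_notMem (f : ZPlus m n) (P : Fin (atyp f.1) → Prop) (s : Fin (atyp f.1)) :
    moveVals f P s ∉ onlySet f := by
  have h := isCapping_capOf f
  unfold moveVals
  split_ifs
  · exact h.notMem_N _ (atypVal_mem f s)
  · exact h.disj _ (atypVal_mem f s)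

/-- As long as `s` and the later indices are unmoved, the ends of the original caps still solve the
recursion: the vertices below a cap are in `onlySet f`, later values, or later cap ends. The moved
earlier values are other cap ends and do no harm. -/
theorem lower_moveVals (f : ZPlus m n) {P : Fin (atyp f.1) → Prop} {s : Fin (atyp f.1)}
    (hP : ∀ t, s ≤ t → ¬ P t) :
    lowerAt f s (withVals f (moveVals f P)) = withVals f (moveVals f fun t => P t ∨ t = s) := by
  have h := isCapping_capOf f
  have hv : ∀ t, s ≤ t → moveVals f P t = atypVal f t := fun t ht => if_neg (hP t ht)
  rw [lower_withVals f (moveVals_injective f P) (moveVals_notMem f P)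
    (ε := fun t => capOf f (atypVal f t)) s]
  · congr 1
    funext t
    by_cases hts : t = s
    · subst hts
      simp [moveVals]
    · rw [Function.update_of_ne hts]
      by_cases hPt : P t <;> simp [moveVals, hPt, hts]
  · intro t ht
    rw [hv t ht]
    symm
    apply nextFree_eq (h.lt _ (atypVal_mem f t))
    · simp only [Finset.mem_union, Finset.mem_image, Finset.mem_univ, true_and, Finset.mem_filter,
        not_or]
      refine ⟨⟨h.notMem_N _ (atypVal_mem f t), ?_⟩, ?_⟩
      · rintro ⟨u, hu⟩
        unfold moveVals at hu
        split_ifs at hu with hPu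
        · have := (atypVal_strictMono f).injective (h.inj _ (atypVal_mem f u) _ (atypVal_mem f t) hu)
          exact hP t ht (this ▸ hPu)
        · exact h.notMem_D _ (atypVal_mem f t) (hu ▸ atypVal_mem f u)
      · rintro ⟨u, htu, hu⟩
        exact htu.ne' ((atypVal_strictMono f).injective
          (h.inj _ (atypVal_mem f u) _ (atypVal_mem f t) hu))
    · intro y h1 h2
      simp only [Finset.mem_union, Finset.mem_image, Finset.mem_univ, true_and, Finset.mem_filter]
      by_cases hy : y ∈ onlySet f
      · exact Or.inl (Or.inl hy)
      · rcases h.nested _ (atypVal_mem f t) y h1 h2 hy with h3 | ⟨c, h3, h4, rfl⟩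
        · obtain ⟨u, rfl⟩ := exists_atypVal h3
          exact Or.inl (Or.inr ⟨u, hv u (ht.trans ((atypVal_strictMono f).lt_iff_lt.1 h1).le)⟩)
        · obtain ⟨u, rfl⟩ := exists_atypVal h3
          exact Or.inr ⟨u, (atypVal_strictMono f).lt_iff_lt.1 h4, rfl⟩

theorem Ltheta_eq (f : ZPlus m n) (θ : Fin (atyp f.1) → Fin 2) :
    Ltheta f (fun s => (θ s : ℕ)) = dom (withVals f (moveVals f fun s => θ s = 1)) := by
  -- In `L_θ` the first index acts first, so when `s` has its turn only earlier indices have moved,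
  -- as `lower_moveVals` requires.
  have key : ∀ k ≤ atyp f.1, ((List.finRange (atyp f.1)).take k).foldl
      (fun g s => (lowerAt f s)^[(θ s : ℕ)] g) f.1 =
        withVals f (moveVals f fun s => (s : ℕ) < k ∧ θ s = 1) := by
    intro k
    induction k with
    | zero =>
      intro _
      simp only [List.take_zero, List.foldl_nil]
      conv_lhs => rw [← withVals_atypVal f]
      congr 1
      funext s
      simp [moveVals]
    | succ k ih =>
      intro hk
      rw [List.take_succ_eq_append_getElem (by simpa using hk), List.foldl_append,
        ih (by omega), List.foldl_cons, List.foldl_nil, List.getElem_finRange]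
      set s : Fin (atyp f.1) := ⟨k, hk⟩ with hs
      have hs' : ∀ t : Fin (atyp f.1), (t : ℕ) < k + 1 ↔ (t : ℕ) < k ∨ t = s := fun t => by
        rw [Fin.ext_iff]; change _ ↔ _ ∨ (t : ℕ) = k; omega
      change (lowerAt f s)^[(θ s : ℕ)] _ = _
      rcases Fin.exists_fin_two.1 ⟨θ s, rfl⟩ with h | h
      · rw [h]
        simp only [Fin.val_zero, Function.iterate_zero, id]
        congr 2
        funext t
        rw [hs', eq_iff_iff]
        constructor
        · exact fun h' => ⟨Or.inl h'.1, h'.2⟩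
        · rintro ⟨h1 | rfl, h2⟩
          · exact ⟨h1, h2⟩
          · rw [h] at h2; exact absurd h2 (by decide)
      · rw [h]
        simp only [Fin.val_one, Function.iterate_one]
        rw [lower_moveVals]
        · congr 2
          funext t
          rw [hs', eq_iff_iff]
          constructor
          · rintro (h' | rfl)
            · exact ⟨Or.inl h'.1, h'.2⟩
            · exact ⟨Or.inr rfl, h⟩
          · rintro ⟨h1 | h1, h2⟩
            · exact Or.inl ⟨h1, h2⟩
            · exact Or.inr h1
        · intro t ht h'
          have : k ≤ (t : ℕ) := ht
          omega
  have := key _ le_rfl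
  rw [List.take_of_length_le (by simp)] at this
  rw [Ltheta, this]
  congr 3
  funext s
  simp

theorem image_moveVals (f : ZPlus m n) (P : Fin (atyp f.1) → Prop) [DecidablePred P] :
    Finset.univ.image (moveVals f P) =
      moved (bothSet f) (capOf f) ((Finset.univ.filter P).image (atypVal f)) := by
  ext z
  simp only [moved, Finset.mem_image, Finset.mem_univ, true_and, Finset.mem_union,
    Finset.mem_sdiff, Finset.mem_filter, exists_exists_and_eq_and]
  constructor
  · rintro ⟨s, rfl⟩
    by_cases hs : P s
    · exact Or.inr ⟨s, hs, by simp [moveVals, hs]⟩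
    · refine Or.inl ⟨by simpa [moveVals, hs] using atypVal_mem f s, ?_⟩
      rintro ⟨t, ht, h⟩
      simp only [moveVals, hs, if_false] at h
      exact hs ((atypVal_strictMono f).injective h ▸ ht)
  · rintro (⟨h1, h2⟩ | ⟨s, hs, rfl⟩)
    · obtain ⟨s, rfl⟩ := exists_atypVal h1
      refine ⟨s, ?_⟩
      have : ¬ P s := fun h => h2 ⟨s, h, rfl⟩
      simp [moveVals, this]
    · exact ⟨s, by simp [moveVals, hs]⟩

theorem K_Ltheta (f : ZPlus m n) (θ : Fin (atyp f.1) → Fin 2) :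
    K (Ltheta f fun s => (θ s : ℕ)) =
      Kset (leftOnly f ∪ moved (bothSet f) (capOf f)
        ((Finset.univ.filter fun s => θ s = 1).image (atypVal f)))
        (rightOnly f ∪ moved (bothSet f) (capOf f)
          ((Finset.univ.filter fun s => θ s = 1).image (atypVal f))) := by
  have h := sets_dom_withVals f (moveVals_injective f fun s => θ s = 1) (moveVals_notMem f _)
  rw [Ltheta_eq, ← Kset_sets, h.1, h.2, image_moveVals]

theorem capBasis_eq_sum (f : ZPlus m n) :
    capBasis f = ∑ θ : Fin (atyp f.1) → Fin 2,
      q ^ (∑ s, (θ s : ℕ)) • K (Ltheta f fun s => (θ s : ℕ)) := by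
  have hinj := (atypVal_strictMono f).injective
  rw [capBasis, capSum]
  symm
  refine Finset.sum_bij (fun θ _ => (Finset.univ.filter fun s => θ s = 1).image (atypVal f))
    ?_ ?_ ?_ ?_
  · intro θ _
    rw [Finset.mem_powerset, ← image_atypVal]
    exact Finset.image_subset_image (Finset.filter_subset _ _)
  · intro θ _ θ' _ h
    have h' := Finset.image_injective hinj h
    funext s
    have := Finset.ext_iff.1 h' s
    simp only [Finset.mem_filter, Finset.mem_univ, true_and] at this
    omega
  · intro S hS
    rw [Finset.mem_powerset] at hS
    refine ⟨fun s => if atypVal f s ∈ S then 1 else 0, Finset.mem_univ _, ?_⟩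
    ext z
    simp only [Finset.mem_image, Finset.mem_filter, Finset.mem_univ, true_and]
    constructor
    · rintro ⟨s, hs, rfl⟩
      by_contra h
      simp [h] at hs
    · intro hz
      obtain ⟨s, rfl⟩ := exists_atypVal (hS hz)
      exact ⟨s, by simp [hz], rfl⟩
  · intro θ _
    rw [K_Ltheta, Finset.card_image_of_injective _ hinj]
    congr 2
    rw [Finset.card_filter]
    refine Finset.sum_congr rfl fun s _ => ?_
    generalize θ s = x
    fin_cases x <;> rfl

end

section

variable {m n : ℕ}

/-! ### The inverse expansion -/

/-- An unoccupied vertex lies below no cap, so a cap from it to the next unoccupied vertex crosses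
nothing and leaves the other caps as they are. -/
theorem IsCapping.insert {N H : Finset ℤ} {e : ℤ → ℤ} (h : IsCapping N H e) {z : ℤ}
    (hz : z ∉ N ∪ H ∪ H.image e) : IsCapping N (insert z H)
      (Function.update e z (nextFree (N ∪ H ∪ H.image e) z)) := by
  obtain ⟨h1, h2⟩ := nextFree_mem (N ∪ H ∪ H.image e) z
  have h3 := fun y => mem_of_lt_nextFree (H := N ∪ H ∪ H.image e) (c := z) (z := y)
  generalize nextFree (N ∪ H ∪ H.image e) z = z' at *
  simp only [Finset.mem_union, Finset.mem_image, not_or, not_exists, not_and] at hz h2 h3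
  have hu : ∀ c ∈ H, Function.update e z z' c = e c := fun c hc =>
    Function.update_of_ne (by rintro rfl; exact hz.1.2 hc) _ _
  have hcases : ∀ c ∈ Insert.insert z H, (c = z ∧ Function.update e z z' c = z') ∨
      (c ∈ H ∧ Function.update e z z' c = e c) := fun c hc => by
    rcases Finset.mem_insert.1 hc with rfl | hc
    · exact Or.inl ⟨rfl, Function.update_self _ _ _⟩
    · exact Or.inr ⟨hc, hu c hc⟩
  refine ⟨?_, ?_, ?_, ?_, ?_, ?_⟩
  · intro c hc
    rcases hcases c hc with ⟨rfl, h4⟩ | ⟨hc, h4⟩ <;> rw [h4]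
    · exact h1
    · exact h.lt c hc
  · intro c hc
    rcases hcases c hc with ⟨rfl, h4⟩ | ⟨hc, h4⟩ <;> rw [h4]
    · exact h2.1.1
    · exact h.notMem_N c hc
  · intro c hc
    rw [Finset.mem_insert, not_or]
    rcases hcases c hc with ⟨rfl, h4⟩ | ⟨hc, h4⟩ <;> rw [h4]
    · exact ⟨h1.ne', h2.1.2⟩
    · exact ⟨hz.2 c hc, h.notMem_D c hc⟩
  · intro c hc
    rcases Finset.mem_insert.1 hc with rfl | hc
    · exact hz.1.1
    · exact h.disj c hc
  · intro c hc c' hc' heq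
    rcases hcases c hc with ⟨rfl, h4⟩ | ⟨hc, h4⟩ <;>
      rcases hcases c' hc' with ⟨h6, h5⟩ | ⟨hc', h5⟩ <;> rw [h4, h5] at heq
    · exact h6.symm
    · exact absurd heq.symm (h2.2 c' hc')
    · exact absurd heq (h2.2 c hc)
    · exact h.inj c hc c' hc' heq
  · intro c hc y hy1 hy2 hyN
    rcases hcases c hc with ⟨rfl, h4⟩ | ⟨hc, h4⟩ <;> rw [h4] at hy2
    · rcases h3 y hy1 hy2 with (h5 | h5) | ⟨c', h5, rfl⟩
      · exact absurd h5 hyN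
      · exact Or.inl (Finset.mem_insert_of_mem h5)
      · refine Or.inr ⟨c', Finset.mem_insert_of_mem h5, ?_, (hu c' h5).symm⟩
        -- A cap that starts before the new vertex and ends beyond it would have the new vertex
        -- below it.
        by_contra h6
        have h7 : c' < c := lt_of_le_of_ne (not_lt.1 h6) (by rintro rfl; exact hz.1.2 h5)
        rcases h.nested c' h5 c h7 hy1 hz.1.1 with h8 | ⟨c'', h8, -, h9⟩
        · exact hz.1.2 h8
        · exact hz.2 c'' h8 h9.symm
    · rcases h.nested c hc y hy1 hy2 hyN with h5 | ⟨c', h5, h6, rfl⟩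
      · exact Or.inl (Finset.mem_insert_of_mem h5)
      · exact Or.inr ⟨c', Finset.mem_insert_of_mem h5, h6, (hu c' h5).symm⟩

/-- The vertices that belong to the cap diagram with vertices `H`. -/
def occupied (N H : Finset ℤ) : Finset ℤ := N ∪ H ∪ H.image (capEnd N H)

theorem capEnd_insert {N H : Finset ℤ} (hH : ∀ c ∈ H, c ∉ N) {z : ℤ} (hz : z ∉ occupied N H) :
    capEnd N (insert z H) z = nextFree (occupied N H) z ∧
      ∀ c ∈ H, capEnd N (insert z H) c = capEnd N H c := by
  have h := (isCapping_capEnd hH).insert hz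
  have h' := (isCapping_capEnd h.disj).unique h
  refine ⟨by rw [h' z (Finset.mem_insert_self _ _), Function.update_self]; rfl, fun c hc => ?_⟩
  rw [h' c (Finset.mem_insert_of_mem hc), Function.update_of_ne]
  rintro rfl
  exact hz (Finset.mem_union_left _ (Finset.mem_union_right _ hc))

theorem notMem_occupied_of_lt {N H : Finset ℤ} (hH : ∀ c ∈ H, c ∉ N) {z : ℤ} (hz : z ∉ N)
    (hlt : ∀ c ∈ H, z < c) : z ∉ occupied N H := by
  simp only [occupied, Finset.mem_union, Finset.mem_image, not_or]
  refine ⟨⟨hz, fun h => lt_irrefl _ (hlt z h)⟩, ?_⟩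
  rintro ⟨c, hc, rfl⟩
  exact lt_asymm (hlt c hc) ((isCapping_capEnd hH).lt c hc)

theorem iterate_nextFree_notMem {G : Finset ℤ} {z : ℤ} (hz : z ∉ G) (k : ℕ) :
    (nextFree G)^[k] z ∉ G := by
  cases k with
  | zero => exact hz
  | succ k => rw [Function.iterate_succ_apply']; exact nextFree_notMem _ _

theorem le_iterate_nextFree (G : Finset ℤ) (z : ℤ) (k : ℕ) : z + k ≤ (nextFree G)^[k] z := by
  induction k with
  | zero => simp
  | succ k ih =>
    rw [Function.iterate_succ_apply']
    have := lt_nextFree G ((nextFree G)^[k] z)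
    push_cast
    omega

/-- A vertex is replaced step by step by the start of a cap. -/
theorem capSum_expand {V : Type*} [AddCommGroup V] [Module Qq V] (κ : Finset ℤ → Finset ℤ → V)
    {N H : Finset ℤ} (hH : ∀ c ∈ H, c ∉ N) {z : ℤ} (hz : z ∉ occupied N H) (X Y : Finset ℤ)
    (T : ℕ) :
    capSum κ H (capEnd N H) (insert z X) (insert z Y) =
      (∑ j ∈ Finset.range T, (-q) ^ j • capSum κ (insert ((nextFree (occupied N H))^[j] z) H)
        (capEnd N (insert ((nextFree (occupied N H))^[j] z) H)) X Y) +
      (-q) ^ T • capSum κ H (capEnd N H) (insert ((nextFree (occupied N H))^[T] z) X)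
        (insert ((nextFree (occupied N H))^[T] z) Y) := by
  induction T with
  | zero => simp
  | succ T ih =>
    rw [ih, Finset.sum_range_succ, add_assoc]
    congr 1
    have h1 := iterate_nextFree_notMem hz T
    rw [Function.iterate_succ_apply']
    generalize (nextFree (occupied N H))^[T] z = y at *
    have h2 := capEnd_insert hH h1
    -- Splitting the cap that starts at `y` and solving for the double label there: it equals the
    -- sum with this cap minus `q` times the double label at the next unoccupied vertex.
    rw [capSum_insert κ (fun h => h1 (Finset.mem_union_left _ (Finset.mem_union_right _ h))), h2.1,
      capSum_congr κ h2.2, capSum_congr κ h2.2, pow_succ,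
      smul_add, mul_neg, neg_smul, mul_smul]
    abel

/-! #### The sequence of lowerings -/

/-- The values of `p` from position `k` on. -/
def tail {r : ℕ} (p : Fin r → ℤ) (k : ℕ) : Finset ℤ :=
  (Finset.univ.filter fun t : Fin r => k ≤ t).image p

theorem mem_tail {r : ℕ} {p : Fin r → ℤ} {k : ℕ} {z : ℤ} :
    z ∈ tail p k ↔ ∃ t : Fin r, k ≤ t ∧ p t = z := by
  simp [tail]

theorem tail_eq_insert {r : ℕ} (p : Fin r → ℤ) (k : Fin r) :
    tail p k = insert (p k) (tail p (k + 1)) := by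
  ext z
  rw [Finset.mem_insert, mem_tail, mem_tail]
  constructor
  · rintro ⟨t, ht, rfl⟩
    rcases eq_or_lt_of_le ht with h | h
    · exact Or.inl (by rw [Fin.ext h])
    · exact Or.inr ⟨t, h, rfl⟩
  · rintro (rfl | ⟨t, ht, rfl⟩)
    · exact ⟨k, le_rfl, rfl⟩
    · exact ⟨t, by omega, rfl⟩

theorem tail_congr {r : ℕ} {p p' : Fin r → ℤ} {k : ℕ} (h : ∀ t : Fin r, k ≤ t → p t = p' t) :
    tail p k = tail p' k :=
  Finset.image_congr fun t ht => h t (by simpa using ht)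

/-- The values of `p` that can arise from those of `f` by lowerings in the order of the
indices. -/
def Admissible (f : ZPlus m n) (p : Fin (atyp f.1) → ℤ) : Prop :=
  ∀ t : Fin (atyp f.1), p t ∉ occupied (onlySet f) (tail p (t + 1))

namespace Admissible

variable {f : ZPlus m n} {p : Fin (atyp f.1) → ℤ}

theorem notMem (hp : Admissible f p) (t : Fin (atyp f.1)) : p t ∉ onlySet f := fun h =>
  hp t (Finset.mem_union_left _ (Finset.mem_union_left _ h))

theorem tail_notMem (hp : Admissible f p) (k : ℕ) : ∀ c ∈ tail p k, c ∉ onlySet f := by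
  intro c hc
  obtain ⟨t, -, rfl⟩ := mem_tail.1 hc
  exact hp.notMem t

theorem ne_of_lt (hp : Admissible f p) {t u : Fin (atyp f.1)} (h : t < u) : p t ≠ p u := fun he =>
  hp t (Finset.mem_union_left _ (Finset.mem_union_right _ (mem_tail.2 ⟨u, h, he.symm⟩)))

theorem injective (hp : Admissible f p) : Function.Injective p := by
  intro t u h
  rcases lt_trichotomy t u with h1 | h1 | h1
  · exact absurd h (hp.ne_of_lt h1)
  · exact h1
  · exact absurd h.symm (hp.ne_of_lt h1)

/-- By admissibility each value is unoccupied when it is added to the later ones, so it does not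
disturb their caps. -/
theorem capEnd_tail (hp : Admissible f p) (k : ℕ) : ∀ t : Fin (atyp f.1), k ≤ t →
    capEnd (onlySet f) (tail p k) (p t) =
      nextFree (occupied (onlySet f) (tail p (t + 1))) (p t) := by
  obtain ⟨j, hj⟩ : ∃ j, atyp f.1 ≤ k + j := ⟨_, Nat.le_add_left _ _⟩
  induction j generalizing k with
  | zero => intro t ht; omega
  | succ j ih =>
    intro t ht
    have hk : k < atyp f.1 := ht.trans_lt t.2
    obtain ⟨s, rfl⟩ : ∃ s : Fin (atyp f.1), k = s := ⟨⟨k, hk⟩, rfl⟩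
    have h1 := capEnd_insert (hp.tail_notMem (s + 1)) (hp s)
    rw [tail_eq_insert]
    rcases eq_or_lt_of_le ht with h | h
    · obtain rfl := Fin.ext h
      exact h1.1
    · rw [h1.2 _ (mem_tail.2 ⟨t, h, rfl⟩)]
      exact ih (s + 1) (by omega) t h

/-- The cap ends in the diagrams of the tails solve the recursion of `lower_withVals`. An earlier
value never blocks such an end, since admissibility keeps it away from the caps of the later values.
-/
theorem lower (hp : Admissible f p) (s : Fin (atyp f.1)) :
    lowerAt f s (withVals f p) = withVals f (Function.update p s
      (nextFree (occupied (onlySet f) (tail p (s + 1))) (p s))) := by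
  refine lower_withVals f hp.injective hp.notMem
    (ε := fun t => nextFree (occupied (onlySet f) (tail p (t + 1))) (p t)) s fun t _ => ?_
  symm
  apply nextFree_eq (lt_nextFree _ _)
  · have h1 := nextFree_notMem (occupied (onlySet f) (tail p (t + 1))) (p t)
    simp only [Finset.mem_union, Finset.mem_image, Finset.mem_univ, true_and, Finset.mem_filter,
      not_or]
    refine ⟨⟨fun h => h1 (Finset.mem_union_left _ (Finset.mem_union_left _ h)), ?_⟩, ?_⟩
    · rintro ⟨u, hu⟩
      rcases lt_trichotomy u t with h2 | rfl | h2
      · refine hp u ?_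
        rw [hu, ← hp.capEnd_tail (u + 1) t h2]
        exact Finset.mem_union_right _ (Finset.mem_image_of_mem _ (mem_tail.2 ⟨t, h2, rfl⟩))
      · exact (lt_nextFree _ _).ne hu
      · refine h1 (hu ▸ ?_)
        exact Finset.mem_union_left _ (Finset.mem_union_right _ (mem_tail.2 ⟨u, h2, rfl⟩))
    · rintro ⟨u, h2, hu⟩
      refine h1 (hu ▸ ?_)
      rw [← hp.capEnd_tail (t + 1) u h2]
      exact Finset.mem_union_right _ (Finset.mem_image_of_mem _ (mem_tail.2 ⟨u, h2, rfl⟩))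
  · intro y h1 h2
    have h3 := mem_of_lt_nextFree h1 h2
    simp only [occupied, Finset.mem_union, Finset.mem_image, Finset.mem_univ, true_and,
      Finset.mem_filter] at h3 ⊢
    rcases h3 with (h3 | h3) | ⟨c, h3, rfl⟩
    · exact Or.inl (Or.inl h3)
    · obtain ⟨u, -, rfl⟩ := mem_tail.1 h3
      exact Or.inl (Or.inr ⟨u, rfl⟩)
    · obtain ⟨u, h4, rfl⟩ := mem_tail.1 h3
      exact Or.inr ⟨u, h4, (hp.capEnd_tail (t + 1) u h4).symm⟩

end Admissible

/-- The unmoved values before `s` lie to the left of everything later, hence of every cap, wherever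
the later values have gone. -/
theorem admissible_update (f : ZPlus m n) {p : Fin (atyp f.1) → ℤ} (hp : Admissible f p)
    {s : Fin (atyp f.1)} (hlow : ∀ t, t < s → p t = atypVal f t)
    (hge : ∀ t, s < t → atypVal f t ≤ p t) {z : ℤ} (hz : atypVal f s ≤ z)
    (hz' : z ∉ occupied (onlySet f) (tail p (s + 1))) :
    Admissible f (Function.update p s z) := by
  have hup : ∀ k : ℕ, s < k → tail (Function.update p s z) k = tail p k := fun k hk =>
    tail_congr fun t ht => Function.update_of_ne (by rintro rfl; omega) _ _
  have hN : ∀ t, Function.update p s z t ∉ onlySet f := fun t => by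
    by_cases hts : t = s
    · subst hts
      rw [Function.update_self]
      exact fun h => hz' (Finset.mem_union_left _ (Finset.mem_union_left _ h))
    · rw [Function.update_of_ne hts]
      exact hp.notMem t
  intro t
  rcases lt_trichotomy t s with h | rfl | h
  · refine notMem_occupied_of_lt (fun c hc => ?_) (hN t) fun c hc => ?_
    · obtain ⟨u, -, rfl⟩ := mem_tail.1 hc
      exact hN u
    · obtain ⟨u, hu, rfl⟩ := mem_tail.1 hc
      rw [Function.update_of_ne h.ne, hlow t h]
      refine (atypVal_strictMono f (show t < u from hu)).trans_le ?_
      rcases lt_trichotomy u s with h1 | rfl | h1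
      · rw [Function.update_of_ne h1.ne, hlow u h1]
      · rwa [Function.update_self]
      · rw [Function.update_of_ne h1.ne']
        exact hge u h1
  · rw [Function.update_self, hup _ (by omega)]
    exact hz'
  · have : (s : ℕ) < t := h
    rw [Function.update_of_ne h.ne', hup _ (by omega)]
    exact hp t

theorem admissible_atypVal (f : ZPlus m n) : Admissible f (atypVal f) := by
  have hN : ∀ t, atypVal f t ∉ onlySet f := fun t => (isCapping_capOf f).disj _ (atypVal_mem f t)
  refine fun t : Fin (atyp f.1) => notMem_occupied_of_lt (fun c hc => ?_) (hN t) fun c hc => ?_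
  · obtain ⟨u, -, rfl⟩ := mem_tail.1 hc
    exact hN u
  · obtain ⟨u, hu, rfl⟩ := mem_tail.1 hc
    exact atypVal_strictMono f hu

/-- The values at the indices `i_s` after the lowerings in the positions from `k` on. -/
def chain (f : ZPlus m n) (θ : Fin (atyp f.1) → ℕ) (k : ℕ) : Fin (atyp f.1) → ℤ :=
  ((List.finRange (atyp f.1)).drop k).foldr (fun s p => Function.update p s
    ((nextFree (occupied (onlySet f) (tail p (s + 1))))^[θ s] (p s))) (atypVal f)

section

variable (f : ZPlus m n)

theorem chain_of_le (θ : Fin (atyp f.1) → ℕ) {k : ℕ} (hk : atyp f.1 ≤ k) :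
    chain f θ k = atypVal f := by
  rw [chain, List.drop_eq_nil_of_le (by simpa using hk), List.foldr_nil]

theorem drop_finRange {r : ℕ} (s : Fin r) :
    (List.finRange r).drop s = s :: (List.finRange r).drop (s + 1) := by
  rw [List.drop_eq_getElem_cons (by simp), List.getElem_finRange]
  rfl

theorem chain_eq (θ : Fin (atyp f.1) → ℕ) (s : Fin (atyp f.1)) :
    chain f θ s = Function.update (chain f θ (s + 1)) s
      ((nextFree (occupied (onlySet f) (tail (chain f θ (s + 1)) (s + 1))))^[θ s]
        (chain f θ (s + 1) s)) := by
  rw [chain, drop_finRange, List.foldr_cons]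
  rfl

theorem chain_induction {P : ℕ → Prop} (r : ℕ) (h0 : ∀ k, r ≤ k → P k)
    (h1 : ∀ s : Fin r, P (s + 1) → P s) (k : ℕ) : P k := by
  obtain ⟨j, hj⟩ : ∃ j, r ≤ k + j := ⟨_, Nat.le_add_left _ _⟩
  induction j generalizing k with
  | zero => exact h0 k hj
  | succ j ih =>
    by_cases hk : k < r
    · exact h1 ⟨k, hk⟩ (ih (k + 1) (by omega))
    · exact h0 k (not_lt.1 hk)

theorem chain_congr {θ θ' : Fin (atyp f.1) → ℕ} (k : ℕ)
    (h : ∀ t : Fin (atyp f.1), k ≤ t → θ t = θ' t) : chain f θ k = chain f θ' k := by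
  induction k using chain_induction (atyp f.1) with
  | h0 k hk => rw [chain_of_le f θ hk, chain_of_le f θ' hk]
  | h1 s ih => rw [chain_eq, chain_eq f θ', ih fun t ht => h t (by omega), h s le_rfl]

/-- Induction from the last index down, the order in which `L'_θ` acts. The lower bound on the
values serves two purposes: it keeps unmoved values to the left, and it later gives convergence. -/
theorem chain_spec (θ : Fin (atyp f.1) → ℕ) (k : ℕ) : Admissible f (chain f θ k) ∧
    (∀ t : Fin (atyp f.1), t < k → chain f θ k t = atypVal f t) ∧
    (∀ t : Fin (atyp f.1), k ≤ t → atypVal f t + θ t ≤ chain f θ k t) ∧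
    ((List.finRange (atyp f.1)).drop k).foldr (fun s g => (lowerAt f s)^[θ s] g) f.1 =
      withVals f (chain f θ k) := by
  induction k using chain_induction (atyp f.1) with
  | h0 k hk =>
    rw [chain_of_le f θ hk, List.drop_eq_nil_of_le (by simpa using hk), List.foldr_nil,
      withVals_atypVal]
    exact ⟨admissible_atypVal f, fun _ _ => rfl, fun t ht => by omega, rfl⟩
  | h1 s ih =>
    obtain ⟨h1, h2, h3, h4⟩ := ih
    rw [drop_finRange, List.foldr_cons, h4, chain_eq]
    set p := chain f θ (s + 1) with hp
    set G := occupied (onlySet f) (tail p (s + 1)) with hG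
    have hps : p s = atypVal f s := h2 s (by omega)
    have hadm : ∀ j : ℕ, Admissible f (Function.update p s ((nextFree G)^[j] (p s))) := fun j => by
      refine admissible_update f h1 (fun t ht => h2 t ?_) (fun t ht => ?_) ?_
        (iterate_nextFree_notMem (h1 s) j)
      · have : (t : ℕ) < s := ht
        omega
      · have := h3 t ht
        omega
      · have := le_iterate_nextFree G (p s) j
        omega
    refine ⟨hadm _, ?_, ?_, ?_⟩
    · intro t ht
      rw [Function.update_of_ne (by rintro rfl; omega)]
      exact h2 t (by omega)
    · intro t ht
      by_cases hts : t = s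
      · subst hts
        rw [Function.update_self, ← hps]
        exact le_iterate_nextFree _ _ _
      · rw [Function.update_of_ne hts]
        exact h3 t (by have := fun h => hts (Fin.ext h); omega)
    · generalize θ s = j
      induction j with
      | zero => simp
      | succ j ih =>
        -- Repeated lowering at `s` leaves the later values alone, so all its steps refer to the
        -- same occupied set.
        have htail : tail (Function.update p s ((nextFree G)^[j] (p s))) (s + 1) = tail p (s + 1) :=
          tail_congr fun t ht => Function.update_of_ne (by rintro rfl; omega) _ _
        rw [Function.iterate_succ_apply', ih, (hadm j).lower, Function.update_self,
          Function.update_idem, Function.iterate_succ_apply', htail]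

/-- The values of `f` at the indices `i_s` before position `k`. -/
def heads (k : ℕ) : Finset ℤ :=
  (Finset.univ.filter fun t : Fin (atyp f.1) => (t : ℕ) < k).image (atypVal f)

theorem heads_succ (s : Fin (atyp f.1)) : heads f (s + 1) = insert (atypVal f s) (heads f s) := by
  ext z
  simp only [heads, Finset.mem_insert, Finset.mem_image, Finset.mem_filter, Finset.mem_univ,
    true_and]
  constructor
  · rintro ⟨t, ht, rfl⟩
    by_cases hts : t = s
    · exact Or.inl (by rw [hts])
    · exact Or.inr ⟨t, by have := fun h => hts (Fin.ext h); omega, rfl⟩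
  · rintro (rfl | ⟨t, ht, rfl⟩)
    · exact ⟨s, by omega, rfl⟩
    · exact ⟨t, by omega, rfl⟩

/-- The vector obtained from `K_f` by expanding the positions from `k` on. -/
def partialVec (θ : Fin (atyp f.1) → ℕ) (k : ℕ) : EHat m n :=
  capSum Kset (tail (chain f θ k) k) (capEnd (onlySet f) (tail (chain f θ k) k))
    (leftOnly f ∪ heads f k) (rightOnly f ∪ heads f k)

theorem partialVec_of_le (θ : Fin (atyp f.1) → ℕ) {k : ℕ} (hk : atyp f.1 ≤ k) :
    partialVec f θ k = K f := by
  have h1 : tail (chain f θ k) k = ∅ := by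
    rw [Finset.eq_empty_iff_forall_notMem]
    intro z hz
    obtain ⟨t, ht, -⟩ := mem_tail.1 hz
    omega
  have h2 : heads f k = bothSet f := by
    rw [← image_atypVal, heads, Finset.filter_true_of_mem fun t _ => t.2.trans_le hk]
  rw [partialVec, h1, capSum_empty, h2, leftOnly_union, rightOnly_union, Kset_sets]

theorem partialVec_zero (θ : Fin (atyp f.1) → ℕ) :
    partialVec f θ 0 = capBasis (Ltheta' f θ) ∧
      ∀ s, atypVal f s + θ s ∈ {z | ∃ y ∈ leftSet (Ltheta' f θ).1, z ≤ y} := by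
  obtain ⟨h1, -, h3, h4⟩ := chain_spec f θ 0
  have h5 : Ltheta' f θ = dom (withVals f (chain f θ 0)) := by
    rw [← h4, List.drop_zero]; rfl
  obtain ⟨h6, h7⟩ := sets_dom_withVals f h1.injective h1.notMem
  rw [← h5] at h6 h7
  have h8 : tail (chain f θ 0) 0 = Finset.univ.image (chain f θ 0) := by
    rw [tail, Finset.filter_true_of_mem fun t _ => Nat.zero_le _]
  have h9 : heads f 0 = ∅ := by simp [heads]
  constructor
  · rw [partialVec, h9, Finset.union_empty, Finset.union_empty]
    rw [← h8] at h6 h7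
    exact capSum_eq_capBasis (isCapping_capEnd (h1.tail_notMem 0)) (disjoint_only f) h6 h7
  · intro s
    refine ⟨chain f θ 0 s, ?_, h3 s (Nat.zero_le _)⟩
    rw [h6]
    exact Finset.mem_union_right _ (Finset.mem_image_of_mem _ (Finset.mem_univ _))

theorem coeffE_capSum_insert {D : Finset ℤ} {e : ℤ → ℤ} {X Y : Finset ℤ} {z b : ℤ}
    {g : ZPlus m n} (hg : Below b g) (hz : b < z) :
    coeffE (capSum Kset D e (insert z X) Y) g = 0 := by
  classical
  rw [capSum, map_sum, Finset.sum_apply]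
  refine Finset.sum_eq_zero fun S _ => ?_
  rw [map_smul, Pi.smul_apply, coeffE_Kset, if_neg, smul_zero]
  rintro ⟨h, -⟩
  have : z ∈ leftSet g.1 := by
    rw [h]
    exact Finset.mem_union_left _ (Finset.mem_insert_self _ _)
  exact absurd (below_iff.1 hg z (Or.inl this)) (not_le.2 hz)

/-- The double label at `atypVal f s` is expanded by `capSum_expand`. After `T` steps the label of
the remainder is beyond the bound `b`, so the remainder is invisible in the truncation. -/
theorem coeffE_partialVec_succ (θ : Fin (atyp f.1) → ℕ) (s : Fin (atyp f.1)) {T : ℕ} {b : ℤ}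
    (hT : b < atypVal f s + T) {g : ZPlus m n} (hg : Below b g) :
    coeffE (partialVec f θ (s + 1)) g =
      ∑ j ∈ Finset.range T, (-q) ^ j * coeffE (partialVec f (Function.update θ s j) s) g := by
  obtain ⟨h1, h2, -, -⟩ := chain_spec f θ (s + 1)
  have hc : ∀ j, chain f (Function.update θ s j) s = Function.update (chain f θ (s + 1)) s
      ((nextFree (occupied (onlySet f) (tail (chain f θ (s + 1)) (s + 1))))^[j]
        (atypVal f s)) := fun j => by
    rw [chain_eq, chain_congr f (θ' := θ) (s + 1) fun t ht =>
      Function.update_of_ne (by rintro rfl; omega) _ _, Function.update_self, h2 s (by omega)]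
  have hps : chain f θ (s + 1) s = atypVal f s := h2 s (by omega)
  have hz := h1 s
  rw [hps] at hz
  rw [partialVec, heads_succ, Finset.union_insert, Finset.union_insert,
    capSum_expand Kset (h1.tail_notMem (s + 1)) hz _ _ T, map_add, Pi.add_apply, map_smul,
    Pi.smul_apply, coeffE_capSum_insert hg (hT.trans_le (le_iterate_nextFree _ _ _)), smul_zero,
    add_zero, map_sum, Finset.sum_apply]
  refine Finset.sum_congr rfl fun j _ => ?_
  rw [map_smul, Pi.smul_apply, smul_eq_mul, partialVec, hc, tail_eq_insert, Function.update_self]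
  have htail : ∀ z, tail (Function.update (chain f θ (s + 1)) s z) (s + 1) =
      tail (chain f θ (s + 1)) (s + 1) := fun z =>
    tail_congr fun t ht => Function.update_of_ne (by rintro rfl; omega) _ _
  rw [htail]

/-- The multiindices that are bounded from position `k` on and zero before. -/
def box (r T k : ℕ) : Finset (Fin r → ℕ) :=
  Fintype.piFinset fun t => if k ≤ t then Finset.range T else {0}

theorem mem_box {r T k : ℕ} {θ : Fin r → ℕ} :
    θ ∈ box r T k ↔ ∀ t : Fin r, (k ≤ t → θ t < T) ∧ (t < k → θ t = 0) := by
  rw [box, Fintype.mem_piFinset]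
  refine forall_congr' fun t => ?_
  by_cases h : k ≤ t
  · simp [h, not_lt.2 h]
  · simp [h, not_le.1 h]

theorem sum_box {A : Type*} [AddCommMonoid A] {r T : ℕ} (s : Fin r) (φ : (Fin r → ℕ) → A) :
    ∑ θ ∈ box r T s, φ θ =
      ∑ θ ∈ box r T (s + 1), ∑ j ∈ Finset.range T, φ (Function.update θ s j) := by
  rw [← Finset.sum_product']
  refine Finset.sum_bij' (fun θ _ => (Function.update θ s 0, θ s))
    (fun x _ => Function.update x.1 s x.2) ?_ ?_ ?_ ?_ ?_
  · intro θ hθ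
    rw [mem_box] at hθ
    rw [Finset.mem_product, mem_box, Finset.mem_range]
    refine ⟨fun t => ?_, (hθ s).1 le_rfl⟩
    by_cases hts : t = s
    · subst hts; simp
    · change (_ → Function.update θ s 0 t < T) ∧ (_ → Function.update θ s 0 t = 0)
      rw [Function.update_of_ne hts]
      have := fun h => hts (Fin.ext h)
      exact ⟨fun h => (hθ t).1 (by omega), fun h => (hθ t).2 (by omega)⟩
  · rintro ⟨θ, j⟩ hx
    rw [Finset.mem_product, mem_box, Finset.mem_range] at hx
    rw [mem_box]
    intro t
    by_cases hts : t = s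
    · subst hts
      simp only [Function.update_self]
      exact ⟨fun _ => hx.2, fun h => absurd h (lt_irrefl _)⟩
    · rw [Function.update_of_ne hts]
      have := fun h => hts (Fin.ext h)
      exact ⟨fun h => (hx.1 t).1 (by omega), fun h => (hx.1 t).2 (by omega)⟩
  · intro θ _
    simp
  · rintro ⟨θ, j⟩ hx
    rw [Finset.mem_product, mem_box] at hx
    have : θ s = 0 := (hx.1 s).2 (by omega)
    simp only [Function.update_idem, Function.update_self, Prod.mk.injEq, and_true]
    rw [← this, Function.update_eq_self]
  · intro θ _
    simp

/-- From `K f`, with no cap yet, the positions are expanded one after another from the last to the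
first. Entries of `θ` before `k` are set to zero so that each multiindex is counted once. -/
theorem coeffE_K_eq_sum {T : ℕ} {b : ℤ} (hT : ∀ s, b < atypVal f s + T) {g : ZPlus m n}
    (hg : Below b g) (k : ℕ) : coeffE (K f) g =
      ∑ θ ∈ box (atyp f.1) T k, (-q) ^ (∑ s, θ s) * coeffE (partialVec f θ k) g := by
  induction k using chain_induction (atyp f.1) with
  | h0 k hk =>
    have : box (atyp f.1) T k = {0} := by
      ext θ
      rw [mem_box, Finset.mem_singleton, funext_iff]
      exact forall_congr' fun t => ⟨fun h => h.2 (by omega), fun h => ⟨by omega, fun _ => h⟩⟩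
    rw [this, Finset.sum_singleton, partialVec_of_le f 0 hk]
    simp
  | h1 s ih =>
    rw [ih, sum_box]
    refine Finset.sum_congr rfl fun θ hθ => ?_
    rw [coeffE_partialVec_succ f θ s (hT s) hg, Finset.mul_sum]
    refine Finset.sum_congr rfl fun j _ => ?_
    rw [← mul_assoc, ← pow_add]
    congr 2
    have h0 : θ s = 0 := (mem_box.1 hθ s).2 (by omega)
    rw [← Finset.add_sum_erase _ θ (Finset.mem_univ s),
      ← Finset.add_sum_erase _ (Function.update θ s j) (Finset.mem_univ s), Function.update_self,
      h0, zero_add, add_comm]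
    congr 1
    exact Finset.sum_congr rfl fun t ht =>
      (Function.update_of_ne (Finset.ne_of_mem_erase ht) _ _).symm

theorem hasSum_K_capBasis :
    HasSum (fun θ : Fin (atyp f.1) → ℕ => (-q) ^ (∑ s, θ s) • capBasis (Ltheta' f θ)) (K f) := by
  rw [hasSum_EHat]
  intro b
  obtain ⟨T, hT⟩ : ∃ T : ℕ, ∀ s, b < atypVal f s + T := by
    obtain ⟨c, hc⟩ := (Set.finite_range (atypVal f)).bddBelow
    refine ⟨(b - c + 1).toNat, fun s => ?_⟩
    have : c ≤ atypVal f s := hc ⟨s, rfl⟩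
    omega
  refine ⟨box (atyp f.1) T 0, fun t ht g hg => ?_⟩
  rw [coeffE_K_eq_sum f hT hg 0]
  symm
  rw [← Finset.sum_subset ht]
  · refine Finset.sum_congr rfl fun θ _ => ?_
    rw [(partialVec_zero f θ).1, map_smul, Pi.smul_apply, smul_eq_mul]
  · intro θ _ hθ
    rw [mem_box] at hθ
    -- Outside the box `L'_θ(f)` has a value beyond `b`. As the terms of its canonical vector only
    -- go further up, it has no coefficient below `b`.
    obtain ⟨s, hs⟩ : ∃ s, T ≤ θ s := by
      by_contra! h
      exact hθ fun t => ⟨fun _ => h t, fun h' => by omega⟩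
    rw [map_smul, Pi.smul_apply]
    by_contra hne
    have h1 : coeffE (capBasis (Ltheta' f θ)) g ≠ 0 := fun h => hne (by rw [h, smul_zero])
    have h2 := below_iff.1 (unitriangular_capBasis.below _ _ _ h1 hg)
    obtain ⟨y, hy, hy'⟩ := (partialVec_zero f θ).2 s
    have h3 := h2 y (Or.inl hy)
    have h4 := hT s
    omega

end

end

end GLmn
end

theorem mainTheorem5 (m n : ℕ) :
    (∃! bar : GLmn.EHat m n →ₛₗ[GLmn.barQ] GLmn.EHat m n, GLmn.IsBar bar) ∧
    ∀ bar : GLmn.EHat m n →ₛₗ[GLmn.barQ] GLmn.EHat m n, GLmn.IsBar bar →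
      (∃! U : GLmn.ZPlus m n → GLmn.EHat m n, GLmn.IsCanonicalBasis bar U) ∧
      ∀ U : GLmn.ZPlus m n → GLmn.EHat m n, GLmn.IsCanonicalBasis bar U →
        ∀ f : GLmn.ZPlus m n,
          U f = ∑ θ : Fin (GLmn.atyp f.1) → Fin 2,
            GLmn.q ^ (∑ s, (θ s : ℕ)) • GLmn.K (GLmn.Ltheta f (fun s => (θ s : ℕ))) ∧
          HasSum (fun θ : Fin (GLmn.atyp f.1) → ℕ =>
            (-GLmn.q) ^ (∑ s, θ s) • U (GLmn.Ltheta' f θ)) (GLmn.K f) := by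
  refine ⟨⟨GLmn.barE m n, GLmn.isBar_barE, fun bar hbar => hbar.eq_barE⟩, fun bar hbar => ?_⟩
  rw [hbar.eq_barE]
  refine ⟨⟨GLmn.capBasis, GLmn.isCanonicalBasis_capBasis, fun U hU => hU.eq_capBasis⟩,
    fun U hU f => ?_⟩
  rw [hU.eq_capBasis]
  exact ⟨GLmn.capBasis_eq_sum f, GLmn.hasSum_K_capBasis f⟩
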